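/- Let $n$ and $k$ be integers with $1\le k\le n-1$ and $k\neq n-k$. Let $V$ be an $n$-dimensional vector space over a field of characteristic $\neq 2$, equipped with a nondegenerate symplectic (alternating bilinear) form $\xi$. For a subspace $U$ of $V$ put $U^\perp=\{v\in V:\xi(u,v)=0\text{ for all }u\in U\}$ and $\mathrm{Rad}(U)=U\cap U^\perp$; call $U$ regular if $\dim\mathrm{Rad}(U)=0$ and tangential if $\dim\mathrm{Rad}(U)=1$. For $0\le j\le n$ let $(\mathbf{T\text{-}R})_j$ be the set of all $j$-dimensional subspaces of $V$ that are regular or tangential. For $1\le j\le n-1$ the Grassmann space $\mathbf{P}((\mathbf{T\text{-}R}),j)$ is the point-line geometry with point set $(\mathbf{T\text{-}R})_j$ whose lines are the nonempty pencils $\{U\in(\mathbf{T\text{-}R})_j: H\subseteq U\subseteq B\}$ with $H\in(\mathbf{T\text{-}R})_{j-1}$, $B\in(\mathbf{T\text{-}R})_{j+1}$, $H\subseteq B$. Two distinct elements of $(\mathbf{T\text{-}R})_j$ are adjacent, written $U\sim W$, if some line of $\mathbf{P}((\mathbf{T\text{-}R}),j)$ contains both. (i) If $k>1$, then $\mathbf{P}((\mathbf{T\text{-}R}),k-1)$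 can be defined in terms of the structure $\langle(\mathbf{T\text{-}R})_k,\sim\rangle$, and hence also in terms of $\mathbf{P}((\mathbf{T\text{-}R}),k)$. (ii) If $k<n-1$, then $\mathbf{P}((\mathbf{T\text{-}R}),k+1)$ can be defined in terms of the structure $\langle(\mathbf{T\text{-}R})_k,\sim\rangle$, and hence also in terms of $\mathbf{P}((\mathbf{T\text{-}R}),k)$. Here "can be defined" means: there are first-order formulas without parameters, in the language of the structure from which one defines and depending only on $n$ and $k$ (not on the field, on $V$ or on $\xi$), that interpret the point-line geometry $\mathbf{P}((\mathbf{T\text{-}R}),k\mp1)$, i.e. points and lines are the classes of tuples of fixed lengths satisfying given formulas modulo definable equivalence relations, and the incidence of points with lines is definable. Moreover, each $X\in(\mathbf{T\text{-}R})_{k\mp1}$ is hereby identified with the set of the $U\in(\mathbf{T\text{-}R})_k$ incident with it: the relation $X\subseteq U$ in case (i), and $U\subseteq X$ in case (ii), between tuples representing $X$ and elements $U\in(\mathbf{T\text{-}R})_k$ is given by one of the formulas. -/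

import Mathlib

universe u v

namespace SympGrassmann

/-! ### First-order definability of a point-line geometry in a structure -/

/-- Relation symbols of the language of point-line geometries: "is a point", "lies on". -/
inductive PLRel : ℕ → Type
  | point : PLRel 1
  | inc : PLRel 2

/-- The first-order language of point-line geometries. -/
def plLanguage : FirstOrder.Language.{0, 0} := ⟨fun _ => Empty, PLRel⟩

/-- A point-line geometry with point set `P` and set of lines `Ln` (lines are sets of points), as a
first-order structure. The two sorts are put in one universe `P ⊕ Ln`; an element is a line
exactly if it is not a point. -/
@[reducible]
def plStructure {P : Type*} (Ln : Set (Set P)) : plLanguage.Structure (P ⊕ Ln) where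
  funMap := fun f _ => Empty.elim f
  RelMap
    | .point => fun x => ∃ p : P, x 0 = Sum.inl p
    | .inc => fun x => ∃ (p : P) (l : Ln), x 0 = Sum.inl p ∧ x 1 = Sum.inr l ∧ p ∈ l.1

/-- A parameter-free first-order definition scheme in the language `L` for a point-line geometry:
points are given by tuples of length `ptDim` satisfying `ptDom` modulo `ptEq`, lines by tuples of
length `lnDim` satisfying `lnDom` modulo `lnEq`, and `inc` expresses that a point is on a line.
The formula `link` expresses a relation between the defined points and the elements of the
structure in which the definition takes place. -/
structure GeometryScheme (L : FirstOrder.Language.{0, 0}) where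
  ptDim : ℕ
  lnDim : ℕ
  ptDom : L.Formula (Fin ptDim)
  ptEq : L.Formula (Fin ptDim ⊕ Fin ptDim)
  lnDom : L.Formula (Fin lnDim)
  lnEq : L.Formula (Fin lnDim ⊕ Fin lnDim)
  inc : L.Formula (Fin ptDim ⊕ Fin lnDim)
  link : L.Formula (Fin ptDim ⊕ Unit)

/-- The scheme `S`, evaluated in the structure `M`, defines the point-line geometry `(P, Ln)`
(an interpretation without parameters in the usual model-theoretic sense), and it does so in such
a way that the relation `R` between the points of this geometry and the elements of `M` is
defined by `S.link`. -/
def GeometryScheme.Defines {L : FirstOrder.Language.{0, 0}} (S : GeometryScheme L)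
    (M : Type*) [L.Structure M] {P : Type*} (Ln : Set (Set P)) (R : P → M → Prop) : Prop :=
  ∃ (f : {x : Fin S.ptDim → M // S.ptDom.Realize x} → P)
    (g : {y : Fin S.lnDim → M // S.lnDom.Realize y} → Ln),
    Function.Surjective f ∧ Function.Surjective g ∧
    (∀ x x', S.ptEq.Realize (Sum.elim x.1 x'.1) ↔ f x = f x') ∧
    (∀ y y', S.lnEq.Realize (Sum.elim y.1 y'.1) ↔ g y = g y') ∧
    (∀ x y, S.inc.Realize (Sum.elim x.1 y.1) ↔ f x ∈ (g y).1) ∧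
    (∀ x m, S.link.Realize (Sum.elim x.1 (fun _ : Unit => m)) ↔ R (f x) m)

/-! ### Regular and tangential subspaces, their Grassmann spaces and adjacency -/

section

variable {K V : Type*} [Field K] [AddCommGroup V] [Module K V]

/-- The radical `U ∩ U^⊥` of a subspace. -/
def rad (ξ : LinearMap.BilinForm K V) (U : Submodule K V) : Submodule K V :=
  U ⊓ ξ.orthogonal U

/-- `U` is regular if its radical is zero. -/
def IsRegular (ξ : LinearMap.BilinForm K V) (U : Submodule K V) : Prop :=
  rad ξ U = ⊥

/-- `U` is tangential if its radical is a projective point. -/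
def IsTangential (ξ : LinearMap.BilinForm K V) (U : Submodule K V) : Prop :=
  Module.finrank K (rad ξ U) = 1

/-- The regular or tangential subspaces of (linear) dimension `k`. -/
abbrev TR (ξ : LinearMap.BilinForm K V) (k : ℕ) : Type _ :=
  {U : Submodule K V // Module.finrank K U = k ∧ (IsRegular ξ U ∨ IsTangential ξ U)}

/-- The nonempty pencils `{U ∈ (T-R)_k : H ⊆ U ⊆ B}`, where `H ∈ (T-R)_{k-1}`,
`B ∈ (T-R)_{k+1}` and `H ⊆ B`. These are the lines of the Grassmann space on `(T-R)_k`. -/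
def pencils (ξ : LinearMap.BilinForm K V) (k : ℕ) : Set (Set (TR ξ k)) :=
  {l | l.Nonempty ∧ ∃ (j : ℕ) (H : TR ξ j) (B : TR ξ (k + 1)),
    j + 1 = k ∧ H.1 ≤ B.1 ∧ l = {U | H.1 ≤ U.1 ∧ U.1 ≤ B.1}}

/-- Adjacency on `(T-R)_k`: two distinct elements are adjacent if they are collinear in the
Grassmann space. -/
def adjacency (ξ : LinearMap.BilinForm K V) (k : ℕ) : SimpleGraph (TR ξ k) where
  Adj U W := U ≠ W ∧ ∃ l ∈ pencils ξ k, U ∈ l ∧ W ∈ l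
  symm := ⟨fun _ _ h => ⟨h.1.symm, h.2.imp fun _ hl => ⟨hl.1, hl.2.2, hl.2.1⟩⟩⟩
  loopless := ⟨fun _ h => h.1 rfl⟩

/-- The set `(T-R)_k` with its binary adjacency, as a first-order structure. -/
instance adjacencyStructure (ξ : LinearMap.BilinForm K V) (k : ℕ) :
    FirstOrder.Language.graph.Structure (TR ξ k) :=
  (adjacency ξ k).structure

/-- The Grassmann space `((T-R)_k, pencils)`, as a first-order structure. -/
instance grassmannStructure (ξ : LinearMap.BilinForm K V) (k : ℕ) :
    plLanguage.Structure (TR ξ k ⊕ pencils ξ k) :=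
  plStructure (pencils ξ k)

end

/-- The data of the ambient symplectic space: characteristic different from two, `ξ` a
nondegenerate symplectic form, and `dim V = n`. -/
def IsSymplecticSpace {K V : Type*} [Field K] [AddCommGroup V] [Module K V]
    (ξ : LinearMap.BilinForm K V) (n : ℕ) : Prop :=
  ringChar K ≠ 2 ∧ FiniteDimensional K V ∧ Module.finrank K V = n ∧ ξ.IsAlt ∧ ξ.Nondegenerate

/-- For symplectic spaces of dimension `n`, the Grassmann space on `(T-R)_j` can be defined in
terms of the binary adjacency on `(T-R)_k`, each `X ∈ (T-R)_j` being identified with the set of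
the `U ∈ (T-R)_k` incident with it (comparable by inclusion). The formulas depend on the
dimensions alone. -/
def DefinableFromAdjacency (n k j : ℕ) : Prop :=
  ∃ S : GeometryScheme FirstOrder.Language.graph,
    ∀ (K : Type u) (V : Type v) [Field K] [AddCommGroup V] [Module K V]
      (ξ : LinearMap.BilinForm K V), IsSymplecticSpace ξ n →
      S.Defines (TR ξ k) (pencils ξ j) (fun X U => X.1 ≤ U.1 ∨ U.1 ≤ X.1)

/-- The same, in terms of the Grassmann space on `(T-R)_k`. -/
def DefinableFromGrassmann (n k j : ℕ) : Prop :=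
  ∃ S : GeometryScheme plLanguage,
    ∀ (K : Type u) (V : Type v) [Field K] [AddCommGroup V] [Module K V]
      (ξ : LinearMap.BilinForm K V), IsSymplecticSpace ξ n →
      S.Defines (TR ξ k ⊕ pencils ξ k) (pencils ξ j)
        (fun X m => ∃ U : TR ξ k, m = Sum.inl U ∧ (X.1 ≤ U.1 ∨ U.1 ≤ X.1))

end SympGrassmann

/-! The dimension of the radical of U has the parity of dim U. So V has even dimension, elements of
`TR ξ k` are regular for even k, and they have a radical of dimension one for odd k. The duality U ↦
U^⊥ carries `TR ξ k` to `TR ξ (n - k)` and preserves lines and adjacency, so it suffices to descend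
from even k to k - 1 and to ascend from odd k to k + 1. The statement about the Grassmann space
follows because adjacency is collinearity.

Even k. Adjacency only says that the meet is a hyperplane of both elements (`adj_iff_of_even`). The
maximal cliques are stars (all elements above some X of dimension k - 1) and tops (all elements
below some Y of dimension k + 1), and each star arises from a triple (`starAt_or_topAt`,
`exists_starAt`). Two stars share exactly one element when X ⊔ X' is regular of dimension k.
Adjacency of X and X' also needs X ⊓ X' to be regular; a configuration of three further stars
detects this (`adj_of_adjByJoin`, `adjByJoin_of_adj`).

Odd k. Adjacency requires both meet and join to be regular. The hyperplanes of a regular Y of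
dimension k + 1 are the x^⊥ ∩ Y, and two of them are adjacent exactly if their poles are not
orthogonal (`adj_hyperplane_iff`). For k = 1 the points of Y form a double orthogonal complement.
For k ≥ 3 one takes non-adjacent pairs s, t whose common neighbours contain a diamond; such a pair
meets in a hyperplane and has a regular join or a regular meet (`regular_of_isPure`). In the first
case its hull is the set of all elements below the join (`inHull_iff`), in the second, dually, the
set of those above the meet.

Stars and tops must finally be told apart without parameters. Nonorthogonality on a regular space of
dimension d admits triangular systems of length r exactly for r ≤ d (`hasTriangular_iff`). This is
first-order for each fixed r and reads off dimensions: k against n - k in the even case, k + 1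
against n - k + 1 in the odd case. Here k ≠ n - k is essential, since otherwise the duality
interchanges the two kinds. -/

namespace SympGrassmann

open FirstOrder FirstOrder.Language FirstOrder.Language.Structure

/-! ### Relations definable by one formula in all graphs -/

/-- The relation `R`, given on every set with a binary relation, is defined by a single
parameter-free formula in the language of graphs. -/
def UniformlyDefinable {α : Type} (R : ∀ M : Type v, (M → M → Prop) → (α → M) → Prop) : Prop :=
  ∃ φ : Language.graph.Formula α, ∀ (M : Type v) [Language.graph.Structure M] (x : α → M),
    φ.Realize x ↔ R M (fun a b => RelMap adj ![a, b]) x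

namespace UniformlyDefinable

variable {α β : Type} {R R' : ∀ M : Type v, (M → M → Prop) → (α → M) → Prop}

theorem rel (a b : α) : UniformlyDefinable.{v} fun _ A x => A (x a) (x b) :=
  ⟨adj.formula₂ (.var a) (.var b), fun M _ x => by simp [Formula.realize_rel₂]⟩

theorem eq (a b : α) : UniformlyDefinable.{v} fun _ _ x => x a = x b :=
  ⟨(Term.var a).equal (.var b), fun M _ x => by simp⟩

theorem not (h : UniformlyDefinable R) : UniformlyDefinable fun M A x => ¬ R M A x := by
  obtain ⟨φ, hφ⟩ := h
  exact ⟨φ.not, fun M _ x => by rw [Formula.realize_not, hφ]⟩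

theorem and (h : UniformlyDefinable R) (h' : UniformlyDefinable R') :
    UniformlyDefinable fun M A x => R M A x ∧ R' M A x := by
  obtain ⟨φ, hφ⟩ := h
  obtain ⟨ψ, hψ⟩ := h'
  exact ⟨φ ⊓ ψ, fun M _ x => by rw [Formula.realize_inf, hφ, hψ]⟩

theorem or (h : UniformlyDefinable R) (h' : UniformlyDefinable R') :
    UniformlyDefinable fun M A x => R M A x ∨ R' M A x := by
  obtain ⟨φ, hφ⟩ := h
  obtain ⟨ψ, hψ⟩ := h'
  exact ⟨φ ⊔ ψ, fun M _ x => by rw [Formula.realize_sup, hφ, hψ]⟩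

theorem imp (h : UniformlyDefinable R) (h' : UniformlyDefinable R') :
    UniformlyDefinable fun M A x => R M A x → R' M A x := by
  obtain ⟨φ, hφ⟩ := h
  obtain ⟨ψ, hψ⟩ := h'
  exact ⟨φ.imp ψ, fun M _ x => by rw [Formula.realize_imp, hφ, hψ]⟩

theorem iff (h : UniformlyDefinable R) (h' : UniformlyDefinable R') :
    UniformlyDefinable fun M A x => R M A x ↔ R' M A x := by
  obtain ⟨φ, hφ⟩ := h
  obtain ⟨ψ, hψ⟩ := h'
  exact ⟨φ.iff ψ, fun M _ x => by rw [Formula.realize_iff, hφ, hψ]⟩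

theorem forall_index {ι : Type} [Finite ι]
    {R : ι → ∀ M : Type v, (M → M → Prop) → (α → M) → Prop}
    (h : ∀ i, UniformlyDefinable (R i)) : UniformlyDefinable fun M A x => ∀ i, R i M A x := by
  choose φ hφ using h
  exact ⟨Formula.iInf φ, fun M _ x => by simp only [Formula.realize_iInf, hφ]⟩

theorem imp_of_const {p : Prop} (h : UniformlyDefinable R) :
    UniformlyDefinable fun M A x => p → R M A x := by
  by_cases hp : p
  · simpa [hp] using h
  · exact ⟨⊤, fun M _ x => by simp [hp]⟩

theorem exists_tuple [Finite β] {Q : ∀ M : Type v, (M → M → Prop) → (α → M) → (β → M) → Prop}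
    (h : UniformlyDefinable fun M A (x : α ⊕ β → M) => Q M A (x ∘ Sum.inl) (x ∘ Sum.inr)) :
    UniformlyDefinable fun M A x => ∃ z : β → M, Q M A x z := by
  obtain ⟨φ, hφ⟩ := h
  exact ⟨φ.iExs β, fun M _ x => by simp [Formula.realize_iExs, hφ]⟩

theorem forall_tuple [Finite β] {Q : ∀ M : Type v, (M → M → Prop) → (α → M) → (β → M) → Prop}
    (h : UniformlyDefinable fun M A (x : α ⊕ β → M) => Q M A (x ∘ Sum.inl) (x ∘ Sum.inr)) :
    UniformlyDefinable fun M A x => ∀ z : β → M, Q M A x z := by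
  obtain ⟨φ, hφ⟩ := h
  exact ⟨φ.iAlls β, fun M _ x => by simp [Formula.realize_iAlls, hφ]⟩

theorem exists_elem {Q : ∀ M : Type v, (M → M → Prop) → (α → M) → M → Prop}
    (h : UniformlyDefinable fun M A (x : α ⊕ Unit → M) =>
      Q M A (x ∘ Sum.inl) (x (Sum.inr ()))) :
    UniformlyDefinable fun M A x => ∃ z : M, Q M A x z := by
  obtain ⟨φ, hφ⟩ := h
  refine ⟨φ.iExs Unit, fun M _ x => ?_⟩
  simp only [Formula.realize_iExs, hφ, Sum.elim_comp_inl, Sum.elim_inr]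
  exact ⟨fun ⟨i, hi⟩ => ⟨i (), hi⟩, fun ⟨z, hz⟩ => ⟨fun _ => z, hz⟩⟩

theorem forall_elem {Q : ∀ M : Type v, (M → M → Prop) → (α → M) → M → Prop}
    (h : UniformlyDefinable fun M A (x : α ⊕ Unit → M) =>
      Q M A (x ∘ Sum.inl) (x (Sum.inr ()))) :
    UniformlyDefinable fun M A x => ∀ z : M, Q M A x z := by
  obtain ⟨φ, hφ⟩ := h
  refine ⟨φ.iAlls Unit, fun M _ x => ?_⟩
  simp only [Formula.realize_iAlls, hφ, Sum.elim_comp_inl, Sum.elim_inr]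
  exact ⟨fun h z => h fun _ => z, fun h i => h (i ())⟩

/-- Uniformly definable relations are preserved by isomorphisms. -/
theorem iff_of_equiv (h : UniformlyDefinable R) {M M' : Type v} {A : M → M → Prop}
    {A' : M' → M' → Prop} (e : M ≃ M') (he : ∀ a b, A a b ↔ A' (e a) (e b)) (x : α → M) :
    R M A x ↔ R M' A' (e ∘ x) := by
  obtain ⟨φ, hφ⟩ := h
  let _ : Language.graph.Structure M := { RelMap := fun | .adj => fun x => A (x 0) (x 1) }
  let _ : Language.graph.Structure M' := { RelMap := fun | .adj => fun x => A' (x 0) (x 1) }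
  let E : M ≃[Language.graph] M' :=
    { e with
      map_fun' := fun f => isEmptyElim f
      map_rel' := fun {n} r x => by
        cases r
        exact (he _ _).symm }
  have h1 := hφ M x
  have h2 := hφ M' (e ∘ x)
  have h3 : φ.Realize (E ∘ x) ↔ φ.Realize x := StrongHomClass.realize_formula E φ
  exact h1.symm.trans (h3.symm.trans h2)

end UniformlyDefinable

/-! ### Transport of definitions -/

/-- Formulas are invariant under isomorphism, so the same scheme serves both structures. This is
what lets duality transfer a definition without changing any formula. -/
theorem GeometryScheme.Defines.of_equiv {L : FirstOrder.Language.{0, 0}} {S : GeometryScheme L}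
    {M M' P P' : Type*} [L.Structure M] [L.Structure M'] {Ln : Set (Set P)} {Ln' : Set (Set P')}
    {R : P → M → Prop} {R' : P' → M' → Prop} (e : M ≃[L] M') (p : P ≃ P')
    (hLn : ∀ l, p ⁻¹' l ∈ Ln ↔ l ∈ Ln') (hR : ∀ x m, R x m ↔ R' (p x) (e m))
    (h : S.Defines M' Ln' R') : S.Defines M Ln R := by
  obtain ⟨f, g, hf, hg, hfe, hge, hinc, hlink⟩ := h
  have key : ∀ {α : Type} (φ : L.Formula α) (x : α → M), φ.Realize (e ∘ x) ↔ φ.Realize x :=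
    fun φ x => StrongHomClass.realize_formula e φ
  have comp : ∀ {α β : Type} (x : α → M) (y : β → M),
      Sum.elim (e ∘ x) (e ∘ y) = e ∘ Sum.elim x y := fun x y => (Sum.comp_elim _ _ _).symm
  have key' : ∀ {α : Type} (φ : L.Formula α) (x : α → M'),
      φ.Realize (e.symm ∘ x) ↔ φ.Realize x := fun φ x => StrongHomClass.realize_formula e.symm φ
  have cancel : ∀ {α : Type} (x : α → M'), e ∘ (e.symm ∘ x) = x := fun x => by
    ext; simp
  refine ⟨fun x => p.symm (f ⟨e ∘ x.1, (key _ _).2 x.2⟩),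
    fun y => ⟨p ⁻¹' (g ⟨e ∘ y.1, (key _ _).2 y.2⟩).1, (hLn _).2 (g _).2⟩, ?_, ?_, ?_, ?_, ?_, ?_⟩
  · intro q
    obtain ⟨x, hx⟩ := hf (p q)
    refine ⟨⟨e.symm ∘ x.1, (key' _ _).2 x.2⟩, ?_⟩
    simp only [cancel, Subtype.coe_eta, hx, Equiv.symm_apply_apply]
  · intro l
    have hl : p.symm ⁻¹' l.1 ∈ Ln' := by
      rw [← hLn, ← Set.preimage_comp]
      simp
    obtain ⟨y, hy⟩ := hg ⟨_, hl⟩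
    refine ⟨⟨e.symm ∘ y.1, (key' _ _).2 y.2⟩, ?_⟩
    apply Subtype.ext
    simp only [cancel, Subtype.coe_eta, hy, ← Set.preimage_comp]
    simp
  · intro x x'
    rw [← key, ← comp, hfe ⟨_, (key _ _).2 x.2⟩ ⟨_, (key _ _).2 x'.2⟩, p.symm.injective.eq_iff]
  · intro y y'
    rw [← key, ← comp, hge ⟨_, (key _ _).2 y.2⟩ ⟨_, (key _ _).2 y'.2⟩, Subtype.ext_iff,
      Subtype.ext_iff, p.surjective.preimage_injective.eq_iff]
  · intro x y
    rw [← key, ← comp, hinc ⟨_, (key _ _).2 x.2⟩ ⟨_, (key _ _).2 y.2⟩]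
    simp
  · intro x m
    rw [← key, ← comp, hR]
    simpa using! hlink ⟨_, (key _ _).2 x.2⟩ (e m)

/-! ### From the collinearity graph to the geometry -/

/-- The collinearity graph of a point-line geometry, as a structure. -/
@[reducible]
def collinearityStructure {P : Type*} (Ln : Set (Set P)) : Language.graph.Structure P where
  funMap := fun f _ => Empty.elim f
  RelMap | .adj => fun x => x 0 ≠ x 1 ∧ ∃ l ∈ Ln, x 0 ∈ l ∧ x 1 ∈ l

/-- Quantifiers are relativised to points, and adjacency is unfolded as being distinct and on a
common line. -/
theorem exists_translation {α : Type} {n : ℕ} (φ : Language.graph.BoundedFormula α n) :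
    ∃ ψ : plLanguage.BoundedFormula α n, ∀ (P : Type v) (Ln : Set (Set P)) (x : α → P)
      (y : Fin n → P),
      @BoundedFormula.Realize _ _ (plStructure Ln) _ _ ψ (Sum.inl ∘ x) (Sum.inl ∘ y) ↔
        @BoundedFormula.Realize _ _ (collinearityStructure Ln) _ _ φ x y := by
  induction φ with
  | falsum => exact ⟨⊥, fun P Ln x y => Iff.rfl⟩
  | equal t₁ t₂ =>
    rcases t₁ with a | ⟨f, -⟩
    · rcases t₂ with b | ⟨f, -⟩
      · refine ⟨.equal (.var a) (.var b), fun P Ln x y => ?_⟩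
        simp only [BoundedFormula.Realize, Term.realize_var, ← Sum.comp_elim, Function.comp_apply,
          Sum.inl.injEq]
      · exact Empty.elim f
    · exact Empty.elim f
  | @rel n _ r ts =>
    cases r
    obtain ⟨a, ha⟩ : ∃ a, ts 0 = .var a := by
      rcases ts 0 with a | ⟨f, -⟩
      exacts [⟨a, rfl⟩, Empty.elim f]
    obtain ⟨b, hb⟩ : ∃ b, ts 1 = .var b := by
      rcases ts 1 with a | ⟨f, -⟩
      exacts [⟨a, rfl⟩, Empty.elim f]
    let up : α ⊕ Fin n → plLanguage.Term (α ⊕ Fin (n + 1)) :=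
      fun c => .var (Sum.map id Fin.castSucc c)
    let R : plLanguage.Relations 2 := PLRel.inc
    let ln : plLanguage.Term (α ⊕ Fin (n + 1)) := .var (.inr (Fin.last n))
    -- The new variable need not be restricted to lines, since `PLRel.inc` holds only when its
    -- second argument is a line.
    refine ⟨(BoundedFormula.equal (.var a) (.var b)).not ⊓
      ((R.boundedFormula₂ (up a) ln) ⊓ (R.boundedFormula₂ (up b) ln)).ex, fun P Ln x y => ?_⟩
    have hup : ∀ (l : P ⊕ Ln) (c : α ⊕ Fin n), @Term.realize _ _ (plStructure Ln) _
        (Sum.elim (Sum.inl ∘ x) (Fin.snoc (α := fun _ => P ⊕ Ln) (Sum.inl ∘ y) l)) (up c) =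
        Sum.inl (Sum.elim x y c) := by
      rintro l (c | c) <;> simp [up]
    have hln : ∀ (l : P ⊕ Ln), @Term.realize _ _ (plStructure Ln) _
        (Sum.elim (Sum.inl ∘ x) (Fin.snoc (α := fun _ => P ⊕ Ln) (Sum.inl ∘ y) l)) ln = l := by
      intro l; simp [ln]
    let _ := plStructure Ln
    have hR : ∀ p q : P ⊕ Ln, RelMap R ![p, q] ↔
        ∃ (p' : P) (l : Ln), p = Sum.inl p' ∧ q = Sum.inr l ∧ p' ∈ l.1 := fun p q => Iff.rfl
    have heq : (BoundedFormula.equal (L := plLanguage) (.var a) (.var b)).Realize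
        (M := P ⊕ Ln) (Sum.inl ∘ x) (Sum.inl ∘ y) ↔ Sum.elim x y a = Sum.elim x y b := by
      simp only [BoundedFormula.Realize, Term.realize_var, ← Sum.comp_elim, Function.comp_apply,
          Sum.inl.injEq]
    rw [BoundedFormula.realize_inf, BoundedFormula.realize_not, heq]
    simp only [BoundedFormula.realize_ex, BoundedFormula.realize_inf,
      BoundedFormula.realize_rel₂, hup, hln, hR]
    change _ ↔ (@Term.realize _ _ (collinearityStructure Ln) _ _ (ts 0) ≠
      @Term.realize _ _ (collinearityStructure Ln) _ _ (ts 1) ∧ ∃ l ∈ Ln,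
      @Term.realize _ _ (collinearityStructure Ln) _ _ (ts 0) ∈ l ∧
      @Term.realize _ _ (collinearityStructure Ln) _ _ (ts 1) ∈ l)
    rw [ha, hb]
    simp only [Term.realize_var]
    refine and_congr Iff.rfl ⟨?_, ?_⟩
    · rintro ⟨_, ⟨p, l, h₁, rfl, hp⟩, ⟨q, l', h₂, h₃, hq⟩⟩
      cases h₁; cases h₂; cases h₃
      exact ⟨l.1, l.2, hp, hq⟩
    · rintro ⟨l, hl, hp, hq⟩
      exact ⟨.inr ⟨l, hl⟩, ⟨_, ⟨l, hl⟩, rfl, rfl, hp⟩, ⟨_, ⟨l, hl⟩, rfl, rfl, hq⟩⟩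
  | imp φ ψ h₁ h₂ =>
    obtain ⟨φ', h₁⟩ := h₁
    obtain ⟨ψ', h₂⟩ := h₂
    refine ⟨φ'.imp ψ', fun P Ln x y => ?_⟩
    simp only [BoundedFormula.realize_imp, h₁, h₂]
  | @all n φ h =>
    obtain ⟨φ', h⟩ := h
    let R : plLanguage.Relations 1 := PLRel.point
    refine ⟨((R.boundedFormula₁ (.var (.inr (Fin.last n)))).imp φ').all, fun P Ln x y => ?_⟩
    let _ := plStructure Ln
    let _ := collinearityStructure Ln
    have hR : ∀ p : P ⊕ Ln, RelMap R ![p] ↔ ∃ p' : P, p = Sum.inl p' := fun p => Iff.rfl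
    have hsnoc : ∀ p : P, (Fin.snoc (α := fun _ => P ⊕ Ln) (Sum.inl ∘ y) (Sum.inl p) :
        Fin (n + 1) → P ⊕ Ln) = Sum.inl ∘ (Fin.snoc y p : Fin (n + 1) → P) :=
      fun p => (Fin.comp_snoc _ _ _).symm
    rw [BoundedFormula.realize_all, BoundedFormula.realize_all]
    simp only [BoundedFormula.realize_imp, BoundedFormula.realize_rel₁, Term.realize_var,
      Sum.elim_inr, Fin.snoc_last, hR]
    constructor
    · intro H p
      have := H (.inl p) ⟨p, rfl⟩
      rw [hsnoc, h] at this
      exact this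
    · rintro H _ ⟨p, rfl⟩
      rw [hsnoc, h]
      exact H p

theorem exists_formula_translation {α : Type} (φ : Language.graph.Formula α) :
    ∃ ψ : plLanguage.Formula α, ∀ (P : Type v) (Ln : Set (Set P)) (x : α → P),
      @Formula.Realize _ _ (plStructure Ln) _ ψ (Sum.inl ∘ x) ↔
        @Formula.Realize _ _ (collinearityStructure Ln) _ φ x := by
  obtain ⟨ψ, hψ⟩ := exists_translation.{v} φ
  refine ⟨ψ, fun P Ln x => ?_⟩
  let _ := plStructure Ln
  let _ := collinearityStructure Ln
  rw [Formula.Realize, Formula.Realize, ← hψ P Ln x default]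
  exact iff_of_eq (congrArg _ (Subsingleton.elim _ _))

/-- All entries of the tuple are points. -/
theorem exists_pointFormula (ι : Type) [Finite ι] :
    ∃ ψ : plLanguage.Formula ι, ∀ (P : Type v) (Ln : Set (Set P)) (x : ι → P ⊕ Ln),
      @Formula.Realize _ _ (plStructure Ln) _ ψ x ↔ ∃ y : ι → P, x = Sum.inl ∘ y := by
  let R : plLanguage.Relations 1 := PLRel.point
  refine ⟨Formula.iInf fun i : ι => R.formula₁ (.var i), fun P Ln x => ?_⟩
  let _ := plStructure Ln
  have hR : ∀ p : P ⊕ Ln, RelMap R ![p] ↔ ∃ p' : P, p = Sum.inl p' := fun p => Iff.rfl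
  simp only [Formula.realize_iInf, Formula.realize_rel₁, Term.realize_var, hR]
  refine ⟨fun h => ?_, ?_⟩
  · choose y hy using h
    exact ⟨y, funext hy⟩
  · rintro ⟨y, rfl⟩ i
    exact ⟨y i, rfl⟩

/-- The translated formulas are controlled only on tuples of points, so the two domain formulas and
`link` must also demand that all entries are points. The other formulas are evaluated only on tuples
from these domains. -/
theorem exists_scheme_translation (S : GeometryScheme Language.graph) :
    ∃ S' : GeometryScheme plLanguage, ∀ (P : Type v) (Ln : Set (Set P)) (Q : Type v)
      (Ln' : Set (Set Q)) (R : Q → P → Prop),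
      @GeometryScheme.Defines _ S P (collinearityStructure Ln) _ Ln' R →
      @GeometryScheme.Defines _ S' (P ⊕ Ln) (plStructure Ln) _ Ln'
        (fun X m => ∃ p : P, m = Sum.inl p ∧ R X p) := by
  obtain ⟨ptDom, hptDom⟩ := exists_formula_translation.{v} S.ptDom
  obtain ⟨ptEq, hptEq⟩ := exists_formula_translation.{v} S.ptEq
  obtain ⟨lnDom, hlnDom⟩ := exists_formula_translation.{v} S.lnDom
  obtain ⟨lnEq, hlnEq⟩ := exists_formula_translation.{v} S.lnEq
  obtain ⟨inc, hinc⟩ := exists_formula_translation.{v} S.inc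
  obtain ⟨link, hlink⟩ := exists_formula_translation.{v} S.link
  obtain ⟨pts, hpts⟩ := exists_pointFormula.{v} (Fin S.ptDim)
  obtain ⟨lns, hlns⟩ := exists_pointFormula.{v} (Fin S.lnDim)
  obtain ⟨pls, hpls⟩ := exists_pointFormula.{v} (Fin S.ptDim ⊕ Unit)
  refine ⟨⟨S.ptDim, S.lnDim, pts ⊓ ptDom, ptEq, lns ⊓ lnDom, lnEq, inc, pls ⊓ link⟩,
    fun P Ln Q Ln' R h => ?_⟩
  let _ := plStructure Ln
  let _ := collinearityStructure Ln
  obtain ⟨f, g, hf, hg, hfe, hge, hfg, hfl⟩ := h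
  have hx : ∀ x : {x : Fin S.ptDim → P ⊕ Ln // (pts ⊓ ptDom).Realize x},
      ∃ y : {y : Fin S.ptDim → P // S.ptDom.Realize y}, x.1 = Sum.inl ∘ y.1 := by
    rintro ⟨x, hx⟩
    rw [Formula.realize_inf, hpts] at hx
    obtain ⟨⟨y, rfl⟩, hy⟩ := hx
    exact ⟨⟨y, (hptDom _ _ _).1 hy⟩, rfl⟩
  have hy : ∀ x : {x : Fin S.lnDim → P ⊕ Ln // (lns ⊓ lnDom).Realize x},
      ∃ y : {y : Fin S.lnDim → P // S.lnDom.Realize y}, x.1 = Sum.inl ∘ y.1 := by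
    rintro ⟨x, hx⟩
    rw [Formula.realize_inf, hlns] at hx
    obtain ⟨⟨y, rfl⟩, hy⟩ := hx
    exact ⟨⟨y, (hlnDom _ _ _).1 hy⟩, rfl⟩
  choose F hF using hx
  choose G hG using hy
  have inj : ∀ {α : Type} {y y' : α → P},
      (Sum.inl ∘ y : α → P ⊕ Ln) = Sum.inl ∘ y' → y = y' :=
    fun h => Sum.inl_injective.comp_left h
  have comp : ∀ {α β : Type} (x : α → P) (y : β → P),
      (Sum.elim (Sum.inl ∘ x) (Sum.inl ∘ y) : α ⊕ β → P ⊕ Ln) = Sum.inl ∘ Sum.elim x y :=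
    fun x y => (Sum.comp_elim _ _ _).symm
  refine ⟨fun x => f (F x), fun y => g (G y), ?_, ?_, ?_, ?_, ?_, ?_⟩
  · intro q
    obtain ⟨y, rfl⟩ := hf q
    refine ⟨⟨Sum.inl ∘ y.1, ?_⟩, ?_⟩
    · rw [Formula.realize_inf, hpts, hptDom]
      exact ⟨⟨_, rfl⟩, y.2⟩
    · exact congrArg f (Subtype.ext (inj (hF ⟨Sum.inl ∘ y.1, _⟩).symm))
  · intro q
    obtain ⟨y, rfl⟩ := hg q
    refine ⟨⟨Sum.inl ∘ y.1, ?_⟩, ?_⟩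
    · rw [Formula.realize_inf, hlns, hlnDom]
      exact ⟨⟨_, rfl⟩, y.2⟩
    · exact congrArg g (Subtype.ext (inj (hG ⟨Sum.inl ∘ y.1, _⟩).symm))
  · intro x x'
    rw [hF, hF, comp, hptEq, hfe]
  · intro y y'
    rw [hG, hG, comp, hlnEq, hge]
  · intro x y
    rw [hF, hG, comp, hinc, hfg]
  · intro x m
    rw [Formula.realize_inf, hpls, hF]
    constructor
    · rintro ⟨⟨y, hy⟩, hl⟩
      have h0 : m = Sum.inl (y (.inr ())) := congrFun hy (.inr ())
      subst h0
      refine ⟨_, rfl, (hfl _ _).1 ?_⟩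
      rw [← hlink, ← comp]
      exact hl
    · rintro ⟨p, rfl, hp⟩
      refine ⟨⟨Sum.elim (F x).1 fun _ => p, (comp _ _)⟩, ?_⟩
      rw [← hfl, ← hlink, ← comp] at hp
      exact hp

theorem DefinableFromAdjacency.definableFromGrassmann {n k j : ℕ}
    (h : DefinableFromAdjacency.{u, v} n k j) : DefinableFromGrassmann.{u, v} n k j := by
  obtain ⟨S, hS⟩ := h
  obtain ⟨S', hS'⟩ := exists_scheme_translation.{v} S
  refine ⟨S', fun K V _ _ _ ξ hξ => hS' _ _ _ _ _ ?_⟩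
  convert hS K V ξ hξ using 1
  apply Structure.ext
  · funext n f
    exact Empty.elim f
  · funext n r
    cases r
    rfl

end SympGrassmann

namespace SympGrassmann

open Module FirstOrder

set_option linter.unusedSectionVars false

/-! ### Dimension arguments for subspaces -/

section Dimension

variable {K V : Type*} [Field K] [AddCommGroup V] [Module K V] [FiniteDimensional K V]

theorem eq_of_le_of_finrank_eq' {S T : Submodule K V} (h : S ≤ T) (hd : finrank K T ≤ finrank K S) :
    S = T := Submodule.eq_of_le_of_finrank_le h hd

/-- Two distinct hyperplanes of `Y`: their join and the dimension of their meet. -/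
theorem sup_eq_and_finrank_inf {Y U W : Submodule K V} {k : ℕ} (hU : finrank K U = k)
    (hW : finrank K W = k) (hY : finrank K Y = k + 1) (hUY : U ≤ Y) (hWY : W ≤ Y) (hne : U ≠ W) :
    U ⊔ W = Y ∧ finrank K ↥(U ⊓ W) + 1 = k := by
  have h1 := Submodule.finrank_sup_add_finrank_inf_eq U W
  have h2 : finrank K ↥(U ⊔ W) ≤ k + 1 := hY ▸ Submodule.finrank_mono (sup_le hUY hWY)
  have h3 : k < finrank K ↥(U ⊔ W) := by
    by_contra h
    push Not at h
    have e1 : U = U ⊔ W := eq_of_le_of_finrank_eq' le_sup_left (by omega)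
    have e2 : W = U ⊔ W := eq_of_le_of_finrank_eq' le_sup_right (by omega)
    exact hne (e1.trans e2.symm)
  exact ⟨eq_of_le_of_finrank_eq' (sup_le hUY hWY) (by omega), by omega⟩

/-- Two distinct subspaces containing `X` as a hyperplane. -/
theorem inf_eq_and_finrank_sup {X U W : Submodule K V} {k : ℕ} (hU : finrank K U = k)
    (hW : finrank K W = k) (hX : finrank K X + 1 = k) (hXU : X ≤ U) (hXW : X ≤ W) (hne : U ≠ W) :
    U ⊓ W = X ∧ finrank K ↥(U ⊔ W) = k + 1 := by
  have h1 := Submodule.finrank_sup_add_finrank_inf_eq U W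
  have h2 : finrank K X ≤ finrank K ↥(U ⊓ W) := Submodule.finrank_mono (le_inf hXU hXW)
  have h3 : finrank K ↥(U ⊓ W) < k := by
    by_contra h
    push Not at h
    have e1 : U ⊓ W = U := eq_of_le_of_finrank_eq' inf_le_left (by omega)
    have e2 : U ⊓ W = W := eq_of_le_of_finrank_eq' inf_le_right (by omega)
    exact hne (e1.symm.trans e2)
  exact ⟨(eq_of_le_of_finrank_eq' (le_inf hXU hXW) (by omega)).symm, by omega⟩

theorem finrank_sup_of_inf {U W : Submodule K V} {k : ℕ} (hU : finrank K U = k)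
    (hW : finrank K W = k) (h : finrank K ↥(U ⊓ W) + 1 = k) : finrank K ↥(U ⊔ W) = k + 1 := by
  have h1 := Submodule.finrank_sup_add_finrank_inf_eq U W
  omega

/-- A subspace meeting each of `U`, `W` in a hyperplane contains `U ⊓ W` or lies in `U ⊔ W`. -/
theorem inf_le_or_le_sup {U W Z : Submodule K V} {k : ℕ} (hZ : finrank K Z = k)
    (hUW : finrank K ↥(U ⊓ W) + 1 = k) (hUZ : finrank K ↥(Z ⊓ U) + 1 = k)
    (hWZ : finrank K ↥(Z ⊓ W) + 1 = k) : U ⊓ W ≤ Z ∨ Z ≤ U ⊔ W := by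
  -- Equal traces on Z must be U ⊓ W by dimension; two different hyperplanes of Z span Z.
  by_cases h : Z ⊓ U = Z ⊓ W
  · left
    have h1 : Z ⊓ U ≤ U ⊓ W := le_inf inf_le_right (h ▸ inf_le_right)
    rw [← eq_of_le_of_finrank_eq' h1 (by omega)]
    exact inf_le_left
  · right
    obtain ⟨h1, -⟩ := sup_eq_and_finrank_inf (k := k - 1) (by omega) (by omega)
      (show finrank K Z = k - 1 + 1 by omega) inf_le_left inf_le_left h
    rw [← h1]
    exact sup_le_sup inf_le_right inf_le_right

theorem exists_not_mem_of_ne_top {S T : Submodule K V} (hS : S ≠ ⊤) (hT : T ≠ ⊤) :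
    ∃ v, v ∉ S ∧ v ∉ T := by
  obtain ⟨s, -, hs⟩ := SetLike.exists_of_lt hS.lt_top
  obtain ⟨t, -, ht⟩ := SetLike.exists_of_lt hT.lt_top
  by_cases h1 : s ∈ T
  · by_cases h2 : t ∈ S
    · refine ⟨s + t, fun h => hs ?_, fun h => ht ?_⟩
      · simpa using S.sub_mem h h2
      · simpa using T.sub_mem h h1
    · exact ⟨t, h2, ht⟩
  · exact ⟨s, hs, h1⟩

theorem finrank_sup_span_singleton' {H : Submodule K V} {v : V} (hv : v ∉ H) :
    finrank K ↥(H ⊔ K ∙ v) = finrank K H + 1 :=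
  Submodule.finrank_sup_span_singleton hv

theorem finrank_inf_lower (S T : Submodule K V) :
    finrank K S + finrank K T ≤ finrank K V + finrank K ↥(S ⊓ T) := by
  have h1 := Submodule.finrank_sup_add_finrank_inf_eq S T
  have h2 := Submodule.finrank_le (S ⊔ T)
  omega

theorem exists_ne_zero_of_finrank_pos {S : Submodule K V} (h : 0 < finrank K S) :
    ∃ v ∈ S, v ≠ 0 :=
  S.exists_mem_ne_zero_of_ne_bot fun h0 => by rw [h0, finrank_bot] at h; omega

theorem mem_span_singleton_of_finrank_le_one {S : Submodule K V} (h : finrank K S ≤ 1) {v w : V}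
    (hv : v ∈ S) (hw : w ∈ S) (hv0 : v ≠ 0) : w ∈ K ∙ v := by
  have h1 : K ∙ v ≤ S := (Submodule.span_singleton_le_iff_mem _ _).2 hv
  rw [eq_of_le_of_finrank_eq' h1 (by rw [finrank_span_singleton hv0]; exact h)]
  exact hw

end Dimension

/-! ### Radicals -/

section Radical

variable {K V : Type*} [Field K] [AddCommGroup V] [Module K V] {ξ : LinearMap.BilinForm K V}

theorem mem_rad {U : Submodule K V} {x : V} : x ∈ rad ξ U ↔ x ∈ U ∧ ∀ u ∈ U, ξ u x = 0 := Iff.rfl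

theorem rad_le (U : Submodule K V) : rad ξ U ≤ U := inf_le_left

theorem isRegular_iff {U : Submodule K V} :
    IsRegular ξ U ↔ ∀ x ∈ U, (∀ u ∈ U, ξ u x = 0) → x = 0 := by
  rw [IsRegular, Submodule.eq_bot_iff]
  exact ⟨fun h x h1 h2 => h x ⟨h1, h2⟩, fun h x hx => h x hx.1 hx.2⟩

theorem eq_zero_comm (hA : ξ.IsAlt) {x y : V} (h : ξ x y = 0) : ξ y x = 0 :=
  hA.isRefl x y h

variable [FiniteDimensional K V]

theorem isRegular_iff_finrank {U : Submodule K V} :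
    IsRegular ξ U ↔ finrank K (rad ξ U) = 0 := Submodule.finrank_eq_zero.symm

theorem isRegular_or_isTangential_iff {U : Submodule K V} :
    IsRegular ξ U ∨ IsTangential ξ U ↔ finrank K (rad ξ U) ≤ 1 := by
  rw [isRegular_iff_finrank, IsTangential]
  omega

/-- The Gram matrix M is skew-symmetric and invertible; in odd size det M = -det M would contradict
characteristic different from two. -/
theorem IsRegular.even_finrank (hA : ξ.IsAlt) (h2 : (2 : K) ≠ 0) {U : Submodule K V}
    (hU : IsRegular ξ U) : Even (finrank K U) := by
  let b := finBasis K U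
  let M := LinearMap.BilinForm.toMatrix b (ξ.restrict U)
  have hM : M.det ≠ 0 := by
    rw [← LinearMap.BilinForm.nondegenerate_iff_det_ne_zero b]
    refine ⟨fun x hx => ?_, fun x hx => ?_⟩
    · exact Subtype.ext (isRegular_iff.1 hU x x.2 fun u hu => eq_zero_comm hA (hx ⟨u, hu⟩))
    · exact Subtype.ext (isRegular_iff.1 hU x x.2 fun u hu => hx ⟨u, hu⟩)
  have hT : M.transpose = -M := by
    ext i j
    simp only [M, Matrix.transpose_apply, Matrix.neg_apply, LinearMap.BilinForm.toMatrix_apply]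
    exact (hA.neg_eq _ _).symm
  have := congrArg Matrix.det hT
  rw [Matrix.det_transpose, Matrix.det_neg, Fintype.card_fin] at this
  by_contra hodd
  rw [Nat.not_even_iff_odd] at hodd
  rw [hodd.neg_one_pow, neg_one_mul] at this
  have h3 : 2 * M.det = 0 := by linear_combination this
  exact hM ((mul_eq_zero.1 h3).resolve_left h2)

/-- A complement of the radical in U is regular, hence of even dimension. -/
theorem even_finrank_rad_iff (hA : ξ.IsAlt) (h2 : (2 : K) ≠ 0) (U : Submodule K V) :
    Even (finrank K (rad ξ U)) ↔ Even (finrank K U) := by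
  obtain ⟨Q, hQ⟩ := (rad ξ U).exists_isCompl
  have hsup : rad ξ U ⊔ (Q ⊓ U) = U := by
    rw [← sup_inf_assoc_of_le _ (rad_le U), hQ.sup_eq_top, top_inf_eq]
  have hinf : rad ξ U ⊓ (Q ⊓ U) = ⊥ := by
    rw [← inf_assoc, hQ.inf_eq_bot, bot_inf_eq]
  have hreg : IsRegular ξ (Q ⊓ U) := by
    rw [isRegular_iff]
    intro x hx h
    have : x ∈ rad ξ U ⊓ (Q ⊓ U) := by
      refine ⟨mem_rad.2 ⟨hx.2, fun u hu => ?_⟩, hx⟩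
      rw [← hsup] at hu
      obtain ⟨r, hr, c, hc, rfl⟩ := Submodule.mem_sup.1 hu
      rw [map_add, LinearMap.add_apply, h c hc, add_zero]
      exact eq_zero_comm hA (hr.2 x hx.2)
    rw [hinf] at this
    exact this
  have h1 := Submodule.finrank_sup_add_finrank_inf_eq (rad ξ U) (Q ⊓ U)
  rw [hsup, hinf, finrank_bot, add_zero] at h1
  rw [h1, Nat.even_add]
  simp [hreg.even_finrank hA h2]

theorem isRegular_of_even (hA : ξ.IsAlt) (h2 : (2 : K) ≠ 0) {U : Submodule K V}
    (hU : Even (finrank K U)) (h : finrank K (rad ξ U) ≤ 1) : IsRegular ξ U := by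
  rw [isRegular_iff_finrank]
  have := (even_finrank_rad_iff hA h2 U).2 hU
  rcases this with ⟨r, hr⟩
  omega

theorem finrank_rad_of_odd (hA : ξ.IsAlt) (h2 : (2 : K) ≠ 0) {U : Submodule K V}
    (hU : ¬ Even (finrank K U)) (h : finrank K (rad ξ U) ≤ 1) : finrank K (rad ξ U) = 1 := by
  rw [← even_finrank_rad_iff hA h2 U] at hU
  by_contra h1
  exact hU (by rw [show finrank K (rad ξ U) = 0 by omega]; exact ⟨0, rfl⟩)

/-- If w spans U modulo H, the functional ξ w is injective on U ∩ H^⊥: a vector in its kernel is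
orthogonal to all of U. -/
theorem finrank_inf_orthogonal_le_one {H U : Submodule K V}
    (hd : finrank K U = finrank K H + 1) (hHU : H ≤ U) (hU : IsRegular ξ U) :
    finrank K ↥(U ⊓ ξ.orthogonal H) ≤ 1 := by
  obtain ⟨w, hw, hwH⟩ : ∃ w ∈ U, w ∉ H := by
    by_contra! h
    have := Submodule.finrank_mono (show U ≤ H from h)
    omega
  have hsup : H ⊔ K ∙ w = U := eq_of_le_of_finrank_eq'
    (sup_le hHU ((Submodule.span_singleton_le_iff_mem _ _).2 hw))
    (by rw [finrank_sup_span_singleton' hwH, hd])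
  let f : ↥(U ⊓ ξ.orthogonal H) →ₗ[K] K := (ξ w).comp (Submodule.subtype _)
  have hf : Function.Injective f := by
    rw [← LinearMap.ker_eq_bot, LinearMap.ker_eq_bot']
    intro x hx
    refine Subtype.ext (isRegular_iff.1 hU _ x.2.1 fun u hu => ?_)
    rw [← hsup] at hu
    obtain ⟨a, ha, c, hc, rfl⟩ := Submodule.mem_sup.1 hu
    obtain ⟨c, rfl⟩ := Submodule.mem_span_singleton.1 hc
    have h1 : ξ a x.1 = 0 := x.2.2 a ha
    have h2 : ξ w x.1 = 0 := hx
    simp [h1, h2]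
  simpa using LinearMap.finrank_le_finrank_of_injective hf

theorem finrank_rad_le_one_of_le {H U : Submodule K V} (hd : finrank K U = finrank K H + 1)
    (hHU : H ≤ U) (hU : IsRegular ξ U) : finrank K (rad ξ H) ≤ 1 :=
  (Submodule.finrank_mono (inf_le_inf_right _ hHU)).trans
    (finrank_inf_orthogonal_le_one hd hHU hU)

/-- The radical of U meets the regular hyperplane H trivially. -/
theorem finrank_rad_le_one_of_ge {H U : Submodule K V} (hd : finrank K U = finrank K H + 1)
    (hHU : H ≤ U) (hH : IsRegular ξ H) : finrank K (rad ξ U) ≤ 1 := by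
  have h0 : rad ξ U ⊓ H = ⊥ := by
    rw [Submodule.eq_bot_iff]
    intro x hx
    exact isRegular_iff.1 hH x hx.2 fun u hu => hx.1.2 u (hHU hu)
  have h1 := Submodule.finrank_sup_add_finrank_inf_eq (rad ξ U) H
  have h2 : finrank K ↥(rad ξ U ⊔ H) ≤ finrank K U :=
    Submodule.finrank_mono (sup_le (rad_le U) hHU)
  rw [h0, finrank_bot] at h1
  omega

/-! ### Duality -/

theorem orthogonal_orthogonal (hA : ξ.IsAlt) (hN : ξ.Nondegenerate) (U : Submodule K V) :
    ξ.orthogonal (ξ.orthogonal U) = U :=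
  LinearMap.BilinForm.orthogonal_orthogonal hN hA.isRefl U

theorem finrank_add_finrank_orthogonal (hN : ξ.Nondegenerate) (U : Submodule K V) :
    finrank K U + finrank K (ξ.orthogonal U) = finrank K V := by
  have := LinearMap.BilinForm.finrank_orthogonal hN U
  have := Submodule.finrank_le U
  omega

theorem rad_orthogonal (hA : ξ.IsAlt) (hN : ξ.Nondegenerate) (U : Submodule K V) :
    rad ξ (ξ.orthogonal U) = rad ξ U := by
  rw [rad, orthogonal_orthogonal hA hN, rad, inf_comm]

theorem orthogonal_le_orthogonal_iff (hA : ξ.IsAlt) (hN : ξ.Nondegenerate) {U W : Submodule K V} :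
    ξ.orthogonal U ≤ ξ.orthogonal W ↔ W ≤ U := by
  refine ⟨fun h => ?_, LinearMap.BilinForm.orthogonal_le⟩
  rw [← orthogonal_orthogonal hA hN U, ← orthogonal_orthogonal hA hN W]
  exact LinearMap.BilinForm.orthogonal_le h

theorem le_orthogonal_comm (hA : ξ.IsAlt) {U W : Submodule K V} :
    U ≤ ξ.orthogonal W ↔ W ≤ ξ.orthogonal U :=
  ⟨fun h _ hw _ hu => eq_zero_comm hA (h hu _ hw), fun h _ hw _ hu => eq_zero_comm hA (h hu _ hw)⟩

end Radical

/-! ### Hyperplanes of a regular subspace -/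

section PerpIn

variable {K V : Type*} [Field K] [AddCommGroup V] [Module K V]

/-- The vectors of `Y` orthogonal to `x`. -/
def perpIn (ξ : LinearMap.BilinForm K V) (Y : Submodule K V) (x : V) : Submodule K V :=
  Y ⊓ LinearMap.ker (ξ x)

variable {ξ : LinearMap.BilinForm K V}

theorem mem_perpIn {Y : Submodule K V} {x y : V} : y ∈ perpIn ξ Y x ↔ y ∈ Y ∧ ξ x y = 0 := Iff.rfl

theorem perpIn_le {Y : Submodule K V} {x : V} : perpIn ξ Y x ≤ Y := inf_le_left

variable [FiniteDimensional K V] {Y : Submodule K V}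

theorem finrank_perpIn (hA : ξ.IsAlt) (hY : IsRegular ξ Y) {x : V} (hx : x ∈ Y) (hx0 : x ≠ 0) :
    finrank K (perpIn ξ Y x) + 1 = finrank K Y := by
  let f : Y →ₗ[K] K := (ξ x).comp Y.subtype
  have hf : f ≠ 0 := by
    intro h
    refine hx0 (isRegular_iff.1 hY x hx fun u hu => eq_zero_comm hA ?_)
    exact LinearMap.congr_fun h ⟨u, hu⟩
  have h1 := Module.Dual.finrank_ker_add_one_of_ne_zero hf
  rw [← h1]
  congr 1
  have : perpIn ξ Y x = (LinearMap.ker f).map Y.subtype := by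
    ext y
    simp [mem_perpIn, f, and_comm]
  rw [this, Submodule.finrank_map_subtype_eq]

/-- Counting dimensions in V, Y ∩ H^⊥ is nonzero; any nonzero vector in it is a pole of H. -/
theorem exists_eq_perpIn (hA : ξ.IsAlt) (hN : ξ.Nondegenerate) (hY : IsRegular ξ Y)
    {H : Submodule K V} (hHY : H ≤ Y) (hd : finrank K H + 1 = finrank K Y) :
    ∃ x ∈ Y, x ≠ 0 ∧ H = perpIn ξ Y x := by
  have h1 := finrank_inf_lower Y (ξ.orthogonal H)
  have h2 := finrank_add_finrank_orthogonal hN H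
  obtain ⟨x, hx, hx0⟩ := exists_ne_zero_of_finrank_pos (S := Y ⊓ ξ.orthogonal H) (by omega)
  refine ⟨x, hx.1, hx0, eq_of_le_of_finrank_eq' ?_ ?_⟩
  · exact fun y hy => ⟨hHY hy, eq_zero_comm hA (hx.2 y hy)⟩
  · have := finrank_perpIn hA hY hx.1 hx0
    omega

theorem mem_span_of_perpIn_eq (hA : ξ.IsAlt) (hY : IsRegular ξ Y) {x y : V} (hx : x ∈ Y)
    (hx0 : x ≠ 0) (hy : y ∈ Y) (h : perpIn ξ Y x = perpIn ξ Y y) : y ∈ K ∙ x := by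
  refine mem_span_singleton_of_finrank_le_one (finrank_inf_orthogonal_le_one
    (finrank_perpIn hA hY hx hx0).symm perpIn_le hY) ⟨hx, fun u hu => ?_⟩ ⟨hy, fun u hu => ?_⟩ hx0
  · exact eq_zero_comm hA hu.2
  · rw [h] at hu
    exact eq_zero_comm hA hu.2

theorem isRegular_inf_perpIn_iff (hA : ξ.IsAlt) (hY : IsRegular ξ Y) {x y : V} (hx : x ∈ Y)
    (hx0 : x ≠ 0) (hy : y ∈ Y) :
    IsRegular ξ (perpIn ξ Y x ⊓ perpIn ξ Y y) ↔ ξ x y ≠ 0 := by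
  rw [isRegular_iff]
  constructor
  · intro h h0
    exact hx0 (h x ⟨⟨hx, hA x⟩, ⟨hx, eq_zero_comm hA h0⟩⟩ fun u hu => eq_zero_comm hA hu.1.2)
  · intro h0 z hz h
    refine isRegular_iff.1 hY z hz.1.1 fun u hu => ?_
    have hyx : ξ y x = -ξ x y := (hA.neg_eq x y).symm
    -- This removes the component of u in the hyperbolic plane spanned by x and y, to which z is
    -- orthogonal.
    have key : u - (ξ y u / ξ y x) • x - (ξ x u / ξ x y) • y ∈ perpIn ξ Y x ⊓ perpIn ξ Y y := by
      have h1 : ξ x x = 0 := hA x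
      have h2 : ξ y y = 0 := hA y
      have h3 : ξ y x ≠ 0 := by rw [hyx]; exact neg_ne_zero.2 h0
      have h4 := Y.sub_mem (Y.sub_mem hu (Y.smul_mem (ξ y u / ξ y x) hx))
        (Y.smul_mem (ξ x u / ξ x y) hy)
      refine ⟨⟨h4, ?_⟩, ⟨h4, ?_⟩⟩
      · simp [h1, h0]
      · simp [h2, h3]
    have h1 := h _ key
    have h2 : ξ x z = 0 := hz.1.2
    have h3 : ξ y z = 0 := hz.2.2
    simpa [h2, h3] using h1

theorem perpIn_self_mem (hA : ξ.IsAlt) {x : V} (hx : x ∈ Y) : x ∈ perpIn ξ Y x := ⟨hx, hA x⟩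

end PerpIn

/-! ### Regular and tangential subspaces of a symplectic space. -/

section Geometry

variable {K V : Type*} [Field K] [AddCommGroup V] [Module K V]

/-- A nondegenerate alternating form in characteristic different from two. -/
structure IsSymplectic (ξ : LinearMap.BilinForm K V) : Prop where
  alt : ξ.IsAlt
  nondeg : ξ.Nondegenerate
  two_ne_zero : (2 : K) ≠ 0

theorem IsSymplecticSpace.isSymplectic {ξ : LinearMap.BilinForm K V} {n : ℕ}
    (h : IsSymplecticSpace ξ n) : IsSymplectic ξ :=
  ⟨h.2.2.2.1, h.2.2.2.2, Ring.two_ne_zero h.1⟩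

variable {ξ : LinearMap.BilinForm K V} {k : ℕ}

theorem TR.finrank_eq (U : TR ξ k) : finrank K U.1 = k := U.2.1

variable [FiniteDimensional K V]

theorem IsSymplectic.even_finrank (h : IsSymplectic ξ) : Even (finrank K V) := by
  have : IsRegular ξ ⊤ := isRegular_iff.2 fun x _ hx => h.nondeg.2 x fun u => hx u trivial
  simpa using this.even_finrank h.alt h.two_ne_zero

theorem TR.finrank_rad_le (U : TR ξ k) : finrank K (rad ξ U.1) ≤ 1 :=
  isRegular_or_isTangential_iff.1 U.2.2

/-- The element of `TR ξ k` given by a subspace. -/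
def TR.of (U : Submodule K V) (h : finrank K U = k) (h' : finrank K (rad ξ U) ≤ 1) : TR ξ k :=
  ⟨U, h, isRegular_or_isTangential_iff.2 h'⟩

theorem IsSymplectic.isRegular (h : IsSymplectic ξ) (hk : Even k) (U : TR ξ k) :
    IsRegular ξ U.1 :=
  isRegular_of_even h.alt h.two_ne_zero (by rwa [U.finrank_eq]) U.finrank_rad_le

theorem IsSymplectic.finrank_rad (h : IsSymplectic ξ) (hk : ¬ Even k) (U : TR ξ k) :
    finrank K (rad ξ U.1) = 1 :=
  finrank_rad_of_odd h.alt h.two_ne_zero (by rwa [U.finrank_eq]) U.finrank_rad_le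

/-! ### Lines and adjacency -/

/-- Two distinct points of a pencil recover its lower and upper bound as their meet and join, so
they determine the line. -/
theorem pencil_eq {l : Set (TR ξ k)} (hl : l ∈ pencils ξ k) {U W : TR ξ k} (hU : U ∈ l)
    (hW : W ∈ l) (hne : U ≠ W) :
    l = {Z | U.1 ⊓ W.1 ≤ Z.1 ∧ Z.1 ≤ U.1 ⊔ W.1} ∧ finrank K ↥(U.1 ⊓ W.1) + 1 = k ∧
      finrank K (rad ξ (U.1 ⊓ W.1)) ≤ 1 ∧ finrank K (rad ξ (U.1 ⊔ W.1)) ≤ 1 := by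
  obtain ⟨-, j, H, B, hj, -, rfl⟩ := hl
  have hne' : U.1 ≠ W.1 := fun e => hne (Subtype.ext e)
  obtain ⟨h1, h2⟩ := sup_eq_and_finrank_inf U.finrank_eq W.finrank_eq B.finrank_eq hU.2 hW.2 hne'
  obtain ⟨h3, -⟩ := inf_eq_and_finrank_sup U.finrank_eq W.finrank_eq
    (by rw [H.finrank_eq, hj]) hU.1 hW.1 hne'
  rw [h1, h3]
  exact ⟨rfl, by rw [H.finrank_eq, hj], H.finrank_rad_le, B.finrank_rad_le⟩

theorem pencil_mem {U W : TR ξ k} (h : finrank K ↥(U.1 ⊓ W.1) + 1 = k)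
    (h1 : finrank K (rad ξ (U.1 ⊓ W.1)) ≤ 1) (h2 : finrank K (rad ξ (U.1 ⊔ W.1)) ≤ 1) :
    {Z : TR ξ k | U.1 ⊓ W.1 ≤ Z.1 ∧ Z.1 ≤ U.1 ⊔ W.1} ∈ pencils ξ k := by
  refine ⟨⟨U, inf_le_left, le_sup_left⟩, finrank K ↥(U.1 ⊓ W.1), TR.of _ rfl h1,
    TR.of _ (finrank_sup_of_inf U.finrank_eq W.finrank_eq h) h2, h, ?_, rfl⟩
  exact inf_le_left.trans (le_sup_left (a := U.1))

theorem adj_iff {U W : TR ξ k} : (adjacency ξ k).Adj U W ↔ U ≠ W ∧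
    finrank K ↥(U.1 ⊓ W.1) + 1 = k ∧ finrank K (rad ξ (U.1 ⊓ W.1)) ≤ 1 ∧
      finrank K (rad ξ (U.1 ⊔ W.1)) ≤ 1 := by
  constructor
  · rintro ⟨hne, l, hl, hU, hW⟩
    exact ⟨hne, (pencil_eq hl hU hW hne).2⟩
  · rintro ⟨hne, h, h1, h2⟩
    exact ⟨hne, _, pencil_mem h h1 h2, ⟨inf_le_left, le_sup_left⟩, ⟨inf_le_right, le_sup_right⟩⟩

/-- Passing from a regular subspace to a hyperplane, or to an extension by one dimension, creates a
radical of dimension at most one, so the conditions on meet and join are automatic. -/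
theorem IsSymplectic.adj_iff_of_even (h : IsSymplectic ξ) (hk : Even k) {U W : TR ξ k} :
    (adjacency ξ k).Adj U W ↔ U ≠ W ∧ finrank K ↥(U.1 ⊓ W.1) + 1 = k := by
  rw [adj_iff]
  refine and_congr_right fun hne => ⟨fun h => h.1, fun hd => ⟨hd, ?_, ?_⟩⟩
  · exact finrank_rad_le_one_of_le (by rw [U.finrank_eq, hd]) inf_le_left (h.isRegular hk U)
  · exact finrank_rad_le_one_of_ge
      (by rw [U.finrank_eq, finrank_sup_of_inf U.finrank_eq W.finrank_eq hd]) le_sup_left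
      (h.isRegular hk U)

theorem IsSymplectic.adj_iff_of_odd (h : IsSymplectic ξ) (hk : ¬ Even k) {U W : TR ξ k} :
    (adjacency ξ k).Adj U W ↔ U ≠ W ∧ finrank K ↥(U.1 ⊓ W.1) + 1 = k ∧
      IsRegular ξ (U.1 ⊓ W.1) ∧ IsRegular ξ (U.1 ⊔ W.1) := by
  rw [adj_iff]
  refine and_congr_right fun hne => and_congr_right fun hd => and_congr ⟨fun h' => ?_, fun h' => ?_⟩
    ⟨fun h' => ?_, fun h' => ?_⟩
  · refine isRegular_of_even h.alt h.two_ne_zero ?_ h'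
    rw [← hd, Nat.even_add_one, not_not] at hk
    exact hk
  · rw [isRegular_iff_finrank.1 h']; exact zero_le_one
  · refine isRegular_of_even h.alt h.two_ne_zero ?_ h'
    rw [finrank_sup_of_inf U.finrank_eq W.finrank_eq hd, Nat.even_add_one]
    exact hk
  · rw [isRegular_iff_finrank.1 h']; exact zero_le_one

/-- Every line has at least two points. Hence lines can be coded by pairs of adjacent points, and a
star and a top never share exactly one element. -/
theorem IsSymplectic.exists_ne_mem_pencil (h : IsSymplectic ξ) {l : Set (TR ξ k)}
    (hl : l ∈ pencils ξ k) {U : TR ξ k} (hU : U ∈ l) : ∃ W ∈ l, W ≠ U := by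
  obtain ⟨-, j, H, B, hj, -, rfl⟩ := hl
  by_cases hk : Even k
  · have hB := h.finrank_rad (by rw [Nat.even_add_one, not_not]; exact hk) B
    obtain ⟨b, hb, hb0⟩ := exists_ne_zero_of_finrank_pos (S := rad ξ B.1) (by omega)
    have hbU : b ∉ U.1 := fun hbU =>
      hb0 (isRegular_iff.1 (h.isRegular hk U) b hbU fun u hu => hb.2 u (hU.2 hu))
    obtain ⟨x, hx, hxH⟩ : ∃ x ∈ U.1, x ∉ H.1 := by
      by_contra! h
      have := Submodule.finrank_mono (show U.1 ≤ H.1 from h)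
      rw [U.finrank_eq, H.finrank_eq] at this
      omega
    have hxb : x + b ∉ U.1 := fun h => hbU (by simpa using U.1.sub_mem h hx)
    have hd := finrank_sup_span_singleton' fun h => hxb (hU.1 h)
    -- U is tilted along the radical vector b of B. As b ∉ X, X is a complement of the radical of B,
    -- and hence regular.
    set X := H.1 ⊔ K ∙ (x + b) with hX
    rw [H.finrank_eq, hj] at hd
    have hbX : b ∉ X := by
      intro hbX
      obtain ⟨a, ha, c, hc, hac⟩ := Submodule.mem_sup.1 hbX
      obtain ⟨c, rfl⟩ := Submodule.mem_span_singleton.1 hc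
      have h1 : (1 - c) • b ∈ U.1 := by
        have : (1 - c) • b = a + c • x := by
          rw [sub_smul, one_smul]
          nth_rewrite 1 [← hac]
          rw [smul_add]
          abel
        rw [this]
        exact U.1.add_mem (hU.1 ha) (U.1.smul_mem _ hx)
      have h2 : c = 1 := by
        by_contra hc
        exact hbU ((U.1.smul_mem_iff (sub_ne_zero.2 (Ne.symm hc))).1 h1)
      rw [h2, one_smul] at hac
      apply hxH
      have : x = -a := by
        have : a + x + b = b := by rw [add_assoc]; exact hac
        have : a + x = 0 := by simpa using this
        exact eq_neg_of_add_eq_zero_right this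
      rw [this]
      exact H.1.neg_mem ha
    have hXB : X ≤ B.1 := sup_le (hU.1.trans hU.2) ((Submodule.span_singleton_le_iff_mem _ _).2
      (B.1.add_mem (hU.2 hx) hb.1))
    have hsup : X ⊔ K ∙ b = B.1 := eq_of_le_of_finrank_eq'
      (sup_le hXB ((Submodule.span_singleton_le_iff_mem _ _).2 hb.1))
      (by rw [finrank_sup_span_singleton' hbX, hd, B.finrank_eq])
    have hreg : IsRegular ξ X := by
      rw [isRegular_iff]
      intro z hz hzX
      have hzB : z ∈ rad ξ B.1 := by
        refine ⟨hXB hz, fun u hu => ?_⟩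
        rw [← hsup] at hu
        obtain ⟨a, ha, c, hc, rfl⟩ := Submodule.mem_sup.1 hu
        obtain ⟨c, rfl⟩ := Submodule.mem_span_singleton.1 hc
        have : ξ b z = 0 := eq_zero_comm h.alt (hb.2 z (hXB hz))
        simp [hzX a ha, this]
      by_contra hz0
      obtain ⟨c, rfl⟩ := Submodule.mem_span_singleton.1
        (mem_span_singleton_of_finrank_le_one hB.le hzB hb hz0)
      exact hbX (X.smul_mem _ hz)
    refine ⟨TR.of X hd (by rw [isRegular_iff_finrank.1 hreg]; exact zero_le_one),
      ⟨le_sup_left, hXB⟩, fun e => hxb ?_⟩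
    rw [← e]
    exact Submodule.mem_sup_right (Submodule.mem_span_singleton_self _)
  · have hB := h.isRegular (by rw [Nat.even_add_one]; exact hk) B
    -- Now B is regular, so any of its hyperplanes is admissible; it suffices to leave U.
    obtain ⟨y, hy, hyU⟩ : ∃ x ∈ B.1, x ∉ U.1 := by
      by_contra! h
      have := Submodule.finrank_mono (show B.1 ≤ U.1 from h)
      rw [U.finrank_eq, B.finrank_eq] at this
      omega
    have hd := finrank_sup_span_singleton' fun h => hyU (hU.1 h)
    rw [H.finrank_eq, hj] at hd
    have hle : H.1 ⊔ K ∙ y ≤ B.1 :=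
      sup_le (hU.1.trans hU.2) ((Submodule.span_singleton_le_iff_mem _ _).2 hy)
    refine ⟨TR.of _ hd (finrank_rad_le_one_of_le (by rw [hd, B.finrank_eq]) hle hB),
      ⟨le_sup_left, hle⟩, fun e => hyU ?_⟩
    rw [← e]
    exact Submodule.mem_sup_right (Submodule.mem_span_singleton_self _)

/-! ### The duality `U ↦ U^⊥` -/

/-- Passing to the orthogonal complement, as a bijection between the regular or tangential
subspaces of complementary dimensions. -/
def IsSymplectic.dual (h : IsSymplectic ξ) {k j : ℕ} (hkj : k + j = finrank K V) :
    TR ξ k ≃ TR ξ j where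
  toFun U := TR.of (ξ.orthogonal U.1)
    (by have := finrank_add_finrank_orthogonal h.nondeg U.1; rw [U.finrank_eq] at this; omega)
    (by rw [rad_orthogonal h.alt h.nondeg]; exact U.finrank_rad_le)
  invFun U := TR.of (ξ.orthogonal U.1)
    (by have := finrank_add_finrank_orthogonal h.nondeg U.1; rw [U.finrank_eq] at this; omega)
    (by rw [rad_orthogonal h.alt h.nondeg]; exact U.finrank_rad_le)
  left_inv U := Subtype.ext (orthogonal_orthogonal h.alt h.nondeg U.1)
  right_inv U := Subtype.ext (orthogonal_orthogonal h.alt h.nondeg U.1)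

theorem IsSymplectic.dual_le_iff (h : IsSymplectic ξ) {k j k' j' : ℕ} (hkj : k + j = finrank K V)
    (hkj' : k' + j' = finrank K V) {U : TR ξ k} {W : TR ξ k'} :
    (h.dual hkj U).1 ≤ (h.dual hkj' W).1 ↔ W.1 ≤ U.1 :=
  orthogonal_le_orthogonal_iff h.alt h.nondeg

theorem IsSymplectic.le_dual_comm (h : IsSymplectic ξ) {k j k' j' : ℕ}
    (hkj : k + j = finrank K V) (hkj' : k' + j' = finrank K V) {U : TR ξ k} {W : TR ξ k'} :
    W.1 ≤ (h.dual hkj U).1 ↔ U.1 ≤ (h.dual hkj' W).1 :=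
  le_orthogonal_comm h.alt

theorem IsSymplectic.dual_le_comm (h : IsSymplectic ξ) {k j k' j' : ℕ}
    (hkj : k + j = finrank K V) (hkj' : k' + j' = finrank K V) {U : TR ξ k} {W : TR ξ k'} :
    (h.dual hkj U).1 ≤ W.1 ↔ (h.dual hkj' W).1 ≤ U.1 := by
  have h1 := orthogonal_le_orthogonal_iff h.alt h.nondeg (U := W.1) (W := ξ.orthogonal U.1)
  rw [orthogonal_orthogonal h.alt h.nondeg] at h1
  exact h1.symm

theorem IsSymplectic.dual_dual (h : IsSymplectic ξ) {k j : ℕ} (hkj : k + j = finrank K V)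
    (hjk : j + k = finrank K V) (U : TR ξ k) : h.dual hjk (h.dual hkj U) = U :=
  (h.dual hkj).left_inv U

theorem IsSymplectic.preimage_dual_mem_pencils (h : IsSymplectic ξ) {k j : ℕ}
    (hkj : k + j = finrank K V) {l : Set (TR ξ j)} (hl : l ∈ pencils ξ j) :
    h.dual hkj ⁻¹' l ∈ pencils ξ k := by
  obtain ⟨⟨U, hU⟩, i, H, B, hi, hHB, rfl⟩ := hl
  have hB : j + 1 ≤ finrank K V := by rw [← B.finrank_eq]; exact Submodule.finrank_le _
  refine ⟨⟨h.dual (by omega) U, ?_⟩, k - 1,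
    h.dual (by omega) B, h.dual (by omega) H, by omega, ?_, ?_⟩
  · rw [Set.mem_preimage, h.dual_dual]
    exact hU
  · rw [h.dual_le_iff]; exact hHB
  · ext W
    exact and_comm.trans (and_congr (h.dual_le_comm hkj (by omega)) (h.le_dual_comm hkj (by omega)))

theorem IsSymplectic.preimage_dual_mem_pencils_iff (h : IsSymplectic ξ) {k j : ℕ}
    (hkj : k + j = finrank K V) {l : Set (TR ξ j)} :
    h.dual hkj ⁻¹' l ∈ pencils ξ k ↔ l ∈ pencils ξ j := by
  refine ⟨fun hl => ?_, h.preimage_dual_mem_pencils hkj⟩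
  have := h.preimage_dual_mem_pencils (show j + k = finrank K V by omega) hl
  rw [← Set.preimage_comp] at this
  convert this
  ext W
  simp [h.dual_dual]

theorem IsSymplectic.adj_dual_iff (h : IsSymplectic ξ) {k j : ℕ} (hkj : k + j = finrank K V)
    {U W : TR ξ k} : (adjacency ξ k).Adj U W ↔
      (adjacency ξ j).Adj (h.dual hkj U) (h.dual hkj W) := by
  refine and_congr (h.dual hkj).injective.ne_iff.symm ⟨?_, ?_⟩
  · rintro ⟨l, hl, hU, hW⟩
    refine ⟨_, h.preimage_dual_mem_pencils (show j + k = finrank K V by omega) hl, ?_, ?_⟩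
    · rwa [Set.mem_preimage, h.dual_dual]
    · rwa [Set.mem_preimage, h.dual_dual]
  · rintro ⟨l, hl, hU, hW⟩
    exact ⟨_, h.preimage_dual_mem_pencils hkj hl, hU, hW⟩

end Geometry

/-- Orthogonal complementation reverses inclusion, which the symmetric relation of comparability
does not notice; so the very same scheme works in the complementary dimensions. -/
theorem DefinableFromAdjacency.dual {n k j : ℕ} (hk : k ≤ n) (hj : j ≤ n)
    (h : DefinableFromAdjacency.{u, v} n k j) :
    DefinableFromAdjacency.{u, v} n (n - k) (n - j) := by
  obtain ⟨S, hS⟩ := h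
  refine ⟨S, fun K V _ _ _ ξ hξ => ?_⟩
  have := hξ.2.1
  have hs := hξ.isSymplectic
  have hn := hξ.2.2.1
  have hkn : n - k + k = finrank K V := by omega
  have hjn : n - j + j = finrank K V := by omega
  let e : TR ξ (n - k) ≃[Language.graph] TR ξ k :=
    { hs.dual hkn with
      map_fun' := fun f => isEmptyElim f
      map_rel' := fun {n} r x => by
        cases r
        exact (hs.adj_dual_iff hkn).symm }
  refine (hS K V ξ hξ).of_equiv e (hs.dual hjn) (fun l => hs.preimage_dual_mem_pencils_iff hjn) ?_
  intro X U
  change _ ↔ (hs.dual hjn X).1 ≤ (hs.dual hkn U).1 ∨ (hs.dual hkn U).1 ≤ (hs.dual hjn X).1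
  rw [hs.dual_le_iff, hs.dual_le_iff, or_comm]

/-- A definition of the points of the Grassmann space on `(T-R)_j` by tuples, together with
definitions of adjacency and of the line through two adjacent points, amounts to a definition of
this Grassmann space. -/
theorem definableFromAdjacency_of_points {n k j m : ℕ}
    {Dom : ∀ M : Type v, (M → M → Prop) → (Fin m → M) → Prop}
    {Mem : ∀ M : Type v, (M → M → Prop) → (Fin m → M) → M → Prop}
    {Ad : ∀ M : Type v, (M → M → Prop) → (Fin m → M) → (Fin m → M) → Prop}
    {Inc : ∀ M : Type v, (M → M → Prop) → (Fin m → M) → (Fin m → M) → (Fin m → M) → Prop}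
    (hDom : ∀ {α : Type} (t : Fin m → α), UniformlyDefinable fun M A x => Dom M A (x ∘ t))
    (hMem : ∀ {α : Type} (t : Fin m → α) (a : α),
      UniformlyDefinable fun M A x => Mem M A (x ∘ t) (x a))
    (hAd : ∀ {α : Type} (t t' : Fin m → α),
      UniformlyDefinable fun M A x => Ad M A (x ∘ t) (x ∘ t'))
    (hInc : ∀ {α : Type} (t t' t'' : Fin m → α),
      UniformlyDefinable fun M A x => Inc M A (x ∘ t) (x ∘ t') (x ∘ t''))
    (H : ∀ (K : Type u) (V : Type v) [Field K] [AddCommGroup V] [Module K V]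
      (ξ : LinearMap.BilinForm K V), IsSymplecticSpace ξ n →
      ∃ f : {t : Fin m → TR ξ k // Dom _ (adjacency ξ k).Adj t} → TR ξ j,
        Function.Surjective f ∧
        (∀ t U, Mem _ (adjacency ξ k).Adj t.1 U ↔ ((f t).1 ≤ U.1 ∨ U.1 ≤ (f t).1)) ∧
        (∀ t t', (∀ U, Mem _ (adjacency ξ k).Adj t.1 U ↔ Mem _ (adjacency ξ k).Adj t'.1 U) →
          f t = f t') ∧
        (∀ t t', Ad _ (adjacency ξ k).Adj t.1 t'.1 ↔ (adjacency ξ j).Adj (f t) (f t')) ∧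
        ∀ t t' t'', (adjacency ξ j).Adj (f t) (f t') →
          (Inc _ (adjacency ξ k).Adj t.1 t'.1 t''.1 ↔
            ((f t).1 ⊓ (f t').1 ≤ (f t'').1 ∧ (f t'').1 ≤ (f t).1 ⊔ (f t').1))) :
    DefinableFromAdjacency.{u, v} n k j := by
  obtain ⟨ptDom, hptDom⟩ := hDom (id : Fin m → Fin m)
  obtain ⟨ptEq, hptEq⟩ := UniformlyDefinable.forall_elem
    (Q := fun M A (x : Fin m ⊕ Fin m → M) U => Mem M A (x ∘ Sum.inl) U ↔ Mem M A (x ∘ Sum.inr) U)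
    ((hMem (Sum.inl ∘ Sum.inl) (Sum.inr ())).iff (hMem (Sum.inl ∘ Sum.inr) (Sum.inr ())))
  -- A line is coded by two adjacent points on it, hence by m + m entries; codes are equal if the
  -- same points lie on the lines.
  obtain ⟨lnDom, hlnDom⟩ := ((hDom (Fin.castAdd m)).and ((hDom (Fin.natAdd m)).and
    (hAd (Fin.castAdd m) (Fin.natAdd m))))
  obtain ⟨lnEq, hlnEq⟩ := UniformlyDefinable.forall_tuple
    (Q := fun M A (x : Fin (m + m) ⊕ Fin (m + m) → M) (z : Fin m → M) => Dom M A z →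
      (Inc M A (x ∘ Sum.inl ∘ Fin.castAdd m) (x ∘ Sum.inl ∘ Fin.natAdd m) z ↔
       Inc M A (x ∘ Sum.inr ∘ Fin.castAdd m) (x ∘ Sum.inr ∘ Fin.natAdd m) z))
    ((hDom Sum.inr).imp
      ((hInc (Sum.inl ∘ Sum.inl ∘ Fin.castAdd m) (Sum.inl ∘ Sum.inl ∘ Fin.natAdd m) Sum.inr).iff
        (hInc (Sum.inl ∘ Sum.inr ∘ Fin.castAdd m) (Sum.inl ∘ Sum.inr ∘ Fin.natAdd m) Sum.inr)))
  obtain ⟨inc, hinc⟩ := hInc (Sum.inr ∘ Fin.castAdd m) (Sum.inr ∘ Fin.natAdd m)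
    (Sum.inl : Fin m → Fin m ⊕ Fin (m + m))
  obtain ⟨link, hlink⟩ := hMem (Sum.inl : Fin m → Fin m ⊕ Unit) (Sum.inr ())
  refine ⟨⟨m, m + m, ptDom, ptEq, lnDom, lnEq, inc, link⟩, fun K V _ _ _ ξ hξ => ?_⟩
  have := hξ.2.1
  have hs := hξ.isSymplectic
  obtain ⟨f, hf, hmem, heq, had, hin⟩ := H K V ξ hξ
  have hL : ∀ y : {y : Fin (m + m) → TR ξ k // lnDom.Realize y},
      ∃ a b : {t : Fin m → TR ξ k // Dom _ (adjacency ξ k).Adj t},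
        a.1 = y.1 ∘ Fin.castAdd m ∧ b.1 = y.1 ∘ Fin.natAdd m ∧
        (adjacency ξ j).Adj (f a) (f b) := by
    rintro ⟨y, hy⟩
    obtain ⟨h1, h2, h3⟩ := (hlnDom _ _).1 hy
    exact ⟨⟨_, h1⟩, ⟨_, h2⟩, rfl, rfl, (had ⟨_, h1⟩ ⟨_, h2⟩).1 h3⟩
  choose a b ha hb hab using hL
  have hpen : ∀ y, {Z : TR ξ j | (f (a y)).1 ⊓ (f (b y)).1 ≤ Z.1 ∧
      Z.1 ≤ (f (a y)).1 ⊔ (f (b y)).1} ∈ pencils ξ j := fun y =>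
    have h := adj_iff.1 (hab y)
    pencil_mem h.2.1 h.2.2.1 h.2.2.2
  let F : {x : Fin m → TR ξ k // ptDom.Realize x} → TR ξ j :=
    fun x => f ⟨x.1, (hptDom _ _).1 x.2⟩
  refine ⟨F, fun y => ⟨_, hpen y⟩, ?_, ?_, ?_, ?_, ?_, ?_⟩
  · intro X
    obtain ⟨t, rfl⟩ := hf X
    exact ⟨⟨t.1, (hptDom _ _).2 t.2⟩, rfl⟩
  · rintro ⟨l, hl⟩
    obtain ⟨U, hU⟩ := hl.1
    obtain ⟨W, hW, hne⟩ := hs.exists_ne_mem_pencil hl hU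
    obtain ⟨s, hs⟩ := hf U
    obtain ⟨t, ht⟩ := hf W
    have hst : (adjacency ξ j).Adj (f s) (f t) := ⟨by rw [hs, ht]; exact hne.symm, l, hl,
      by rwa [hs], by rwa [ht]⟩
    have e1 : (Fin.append s.1 t.1 : Fin (m + m) → TR ξ k) ∘ Fin.castAdd m = s.1 := by
      ext1 i; simp
    have e2 : (Fin.append s.1 t.1 : Fin (m + m) → TR ξ k) ∘ Fin.natAdd m = t.1 :=
      funext fun i => Fin.append_right _ _ i
    have hdom : lnDom.Realize (Fin.append s.1 t.1) := by
      rw [hlnDom]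
      beta_reduce
      rw [e1, e2]
      exact ⟨s.2, t.2, (had s t).2 hst⟩
    refine ⟨⟨_, hdom⟩, Subtype.ext ?_⟩
    have e3 : a ⟨_, hdom⟩ = s := Subtype.ext ((ha _).trans e1)
    have e4 : b ⟨_, hdom⟩ = t := Subtype.ext ((hb _).trans e2)
    simp only [e3, e4, hs, ht]
    exact (pencil_eq hl hU hW hne.symm).1.symm
  · intro x x'
    refine (hptEq _ _).trans ⟨fun h => heq _ _ h, fun h U => ?_⟩
    exact (hmem ⟨x.1, (hptDom _ _).1 x.2⟩ U).trans
      ((iff_of_eq (by rw [show f ⟨x.1, _⟩ = f ⟨x'.1, _⟩ from h])).trans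
        (hmem ⟨x'.1, (hptDom _ _).1 x'.2⟩ U).symm)
  · intro y y'
    refine (hlnEq _ _).trans ?_
    rw [Subtype.mk_eq_mk]
    have key : ∀ y t, Inc _ (adjacency ξ k).Adj (y.1 ∘ Fin.castAdd m) (y.1 ∘ Fin.natAdd m) t.1 ↔
        ((f (a y)).1 ⊓ (f (b y)).1 ≤ (f t).1 ∧ (f t).1 ≤ (f (a y)).1 ⊔ (f (b y)).1) := by
      intro y t
      rw [← ha, ← hb]
      exact hin _ _ _ (hab y)
    constructor
    · intro h
      ext Z
      obtain ⟨t, rfl⟩ := hf Z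
      exact (key y t).symm.trans ((h t.1 t.2).trans (key y' t))
    · intro h t ht
      exact (key y ⟨t, ht⟩).trans ((Set.ext_iff.1 h (f ⟨t, ht⟩)).trans (key y' ⟨t, ht⟩).symm)
  · intro x y
    refine (hinc _ _).trans ?_
    have := hin (a y) (b y) ⟨x.1, (hptDom _ _).1 x.2⟩ (hab y)
    rw [ha, hb] at this
    exact this
  · intro x U
    exact (hlink _ _).trans (hmem ⟨x.1, (hptDom _ _).1 x.2⟩ U)

/-! ### Regular extensions and regular hyperplanes in general position. -/

section Existence

variable {K V : Type*} [Field K] [AddCommGroup V] [Module K V] {ξ : LinearMap.BilinForm K V}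
  {k : ℕ} [FiniteDimensional K V]

theorem IsSymplectic.ker_ne_top (h : IsSymplectic ξ) {r : V} (hr : r ≠ 0) :
    LinearMap.ker (ξ r) ≠ ⊤ := fun e => hr <| h.nondeg.1 r fun y => by
  have : y ∈ LinearMap.ker (ξ r) := e ▸ Submodule.mem_top
  exact this

/-- An element of even dimension above a given one, not contained in a given proper subspace. -/
theorem IsSymplectic.exists_ge_not_le (h : IsSymplectic ξ) {j : ℕ} (hjk : j + 1 = k)
    (hk : Even k) (H : TR ξ j) {B : Submodule K V} (hB : B ≠ ⊤) :
    ∃ Z : TR ξ k, H.1 ≤ Z.1 ∧ ¬ Z.1 ≤ B := by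
  subst hjk
  rw [Nat.even_add_one] at hk
  have hrad := h.finrank_rad hk H
  obtain ⟨r, hr, hr0⟩ := exists_ne_zero_of_finrank_pos (S := rad ξ H.1) (by omega)
  -- A vector not orthogonal to the radical of H makes the extension regular; a vector space is not
  -- the union of the two proper subspaces r^⊥ and B.
  obtain ⟨v, hv, hvB⟩ := exists_not_mem_of_ne_top (h.ker_ne_top hr0) hB
  have hrv : ξ r v ≠ 0 := hv
  have hvH : v ∉ H.1 := fun hvH => hrv (eq_zero_comm h.alt (hr.2 v hvH))
  have hreg : IsRegular ξ (H.1 ⊔ K ∙ v) := by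
    rw [isRegular_iff]
    intro z hz hzZ
    obtain ⟨a, ha, c, hc, rfl⟩ := Submodule.mem_sup.1 hz
    obtain ⟨c, rfl⟩ := Submodule.mem_span_singleton.1 hc
    have h1 := hzZ r (Submodule.mem_sup_left hr.1)
    have h2 : ξ r a = 0 := eq_zero_comm h.alt (hr.2 a ha)
    simp only [map_add, h2, map_smul, smul_eq_mul, zero_add, mul_eq_zero, hrv, or_false] at h1
    subst h1
    simp only [zero_smul, add_zero] at hzZ ⊢
    by_contra ha0
    have har : a ∈ rad ξ H.1 := ⟨ha, fun u hu => hzZ u (Submodule.mem_sup_left hu)⟩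
    obtain ⟨d, rfl⟩ := Submodule.mem_span_singleton.1
      (mem_span_singleton_of_finrank_le_one hrad.le har hr ha0)
    refine hrv (eq_zero_comm h.alt ?_)
    rw [map_smul, hzZ v (Submodule.mem_sup_right (Submodule.mem_span_singleton_self v)), smul_zero]
  refine ⟨TR.of _ (by rw [finrank_sup_span_singleton' hvH, H.finrank_eq])
    (by rw [isRegular_iff_finrank.1 hreg]; exact zero_le_one), le_sup_left, fun hle => hvB ?_⟩
  exact hle (Submodule.mem_sup_right (Submodule.mem_span_singleton_self v))

/-- An element of even dimension below a given one, not containing a given nonzero subspace. -/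
theorem IsSymplectic.exists_le_not_ge (h : IsSymplectic ξ) (hk : Even k) (B : TR ξ (k + 1))
    {H : Submodule K V} (hH : H ≠ ⊥) : ∃ Z : TR ξ k, Z.1 ≤ B.1 ∧ ¬ H ≤ Z.1 := by
  have hn := Submodule.finrank_le B.1
  rw [B.finrank_eq] at hn
  obtain ⟨j, hj⟩ : ∃ j, k + 1 + j = finrank K V := ⟨_, Nat.add_sub_cancel' hn⟩
  have hev := h.even_finrank
  have hj' : Even (j + 1) := by
    rw [← hj, add_right_comm, add_assoc] at hev
    exact (Nat.even_add.1 hev).1 hk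
  have htop : ξ.orthogonal H ≠ ⊤ := by
    intro e
    apply hH
    have h1 := finrank_add_finrank_orthogonal h.nondeg H
    rw [e, finrank_top] at h1
    exact Submodule.finrank_eq_zero.1 (by omega)
  -- The preceding existence statement is applied in the dual dimension.
  obtain ⟨Z, h1, h2⟩ := h.exists_ge_not_le rfl hj' (h.dual hj B) htop
  refine ⟨h.dual (by omega) Z, (h.dual_le_comm hj (by omega)).1 h1, fun hle => h2 ?_⟩
  exact (le_orthogonal_comm h.alt).1 hle

/-! ### Lines in even dimension -/

theorem IsSymplectic.adj_or_eq_iff (h : IsSymplectic ξ) (hk : Even k) {U W : TR ξ k} :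
    (adjacency ξ k).Adj U W ∨ U = W ↔ k ≤ finrank K ↥(U.1 ⊓ W.1) + 1 := by
  rw [h.adj_iff_of_even hk]
  constructor
  · rintro (⟨-, h⟩ | rfl)
    · omega
    · rw [inf_idem, U.finrank_eq]; omega
  · intro hle
    by_cases e : U = W
    · exact .inr e
    · refine .inl ⟨e, ?_⟩
      by_contra hne
      have h1 : U.1 ⊓ W.1 = U.1 :=
        eq_of_le_of_finrank_eq' inf_le_left (by rw [U.finrank_eq]; omega)
      have h2 : U.1 ⊓ W.1 = W.1 :=
        eq_of_le_of_finrank_eq' inf_le_right (by rw [W.finrank_eq]; omega)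
      exact e (Subtype.ext (h1.symm.trans h2))

theorem IsSymplectic.inf_le_or_le_sup (h : IsSymplectic ξ) (hk : Even k) {U W Z : TR ξ k}
    (hUW : (adjacency ξ k).Adj U W) (h1 : (adjacency ξ k).Adj Z U ∨ Z = U)
    (h2 : (adjacency ξ k).Adj Z W ∨ Z = W) : U.1 ⊓ W.1 ≤ Z.1 ∨ Z.1 ≤ U.1 ⊔ W.1 := by
  rcases h1 with h1 | rfl
  · rcases h2 with h2 | rfl
    · rw [h.adj_iff_of_even hk] at hUW h1 h2
      exact SympGrassmann.inf_le_or_le_sup Z.finrank_eq hUW.2 h1.2 h2.2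
    · exact .inl inf_le_right
  · exact .inl inf_le_left

theorem IsSymplectic.adj_or_eq_of_ge (h : IsSymplectic ξ) (hk : Even k) {X : Submodule K V}
    (hX : finrank K X + 1 = k) {U W : TR ξ k} (hU : X ≤ U.1) (hW : X ≤ W.1) :
    (adjacency ξ k).Adj U W ∨ U = W := by
  rw [h.adj_or_eq_iff hk]
  have := Submodule.finrank_mono (le_inf hU hW)
  omega

theorem IsSymplectic.adj_or_eq_of_le (h : IsSymplectic ξ) (hk : Even k) {Y : Submodule K V}
    (hY : finrank K Y = k + 1) {U W : TR ξ k} (hU : U.1 ≤ Y) (hW : W.1 ≤ Y) :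
    (adjacency ξ k).Adj U W ∨ U = W := by
  rw [h.adj_or_eq_iff hk]
  have h1 := Submodule.finrank_mono (sup_le hU hW)
  have h2 := Submodule.finrank_sup_add_finrank_inf_eq U.1 W.1
  rw [U.finrank_eq, W.finrank_eq] at h2
  omega

/-- A line is a double closed neighbourhood: the elements adjacent or equal to both U and W fill the
star of U ⊓ W and the top of U ⊔ W, and only the elements in both are near all of these. -/
theorem IsSymplectic.mem_line_iff (h : IsSymplectic ξ) (hk : Even k) (hk2 : 2 ≤ k)
    (hkn : k + 2 ≤ finrank K V) {U W Z : TR ξ k} (hUW : (adjacency ξ k).Adj U W) :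
    (U.1 ⊓ W.1 ≤ Z.1 ∧ Z.1 ≤ U.1 ⊔ W.1) ↔ ∀ T : TR ξ k,
      ((adjacency ξ k).Adj T U ∨ T = U) → ((adjacency ξ k).Adj T W ∨ T = W) →
      ((adjacency ξ k).Adj T Z ∨ T = Z) := by
  have had := adj_iff.1 hUW
  have hsup := finrank_sup_of_inf U.finrank_eq W.finrank_eq had.2.1
  constructor
  · rintro ⟨h1, h2⟩ T hTU hTW
    rcases h.inf_le_or_le_sup hk hUW hTU hTW with h3 | h3
    · exact h.adj_or_eq_of_ge hk had.2.1 h3 h1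
    · exact h.adj_or_eq_of_le hk hsup h3 h2
  · intro hT
    have hZU : (adjacency ξ k).Adj Z U ∨ Z = U :=
      (hT U (.inr rfl) (.inl hUW)).imp (fun h => h.symm) Eq.symm
    have hZW : (adjacency ξ k).Adj Z W ∨ Z = W :=
      (hT W (.inl hUW.symm) (.inr rfl)).imp (fun h => h.symm) Eq.symm
    rcases h.inf_le_or_le_sup hk hUW hZU hZW with h3 | h3
    · refine ⟨h3, ?_⟩
      by_contra h4
      -- If Z is in the star but not in the top, then Z meets the join only in U ⊓ W; a T in the top
      -- that misses part of U ⊓ W is too far from Z. The other case is dual.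
      obtain ⟨T, hT1, hT2⟩ := h.exists_le_not_ge hk (TR.of _ hsup had.2.2.2)
        (H := U.1 ⊓ W.1) (fun e => by rw [e, finrank_bot] at had; omega)
      have h5 := hT T (h.adj_or_eq_of_le hk hsup hT1 le_sup_left)
        (h.adj_or_eq_of_le hk hsup hT1 le_sup_right)
      rw [h.adj_or_eq_iff hk] at h5
      have h6 : Z.1 ⊓ (U.1 ⊔ W.1) = U.1 ⊓ W.1 := by
        refine (eq_of_le_of_finrank_eq' (le_inf h3 (inf_le_left.trans le_sup_left)) ?_).symm
        by_contra hlt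
        refine h4 (inf_eq_left.1 (eq_of_le_of_finrank_eq' inf_le_left ?_))
        rw [Z.finrank_eq]
        omega
      have h7 : T.1 ⊓ Z.1 < U.1 ⊓ W.1 := by
        refine lt_of_le_of_ne ?_ fun e => hT2 (e ▸ inf_le_left)
        rw [← h6]
        exact le_inf inf_le_right (inf_le_left.trans hT1)
      have := Submodule.finrank_lt_finrank_of_lt h7
      omega
    · refine ⟨?_, h3⟩
      by_contra h4
      obtain ⟨T, hT1, hT2⟩ := h.exists_ge_not_le had.2.1 hk
        (TR.of (U.1 ⊓ W.1) rfl had.2.2.1) (B := U.1 ⊔ W.1)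
        (fun e => by rw [e, finrank_top] at hsup; omega)
      have hT1 : U.1 ⊓ W.1 ≤ T.1 := hT1
      have h5 := hT T (h.adj_or_eq_of_ge hk had.2.1 hT1 inf_le_left)
        (h.adj_or_eq_of_ge hk had.2.1 hT1 inf_le_right)
      rw [h.adj_or_eq_iff hk] at h5
      have h6 : T.1 ⊓ (U.1 ⊔ W.1) = U.1 ⊓ W.1 := by
        refine (eq_of_le_of_finrank_eq' (le_inf hT1 (inf_le_left.trans le_sup_left)) ?_).symm
        by_contra hlt
        refine hT2 (inf_eq_left.1 (eq_of_le_of_finrank_eq' inf_le_left ?_))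
        rw [T.finrank_eq]
        omega
      have h7 : T.1 ⊓ Z.1 < U.1 ⊓ W.1 := by
        refine lt_of_le_of_ne ?_ fun e => h4 (e ▸ inf_le_right)
        rw [← h6]
        exact inf_le_inf_left _ h3
      have := Submodule.finrank_lt_finrank_of_lt h7
      omega

/-! ### Hyperplanes of a regular subspace, as elements of `TR` -/

/-- The hyperplane of the regular subspace `Y` orthogonal to `x`. -/
def hyperplane (hA : ξ.IsAlt) {Y : Submodule K V} (hY : IsRegular ξ Y)
    (hd : finrank K Y = k + 1) (x : V) (hx : x ∈ Y) (hx0 : x ≠ 0) : TR ξ k :=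
  TR.of (perpIn ξ Y x) (by have := finrank_perpIn hA hY hx hx0; omega)
    (finrank_rad_le_one_of_le (finrank_perpIn hA hY hx hx0).symm perpIn_le hY)

theorem hyperplane_le (hA : ξ.IsAlt) {Y : Submodule K V} (hY : IsRegular ξ Y)
    (hd : finrank K Y = k + 1) {x : V} (hx : x ∈ Y) (hx0 : x ≠ 0) :
    (hyperplane hA hY hd x hx hx0).1 ≤ Y := perpIn_le

theorem IsSymplectic.exists_eq_hyperplane (h : IsSymplectic ξ) {Y : Submodule K V}
    (hY : IsRegular ξ Y) (hd : finrank K Y = k + 1) {U : TR ξ k} (hU : U.1 ≤ Y) :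
    ∃ x hx hx0, U = hyperplane h.alt hY hd x hx hx0 := by
  obtain ⟨x, hx, hx0, e⟩ := exists_eq_perpIn h.alt h.nondeg hY hU (by rw [U.finrank_eq, hd])
  exact ⟨x, hx, hx0, Subtype.ext e⟩

theorem hyperplane_eq_iff (hA : ξ.IsAlt) {Y : Submodule K V} (hY : IsRegular ξ Y)
    (hd : finrank K Y = k + 1) {x y : V} (hx : x ∈ Y) (hx0 : x ≠ 0) (hy : y ∈ Y) (hy0 : y ≠ 0)
    (e : hyperplane hA hY hd x hx hx0 = hyperplane hA hY hd y hy hy0) : y ∈ K ∙ x :=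
  mem_span_of_perpIn_eq hA hY hx hx0 hy (congrArg Subtype.val e)

/-- Distinct hyperplanes have the regular join Y, so only regularity of the meet matters. The
elements below Y thus form a copy of the projective points of Y with nonorthogonality as adjacency.
-/
theorem IsSymplectic.adj_hyperplane_iff (h : IsSymplectic ξ) (hk : ¬ Even k) {Y : Submodule K V}
    (hY : IsRegular ξ Y) (hd : finrank K Y = k + 1) {x y : V} (hx : x ∈ Y) (hx0 : x ≠ 0)
    (hy : y ∈ Y) (hy0 : y ≠ 0) :
    (adjacency ξ k).Adj (hyperplane h.alt hY hd x hx hx0) (hyperplane h.alt hY hd y hy hy0) ↔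
      ξ x y ≠ 0 := by
  by_cases e : hyperplane h.alt hY hd x hx hx0 = hyperplane h.alt hY hd y hy hy0
  · have h1 := hyperplane_eq_iff h.alt hY hd hx hx0 hy hy0 e
    obtain ⟨c, rfl⟩ := Submodule.mem_span_singleton.1 h1
    refine ⟨fun h => absurd e h.1, fun h' => absurd ?_ h'⟩
    rw [map_smul, h.alt x, smul_zero]
  · have e' : perpIn ξ Y x ≠ perpIn ξ Y y := fun e' => e (Subtype.ext e')
    obtain ⟨h1, h2⟩ := sup_eq_and_finrank_inf (TR.finrank_eq (hyperplane h.alt hY hd x hx hx0))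
      (TR.finrank_eq (hyperplane h.alt hY hd y hy hy0)) hd perpIn_le perpIn_le e'
    rw [h.adj_iff_of_odd hk, ← isRegular_inf_perpIn_iff h.alt hY hx hx0 hy]
    refine ⟨fun h => h.2.2.1, fun hr => ⟨e, h2, hr, ?_⟩⟩
    rw [h1]
    exact hY

/-! ### Triangular systems -/

/-- The matrix of pairings is triangular with nonzero diagonal, so its rows, and with them the a i,
are independent. -/
theorem card_le_finrank_of_triangular {Y : Submodule K V} {r : ℕ} {a b : Fin r → V}
    (ha : ∀ i, a i ∈ Y) (hab : ∀ i, ξ (a i) (b i) ≠ 0) (h0 : ∀ i j, j < i → ξ (a j) (b i) = 0) :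
    r ≤ finrank K Y := by
  let M : Matrix (Fin r) (Fin r) K := fun i j => ξ (a i) (b j)
  have hM : M.det ≠ 0 := by
    rw [Matrix.det_of_isLowerTriangular M fun i j hij => h0 j i hij]
    exact Finset.prod_ne_zero_iff.2 fun i _ => hab i
  have hli : LinearIndependent K M :=
    Matrix.linearIndependent_rows_of_det_ne_zero hM
  let f : V →ₗ[K] (Fin r → K) := LinearMap.pi fun j => ξ.flip (b j)
  have hli' : LinearIndependent K a := LinearIndependent.of_comp f hli
  have hli'' : LinearIndependent K (fun i => (⟨a i, ha i⟩ : Y)) :=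
    LinearIndependent.of_comp Y.subtype hli'
  simpa using hli''.fintype_card_le_finrank

theorem IsRegular.exists_triangular (hA : ξ.IsAlt) {Y : Submodule K V} (hY : IsRegular ξ Y)
    {r : ℕ} (hr : r ≤ finrank K Y) : ∃ a b : Fin r → V, (∀ i, a i ∈ Y) ∧ (∀ i, b i ∈ Y) ∧
      (∀ i, ξ (a i) (b i) ≠ 0) ∧ ∀ i j, j < i → ξ (a j) (b i) = 0 := by
  have hnd : (ξ.restrict Y).Nondegenerate := by
    refine ⟨fun x hx => ?_, fun x hx => ?_⟩
    · exact Subtype.ext (isRegular_iff.1 hY x x.2 fun u hu => eq_zero_comm hA (hx ⟨u, hu⟩))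
    · exact Subtype.ext (isRegular_iff.1 hY x x.2 fun u hu => hx ⟨u, hu⟩)
  let b := finBasis K Y
  let a := (ξ.restrict Y).dualBasis hnd b
  have hab : ∀ i j, ξ (a i) (b j) = if j = i then 1 else 0 :=
    fun i j => LinearMap.BilinForm.apply_dualBasis_left hnd b i j
  refine ⟨fun i => a (i.castLE hr), fun i => b (i.castLE hr), fun i => (a _).2, fun i => (b _).2,
    fun i => ?_, fun i j hij => ?_⟩
  · simp [hab]
  · rw [hab, if_neg]
    intro e
    exact hij.ne' (Fin.castLE_injective hr e)

end Existence

/-- Sequences `a`, `b` of length `r` in `T`, for which the relation `A` is triangular. -/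
def HasTriangular {M : Type*} (A : M → M → Prop) (T : M → Prop) (r : ℕ) : Prop :=
  ∃ a b : Fin r → M, (∀ i, T (a i) ∧ T (b i) ∧ A (a i) (b i)) ∧ ∀ i j, j < i → ¬ A (a j) (b i)

/-- Under the identification of hyperplanes with their poles, triangular systems of adjacencies are
triangular systems for ξ. For fixed r this is first-order, so the dimension of Y becomes visible in
the graph. -/
theorem IsSymplectic.hasTriangular_iff {K V : Type*} [Field K] [AddCommGroup V] [Module K V]
    {ξ : LinearMap.BilinForm K V} {k : ℕ} [FiniteDimensional K V] (h : IsSymplectic ξ)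
    (hk : ¬ Even k) {Y : Submodule K V} (hY : IsRegular ξ Y) (hd : finrank K Y = k + 1) (r : ℕ) :
    HasTriangular (adjacency ξ k).Adj (fun U => U.1 ≤ Y) r ↔ r ≤ k + 1 := by
  constructor
  · rintro ⟨a, b, h1, h2⟩
    choose x hx hx0 hax using fun i => h.exists_eq_hyperplane hY hd (h1 i).1
    choose y hy hy0 hby using fun i => h.exists_eq_hyperplane hY hd (h1 i).2.1
    rw [← hd]
    refine card_le_finrank_of_triangular (a := x) (b := y) (ξ := ξ) hx (fun i => ?_)
      fun i j hij => ?_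
    · rw [← h.adj_hyperplane_iff hk hY hd (hx i) (hx0 i) (hy i) (hy0 i), ← hax, ← hby]
      exact (h1 i).2.2
    · by_contra hne
      rw [← ne_eq, ← h.adj_hyperplane_iff hk hY hd (hx j) (hx0 j) (hy i) (hy0 i), ← hax,
        ← hby] at hne
      exact h2 i j hij hne
  · intro hr
    obtain ⟨a, b, ha, hb, hab, h0⟩ := hY.exists_triangular h.alt (hd ▸ hr)
    have ha0 : ∀ i, a i ≠ 0 := fun i e => hab i (by simp [e])
    have hb0 : ∀ i, b i ≠ 0 := fun i e => hab i (by simp [e])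
    refine ⟨fun i => hyperplane h.alt hY hd (a i) (ha i) (ha0 i),
      fun i => hyperplane h.alt hY hd (b i) (hb i) (hb0 i), fun i => ⟨perpIn_le, perpIn_le, ?_⟩,
      fun i j hij => ?_⟩
    · rw [h.adj_hyperplane_iff hk]
      exact hab i
    · rw [h.adj_hyperplane_iff hk, not_not]
      exact h0 i j hij

/-- Since ξ is alternating, each nonzero x in Y lies in its own hyperplane x^⊥ ∩ Y. -/
theorem IsSymplectic.le_of_forall_le {K V : Type*} [Field K] [AddCommGroup V] [Module K V]
    {ξ : LinearMap.BilinForm K V} {k : ℕ} [FiniteDimensional K V] (h : IsSymplectic ξ)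
    (hk : Even (k + 1)) {Y Y' : TR ξ (k + 1)} (hle : ∀ U : TR ξ k, U.1 ≤ Y.1 → U.1 ≤ Y'.1) :
    Y.1 ≤ Y'.1 := by
  intro x hx
  by_cases hx0 : x = 0
  · rw [hx0]; exact zero_mem _
  · exact hle (hyperplane h.alt (h.isRegular hk Y) Y.finrank_eq x hx hx0) perpIn_le
      (perpIn_self_mem h.alt hx)

/-- For odd `k`, a definition of the elements of `(T-R)_{k+1}` as sets of elements of `(T-R)_k`
yields a definition of the Grassmann space on `(T-R)_{k+1}`. -/
theorem definableFromAdjacency_succ {n k m : ℕ} (hk : ¬ Even k) (hkn : k + 3 ≤ n)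
    {Dom : ∀ M : Type v, (M → M → Prop) → (Fin m → M) → Prop}
    {Mem : ∀ M : Type v, (M → M → Prop) → (Fin m → M) → M → Prop}
    (hDom : ∀ {α : Type} (t : Fin m → α), UniformlyDefinable fun M A x => Dom M A (x ∘ t))
    (hMem : ∀ {α : Type} (t : Fin m → α) (a : α),
      UniformlyDefinable fun M A x => Mem M A (x ∘ t) (x a))
    (H : ∀ (K : Type u) (V : Type v) [Field K] [AddCommGroup V] [Module K V]
      (ξ : LinearMap.BilinForm K V), IsSymplecticSpace ξ n →
      (∀ t, Dom _ (adjacency ξ k).Adj t → ∃ Y : TR ξ (k + 1),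
        ∀ U, Mem _ (adjacency ξ k).Adj t U ↔ U.1 ≤ Y.1) ∧
      ∀ Y : TR ξ (k + 1), ∃ t, Dom _ (adjacency ξ k).Adj t ∧
        ∀ U, Mem _ (adjacency ξ k).Adj t U ↔ U.1 ≤ Y.1) :
    DefinableFromAdjacency.{u, v} n k (k + 1) := by
  let Eqv : ∀ M : Type v, (M → M → Prop) → (Fin m → M) → (Fin m → M) → Prop :=
    fun M A t t' => ∀ U, Mem M A t U ↔ Mem M A t' U
  have hEqv : ∀ {α : Type} (t t' : Fin m → α),
      UniformlyDefinable fun M A x => Eqv M A (x ∘ t) (x ∘ t') := fun t t' =>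
    .forall_elem ((hMem (Sum.inl ∘ t) (.inr ())).iff (hMem (Sum.inl ∘ t') (.inr ())))
  -- In the even dimension k + 1, adjacency is being distinct with a common hyperplane; that
  -- hyperplane is automatically an element of `TR ξ k`.
  let Ad : ∀ M : Type v, (M → M → Prop) → (Fin m → M) → (Fin m → M) → Prop :=
    fun M A t t' => ¬ Eqv M A t t' ∧ ∃ U, Mem M A t U ∧ Mem M A t' U
  have hAd : ∀ {α : Type} (t t' : Fin m → α),
      UniformlyDefinable fun M A x => Ad M A (x ∘ t) (x ∘ t') := fun t t' =>
    (hEqv t t').not.and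
      (.exists_elem ((hMem (Sum.inl ∘ t) (.inr ())).and (hMem (Sum.inl ∘ t') (.inr ()))))
  have hAE : ∀ {α : Type} (t t' : Fin m → α), UniformlyDefinable fun M A x =>
      Ad M A (x ∘ t) (x ∘ t') ∨ Eqv M A (x ∘ t) (x ∘ t') := fun t t' => (hAd t t').or (hEqv t t')
  refine definableFromAdjacency_of_points (Ad := Ad)
    (Inc := fun M A t t' t'' => ∀ z : Fin m → M, Dom M A z → (Ad M A z t ∨ Eqv M A z t) →
      (Ad M A z t' ∨ Eqv M A z t') → (Ad M A z t'' ∨ Eqv M A z t''))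
    hDom hMem hAd (fun t t' t'' => .forall_tuple ((hDom .inr).imp ((hAE .inr (Sum.inl ∘ t)).imp
      ((hAE .inr (Sum.inl ∘ t')).imp (hAE .inr (Sum.inl ∘ t'')))))) ?_
  intro K V _ _ _ ξ hξ
  have := hξ.2.1
  have hs := hξ.isSymplectic
  have hn := hξ.2.2.1
  obtain ⟨H1, H2⟩ := H K V ξ hξ
  have hk1 : Even (k + 1) := by rw [Nat.even_add_one]; exact hk
  choose f hf using H1
  have hEq : ∀ t t', ∀ ht ht', Eqv _ (adjacency ξ k).Adj t t' ↔ f t ht = f t' ht' := by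
    intro t t' ht ht'
    constructor
    · intro h
      refine Subtype.ext (le_antisymm (hs.le_of_forall_le hk1 fun U hU => ?_)
        (hs.le_of_forall_le hk1 fun U hU => ?_))
      · rwa [← hf t' ht', ← h, hf t ht]
      · rwa [← hf t ht, h, hf t' ht']
    · intro h U
      rw [hf t ht, hf t' ht', h]
  have hA : ∀ t t', ∀ ht ht', Ad _ (adjacency ξ k).Adj t t' ↔
      (adjacency ξ (k + 1)).Adj (f t ht) (f t' ht') := by
    intro t t' ht ht'
    constructor
    · rintro ⟨hne, U, hU, hU'⟩
      rw [hf t ht] at hU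
      rw [hf t' ht'] at hU'
      rw [hEq t t' ht ht'] at hne
      exact (hs.adj_or_eq_of_ge hk1 (by rw [U.finrank_eq]) hU hU').resolve_right hne
    · intro hadj
      obtain ⟨h1, h2, h3, -⟩ := adj_iff.1 hadj
      refine ⟨fun h => h1 ((hEq _ _ _ _).1 h), TR.of _ (by omega) h3, ?_, ?_⟩
      · rw [hf t ht]; exact inf_le_left
      · rw [hf t' ht']; exact inf_le_right
  have hS : ∀ Y, ∃ t ht, f t ht = Y := by
    intro Y
    obtain ⟨t, ht, hY⟩ := H2 Y
    refine ⟨t, ht, Subtype.ext (le_antisymm (hs.le_of_forall_le hk1 fun U hU => ?_)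
        (hs.le_of_forall_le hk1 fun U hU => ?_))⟩
    · rwa [← hY, hf t ht]
    · rwa [← hf t ht, hY]
  refine ⟨fun t => f t.1 t.2, fun Y => ?_, fun t U => ?_, fun t t' h => (hEq _ _ _ _).1 h,
    fun t t' => hA _ _ _ _, fun t t' t'' hadj => ?_⟩
  · obtain ⟨t, ht, rfl⟩ := hS Y
    exact ⟨⟨t, ht⟩, rfl⟩
  · rw [hf t.1 t.2]
    refine ⟨.inr, fun h => h.resolve_left fun hle => ?_⟩
    have := Submodule.finrank_mono hle
    rw [U.finrank_eq, (f t.1 t.2).finrank_eq] at this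
    omega
  · rw [hs.mem_line_iff hk1 (by rcases hk1 with ⟨r, hr⟩; omega) (by omega) hadj]
    constructor
    · intro h T hT hT'
      obtain ⟨z, hz, rfl⟩ := hS T
      rw [← hA, ← hEq] at hT hT' ⊢
      exact h z hz hT hT'
    · intro h z hz h1 h2
      rw [hA _ _ hz t.2, hEq _ _ hz t.2] at h1
      rw [hA _ _ hz t'.2, hEq _ _ hz t'.2] at h2
      rw [hA _ _ hz t''.2, hEq _ _ hz t''.2]
      exact h _ h1 h2

/-! ### The case `k = 1` -/

section Sup

variable {K V : Type*} [Field K] [AddCommGroup V] [Module K V] {ξ : LinearMap.BilinForm K V}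
  {k : ℕ} [FiniteDimensional K V]

/-- Extensions of a regular subspace `H` by two vectors orthogonal to `H`. -/
theorem isRegular_sup_iff (hA : ξ.IsAlt) {H : Submodule K V} (hH : IsRegular ξ H) {x y : V}
    (hx : x ∈ ξ.orthogonal H) (hy : y ∈ ξ.orthogonal H) (hx0 : x ≠ 0) :
    IsRegular ξ ((H ⊔ K ∙ x) ⊔ (H ⊔ K ∙ y)) ↔ ξ x y ≠ 0 := by
  have hmem : ∀ z ∈ (H ⊔ K ∙ x) ⊔ (H ⊔ K ∙ y), ∃ a ∈ H, ∃ c d : K, z = a + c • x + d • y := by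
    intro z hz
    obtain ⟨p, hp, q, hq, rfl⟩ := Submodule.mem_sup.1 hz
    obtain ⟨a, ha, c, hc, rfl⟩ := Submodule.mem_sup.1 hp
    obtain ⟨b, hb, d, hd, rfl⟩ := Submodule.mem_sup.1 hq
    obtain ⟨c, rfl⟩ := Submodule.mem_span_singleton.1 hc
    obtain ⟨d, rfl⟩ := Submodule.mem_span_singleton.1 hd
    exact ⟨a + b, H.add_mem ha hb, c, d, by abel⟩
  have hxm : x ∈ (H ⊔ K ∙ x) ⊔ (H ⊔ K ∙ y) :=
    Submodule.mem_sup_left (Submodule.mem_sup_right (Submodule.mem_span_singleton_self x))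
  have hym : y ∈ (H ⊔ K ∙ x) ⊔ (H ⊔ K ∙ y) :=
    Submodule.mem_sup_right (Submodule.mem_sup_right (Submodule.mem_span_singleton_self y))
  rw [isRegular_iff]
  constructor
  · intro h h0
    refine hx0 (h x hxm fun u hu => ?_)
    obtain ⟨a, ha, c, d, rfl⟩ := hmem u hu
    have h1 : ξ a x = 0 := hx a ha
    have h2 : ξ y x = 0 := eq_zero_comm hA h0
    have h3 : ξ x x = 0 := hA x
    simp [h1, h2, h3]
  · intro h0 z hz hzu
    obtain ⟨a, ha, c, d, rfl⟩ := hmem z hz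
    have e1 := hzu x hxm
    have e2 := hzu y hym
    have h1 : ξ x a = 0 := eq_zero_comm hA (hx a ha)
    have h2 : ξ y a = 0 := eq_zero_comm hA (hy a ha)
    have h3 : ξ x x = 0 := hA x
    have h4 : ξ y y = 0 := hA y
    have h5 : ξ y x ≠ 0 := fun h => h0 (eq_zero_comm hA h)
    simp only [map_add, map_smul, smul_eq_mul, h1, h2, h3, h4, mul_zero, add_zero, zero_add,
      mul_eq_zero, h0, h5, or_false] at e1 e2
    subst e1 e2
    simp only [zero_smul, add_zero] at hzu ⊢
    exact isRegular_iff.1 hH a ha fun u hu =>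
      hzu u (Submodule.mem_sup_left (Submodule.mem_sup_left hu))

theorem isRegular_bot : IsRegular ξ ⊥ := by
  rw [IsRegular, rad, bot_inf_eq]

/-- The one-dimensional subspace spanned by a vector. -/
def point (ξ : LinearMap.BilinForm K V) (x : V) (hx : x ≠ 0) : TR ξ 1 :=
  TR.of (K ∙ x) (finrank_span_singleton hx)
    ((Submodule.finrank_mono (rad_le _)).trans (finrank_span_singleton hx).le)

theorem exists_eq_point (U : TR ξ 1) : ∃ x hx, U = point ξ x hx := by
  obtain ⟨x, hx, hx0⟩ := exists_ne_zero_of_finrank_pos (S := U.1) (by rw [U.finrank_eq]; omega)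
  refine ⟨x, hx0, Subtype.ext (eq_of_le_of_finrank_eq' ?_ ?_).symm⟩
  · exact (Submodule.span_singleton_le_iff_mem _ _).2 hx
  · rw [TR.finrank_eq, TR.finrank_eq]

theorem point_le_iff {x : V} {hx : x ≠ 0} {Y : Submodule K V} : (point ξ x hx).1 ≤ Y ↔ x ∈ Y :=
  Submodule.span_singleton_le_iff_mem _ _

theorem IsSymplectic.adj_point_iff (h : IsSymplectic ξ) {x y : V} {hx : x ≠ 0} {hy : y ≠ 0} :
    (adjacency ξ 1).Adj (point ξ x hx) (point ξ y hy) ↔ ξ x y ≠ 0 := by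
  have key := isRegular_sup_iff h.alt (isRegular_bot (ξ := ξ)) (x := x) (y := y)
    (by simp) (by simp) hx
  rw [bot_sup_eq, bot_sup_eq] at key
  rw [h.adj_iff_of_odd (by decide), ← key]
  refine ⟨fun h => h.2.2.2, fun hr => ?_⟩
  have hne : point ξ x hx ≠ point ξ y hy := by
    intro e
    have hyx : y ∈ (point ξ x hx).1 := by rw [e]; exact Submodule.mem_span_singleton_self y
    obtain ⟨c, rfl⟩ := Submodule.mem_span_singleton.1 hyx
    rw [key] at hr
    exact hr (by rw [map_smul, h.alt x, smul_zero])
  obtain ⟨h1, -⟩ := inf_eq_and_finrank_sup (X := (⊥ : Submodule K V))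
    (point ξ x hx).finrank_eq (point ξ y hy).finrank_eq (by simp) bot_le bot_le
    (fun e => hne (Subtype.ext e))
  rw [h1, finrank_bot]
  exact ⟨hne, rfl, isRegular_bot, hr⟩

end Sup

/-- On points, non-adjacency is orthogonality. A regular plane is spanned by a nonorthogonal pair,
and its points form the double orthogonal complement of that pair. -/
theorem definableFromAdjacency_one_two {n : ℕ} (hn : 4 ≤ n) :
    DefinableFromAdjacency.{u, v} n 1 2 := by
  refine definableFromAdjacency_succ (m := 2) (by decide) hn
    (Dom := fun M A t => A (t 0) (t 1))
    (Mem := fun M A t c => ∀ z, ¬ A z (t 0) → ¬ A z (t 1) → ¬ A z c)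
    (fun t => .rel (t 0) (t 1))
    (fun t c => .forall_elem ((UniformlyDefinable.rel (Sum.inr ()) (Sum.inl (t 0))).not.imp
      ((UniformlyDefinable.rel (Sum.inr ()) (Sum.inl (t 1))).not.imp
        (UniformlyDefinable.rel (Sum.inr ()) (Sum.inl c)).not))) ?_
  intro K V _ _ _ ξ hξ
  have := hξ.2.1
  have hs := hξ.isSymplectic
  have key : ∀ t : Fin 2 → TR ξ 1, (adjacency ξ 1).Adj (t 0) (t 1) → ∀ U : TR ξ 1,
      (∀ z, ¬ (adjacency ξ 1).Adj z (t 0) → ¬ (adjacency ξ 1).Adj z (t 1) →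
        ¬ (adjacency ξ 1).Adj z U) ↔ U.1 ≤ (t 0).1 ⊔ (t 1).1 := by
    intro t ht U
    obtain ⟨a, ha, e0⟩ := exists_eq_point (t 0)
    obtain ⟨b, hb, e1⟩ := exists_eq_point (t 1)
    obtain ⟨c, hc, rfl⟩ := exists_eq_point U
    rw [e0, e1, point_le_iff]
    constructor
    · intro h
      rw [← orthogonal_orthogonal hs.alt hs.nondeg (_ ⊔ _)]
      intro z hz
      by_cases hz0 : z = 0
      · simp [hz0]
      have h1 := h (point ξ z hz0)
      rw [hs.adj_point_iff, hs.adj_point_iff, hs.adj_point_iff, not_not, not_not, not_not] at h1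
      exact h1 (eq_zero_comm hs.alt (hz a (Submodule.mem_sup_left
        (Submodule.mem_span_singleton_self a)))) (eq_zero_comm hs.alt (hz b
          (Submodule.mem_sup_right (Submodule.mem_span_singleton_self b))))
    · intro hcm Z
      obtain ⟨z, hz, rfl⟩ := exists_eq_point Z
      rw [hs.adj_point_iff, hs.adj_point_iff, hs.adj_point_iff, not_not, not_not, not_not]
      intro h1 h2
      obtain ⟨p, hp, q, hq, rfl⟩ := Submodule.mem_sup.1 hcm
      obtain ⟨d, rfl⟩ := Submodule.mem_span_singleton.1 hp
      obtain ⟨e, rfl⟩ := Submodule.mem_span_singleton.1 hq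
      simp [h1, h2]
  constructor
  · intro t ht
    have h1 := adj_iff.1 ht
    exact ⟨TR.of ((t 0).1 ⊔ (t 1).1) (finrank_sup_of_inf (t 0).finrank_eq (t 1).finrank_eq h1.2.1)
      h1.2.2.2, key t ht⟩
  · intro Y
    have hY := hs.isRegular (by decide) Y
    obtain ⟨a, b, ha, hb, hab, -⟩ := hY.exists_triangular (r := 1) hs.alt (by
      rw [Y.finrank_eq]; omega)
    have ha0 : a 0 ≠ 0 := fun e => hab 0 (by simp [e])
    have hb0 : b 0 ≠ 0 := fun e => hab 0 (by simp [e])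
    have hadj : (adjacency ξ 1).Adj (point ξ (a 0) ha0) (point ξ (b 0) hb0) :=
      hs.adj_point_iff.2 (hab 0)
    refine ⟨![point ξ (a 0) ha0, point ξ (b 0) hb0], hadj, fun U => (key _ hadj U).trans ?_⟩
    have h1 := finrank_sup_of_inf (point ξ (a 0) ha0).finrank_eq (point ξ (b 0) hb0).finrank_eq
      (adj_iff.1 hadj).2.1
    rw [← eq_of_le_of_finrank_eq' (sup_le (point_le_iff.2 (ha 0)) (point_le_iff.2 (hb 0)))
      (by rw [h1, Y.finrank_eq])]
    rfl

/-! ### Pairs of non-adjacent elements with a diamond of common neighbours -/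

section Graph

variable {M : Type*} (A : M → M → Prop)

/-- The common neighbours of `s` and `t` contain four elements, all but one pair of which are
adjacent. -/
def HasDiamond (s t : M) : Prop :=
  ∃ z : Fin 4 → M, (∀ i, A (z i) s ∧ A (z i) t) ∧ A (z 0) (z 1) ∧ A (z 0) (z 2) ∧ A (z 0) (z 3) ∧
    A (z 1) (z 2) ∧ A (z 1) (z 3) ∧ z 2 ≠ z 3 ∧ ¬ A (z 2) (z 3)

/-- The diamond serves to exclude, in odd dimension, pairs meeting in codimension two. -/
def IsPure (s t : M) : Prop := s ≠ t ∧ ¬ A s t ∧ HasDiamond A s t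

/-- Being adjacent to two distinct non-adjacent common neighbours of `s` and `t`. -/
def InHull (s t : M) (x : M) : Prop :=
  ∃ z : Fin 2 → M, (∀ i, A (z i) s ∧ A (z i) t ∧ A x (z i)) ∧ z 0 ≠ z 1 ∧ ¬ A (z 0) (z 1)

end Graph

theorem uniformlyDefinable_isPure {α : Type} (a b : α) :
    UniformlyDefinable.{v} fun _ A x => IsPure A (x a) (x b) := by
  refine (UniformlyDefinable.eq a b).not.and ((UniformlyDefinable.rel a b).not.and ?_)
  refine .exists_tuple (.and (.forall_index fun i => .and (.rel (Sum.inr i) (Sum.inl a))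
    (.rel (Sum.inr i) (Sum.inl b))) ?_)
  exact .and (.rel (Sum.inr 0) (Sum.inr 1)) (.and (.rel (Sum.inr 0) (Sum.inr 2)) (.and (.rel (Sum.inr 0) (Sum.inr 3))
    (.and (.rel (Sum.inr 1) (Sum.inr 2)) (.and (.rel (Sum.inr 1) (Sum.inr 3))
      (.and (.not (.eq (Sum.inr 2) (Sum.inr 3))) (.not (.rel (Sum.inr 2) (Sum.inr 3))))))))

theorem uniformlyDefinable_inHull {α : Type} (a b c : α) :
    UniformlyDefinable.{v} fun _ A x => InHull A (x a) (x b) (x c) :=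
  .exists_tuple (.and (.forall_index fun i => .and (.rel (Sum.inr i) (Sum.inl a))
    (.and (.rel (Sum.inr i) (Sum.inl b)) (.rel (Sum.inl c) (Sum.inr i))))
    (.and (.not (.eq (Sum.inr 0) (Sum.inr 1))) (.not (.rel (Sum.inr 0) (Sum.inr 1)))))

theorem uniformlyDefinable_hasTriangular_inHull {α : Type} (a b : α) (r : ℕ) :
    UniformlyDefinable.{v} fun _ A x => HasTriangular A (InHull A (x a) (x b)) r := by
  have hI := @uniformlyDefinable_inHull.{v}
  refine .exists_tuple (.exists_tuple (.and (.forall_index fun i => .and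
    (hI (Sum.inl (Sum.inl a)) (Sum.inl (Sum.inl b)) (Sum.inl (Sum.inr i))) (.and
    (hI (Sum.inl (Sum.inl a)) (Sum.inl (Sum.inl b)) (Sum.inr i)) (.rel (Sum.inl (Sum.inr i)) (Sum.inr i))))
    (.forall_index fun i => .forall_index fun j => .imp_of_const
      (.not (.rel (Sum.inl (Sum.inr j)) (Sum.inr i))))))

/-! ### Odd dimension: common neighbours of non-adjacent elements. -/

section Odd

variable {K V : Type*} [Field K] [AddCommGroup V] [Module K V] {ξ : LinearMap.BilinForm K V}
  {k : ℕ} [FiniteDimensional K V]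

/-- Otherwise z contains s ⊓ t, which is then the regular subspace z ⊓ s; with the regular join this
would make s and t adjacent. -/
theorem IsSymplectic.le_sup_of_adj (h : IsSymplectic ξ) (hk : ¬ Even k) {s t z : TR ξ k}
    (hne : s ≠ t) (hst : ¬ (adjacency ξ k).Adj s t) (hd : finrank K ↥(s.1 ⊓ t.1) + 1 = k)
    (hreg : IsRegular ξ (s.1 ⊔ t.1)) (hs : (adjacency ξ k).Adj z s)
    (ht : (adjacency ξ k).Adj z t) : z.1 ≤ s.1 ⊔ t.1 := by
  have h1 := (h.adj_iff_of_odd hk).1 hs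
  have h2 := (h.adj_iff_of_odd hk).1 ht
  refine (SympGrassmann.inf_le_or_le_sup z.finrank_eq hd h1.2.1 h2.2.1).resolve_left fun hle => hst ?_
  have e : s.1 ⊓ t.1 = z.1 ⊓ s.1 :=
    eq_of_le_of_finrank_eq' (le_inf hle inf_le_left) (by have := h1.2.1; omega)
  rw [h.adj_iff_of_odd hk]
  exact ⟨hne, hd, e ▸ h1.2.2.1, hreg⟩

theorem eq_sup_inf_of_codim_two {s t z : Submodule K V} (hz : finrank K z = k)
    (hd : finrank K ↥(s ⊓ t) + 2 = k) (hzs : finrank K ↥(z ⊓ s) + 1 = k)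
    (hzt : finrank K ↥(z ⊓ t) + 1 = k) : z = (z ⊓ s) ⊔ (z ⊓ t) := by
  refine (sup_eq_and_finrank_inf (k := k - 1) (by omega) (by omega) (by omega)
    inf_le_left inf_le_left fun e => ?_).1.symm
  have := Submodule.finrank_mono (le_inf inf_le_right (e.le.trans inf_le_right) : z ⊓ s ≤ s ⊓ t)
  omega

/-- The common neighbours of two elements meeting in codimension two behave like a grid: adjacent
ones agree in a row or a column. -/
theorem IsSymplectic.inf_eq_or_inf_eq (h : IsSymplectic ξ) (hk : ¬ Even k) {s t z y : TR ξ k}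
    (hd : finrank K ↥(s.1 ⊓ t.1) + 2 = k) (hzs : (adjacency ξ k).Adj z s)
    (hzt : (adjacency ξ k).Adj z t) (hys : (adjacency ξ k).Adj y s)
    (hyt : (adjacency ξ k).Adj y t) (hzy : (adjacency ξ k).Adj z y) :
    z.1 ⊓ s.1 = y.1 ⊓ s.1 ∨ z.1 ⊓ t.1 = y.1 ⊓ t.1 := by
  rw [h.adj_iff_of_odd hk] at hzs hzt hys hyt hzy
  by_contra! hne
  obtain ⟨h1, -⟩ := sup_eq_and_finrank_inf (k := k - 1) (Y := s.1)
    (by have := hzs.2.1; omega) (by have := hys.2.1; omega) (by rw [s.finrank_eq]; omega)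
    inf_le_right inf_le_right hne.1
  obtain ⟨h2, -⟩ := sup_eq_and_finrank_inf (k := k - 1) (Y := t.1)
    (by have := hzt.2.1; omega) (by have := hyt.2.1; omega) (by rw [t.finrank_eq]; omega)
    inf_le_right inf_le_right hne.2
  -- If both traces differ, they generate s and t inside z ⊔ y; but that has dimension k + 1, and s
  -- ⊔ t has dimension k + 2.
  have h3 : s.1 ⊔ t.1 ≤ z.1 ⊔ y.1 := by
    rw [← h1, ← h2]
    exact sup_le (sup_le_sup inf_le_left inf_le_left) (sup_le_sup inf_le_left inf_le_left)
  have h4 := Submodule.finrank_mono h3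
  have h5 := Submodule.finrank_sup_add_finrank_inf_eq s.1 t.1
  rw [finrank_sup_of_inf z.finrank_eq y.finrank_eq hzy.2.1] at h4
  rw [s.finrank_eq, t.finrank_eq] at h5
  omega

/-- The meet of d and e is their common trace on s, regular as d is adjacent to s; their join is d ⊔
t, regular as d is adjacent to t. -/
theorem IsSymplectic.adj_of_inf_eq (h : IsSymplectic ξ) (hk : ¬ Even k) {s t d e : TR ξ k}
    (hd : finrank K ↥(s.1 ⊓ t.1) + 2 = k) (hds : (adjacency ξ k).Adj d s)
    (hdt : (adjacency ξ k).Adj d t) (_hes : (adjacency ξ k).Adj e s)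
    (het : (adjacency ξ k).Adj e t) (hne : d ≠ e) (heq : d.1 ⊓ s.1 = e.1 ⊓ s.1) :
    (adjacency ξ k).Adj d e := by
  rw [h.adj_iff_of_odd hk] at hds hdt het ⊢
  have hne' : d.1 ≠ e.1 := fun h => hne (Subtype.ext h)
  obtain ⟨h1, h2⟩ := inf_eq_and_finrank_sup d.finrank_eq e.finrank_eq hds.2.1 inf_le_left
    (heq.le.trans inf_le_left) hne'
  have hnt : d.1 ⊓ t.1 ≠ e.1 ⊓ t.1 := fun h' => hne' <| by
    rw [eq_sup_inf_of_codim_two d.finrank_eq hd hds.2.1 hdt.2.1,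
      eq_sup_inf_of_codim_two e.finrank_eq hd (by rw [← heq]; exact hds.2.1) het.2.1, heq, h']
  obtain ⟨h3, -⟩ := sup_eq_and_finrank_inf (k := k - 1) (Y := t.1)
    (by have := hdt.2.1; omega) (by have := het.2.1; omega) (by rw [t.finrank_eq]; omega)
    inf_le_right inf_le_right hnt
  have h4 : d.1 ⊔ t.1 = d.1 ⊔ e.1 := by
    refine eq_of_le_of_finrank_eq' (sup_le le_sup_left ?_) ?_
    · rw [← h3]
      exact sup_le_sup inf_le_left inf_le_left
    · rw [h2, finrank_sup_of_inf d.finrank_eq t.finrank_eq hdt.2.1]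
  refine ⟨hne, h1 ▸ hds.2.1, h1 ▸ hds.2.2.1, h4 ▸ hdt.2.2.2⟩

/-- Think of the traces on s and t as row and column. Then z 2 and z 3 differ in both, and z 0, z 1
must each occupy one of the two remaining corners of their rectangle. In the same corner they
coincide; in opposite corners they agree in neither coordinate and cannot be adjacent. -/
theorem IsSymplectic.not_hasDiamond (h : IsSymplectic ξ) (hk : ¬ Even k) {s t : TR ξ k}
    (hd : finrank K ↥(s.1 ⊓ t.1) + 2 = k) : ¬ HasDiamond (adjacency ξ k).Adj s t := by
  rintro ⟨z, hz, h01, h02, h03, h12, h13, hne, hna⟩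
  have hd' : finrank K ↥(t.1 ⊓ s.1) + 2 = k := by rwa [inf_comm]
  have key : ∀ i j, (adjacency ξ k).Adj (z i) (z j) →
      (z i).1 ⊓ s.1 = (z j).1 ⊓ s.1 ∨ (z i).1 ⊓ t.1 = (z j).1 ⊓ t.1 := fun i j hij =>
    h.inf_eq_or_inf_eq hk hd (hz i).1 (hz i).2 (hz j).1 (hz j).2 hij
  have hs : (z 2).1 ⊓ s.1 ≠ (z 3).1 ⊓ s.1 := fun e =>
    hna (h.adj_of_inf_eq hk hd (hz 2).1 (hz 2).2 (hz 3).1 (hz 3).2 hne e)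
  have ht : (z 2).1 ⊓ t.1 ≠ (z 3).1 ⊓ t.1 := fun e =>
    hna (h.adj_of_inf_eq hk hd' (hz 2).2 (hz 2).1 (hz 3).2 (hz 3).1 hne e)
  have hst : ∀ i, (z i).1 = ((z i).1 ⊓ s.1) ⊔ ((z i).1 ⊓ t.1) := fun i =>
    eq_sup_inf_of_codim_two (z i).finrank_eq hd (adj_iff.1 (hz i).1).2.1 (adj_iff.1 (hz i).2).2.1
  have hne01 : ¬ ((z 0).1 ⊓ s.1 = (z 1).1 ⊓ s.1 ∧ (z 0).1 ⊓ t.1 = (z 1).1 ⊓ t.1) := by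
    rintro ⟨e1, e2⟩
    refine h01.1 (Subtype.ext ?_)
    rw [hst 0, hst 1, e1, e2]
  have k01 := key 0 1 h01
  have k02 := key 0 2 h02
  have k03 := key 0 3 h03
  have k12 := key 1 2 h12
  have k13 := key 1 3 h13
  grind

/-- Look at one common neighbour z. If its traces on s and t agree, they equal s ⊓ t, which is
regular. If not, s ⊓ t has codimension at most two; two is excluded by the diamond, and for
codimension one z ⊔ s = s ⊔ t is regular. -/
theorem IsSymplectic.regular_of_isPure (h : IsSymplectic ξ) (hk : ¬ Even k) {s t : TR ξ k}
    (hp : IsPure (adjacency ξ k).Adj s t) : finrank K ↥(s.1 ⊓ t.1) + 1 = k ∧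
      (IsRegular ξ (s.1 ⊔ t.1) ∨ IsRegular ξ (s.1 ⊓ t.1)) := by
  obtain ⟨hne, hna, hD⟩ := hp
  have hne' : s.1 ≠ t.1 := fun e => hne (Subtype.ext e)
  obtain ⟨z, hz, -⟩ := id hD
  have h1 := (h.adj_iff_of_odd hk).1 (hz 0).1
  have h2 := (h.adj_iff_of_odd hk).1 (hz 0).2
  by_cases e : (z 0).1 ⊓ s.1 = (z 0).1 ⊓ t.1
  · obtain ⟨h3, -⟩ := inf_eq_and_finrank_sup s.finrank_eq t.finrank_eq h1.2.1 inf_le_right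
      (e.le.trans inf_le_right) hne'
    rw [h3]
    exact ⟨h1.2.1, .inr h1.2.2.1⟩
  · obtain ⟨h3, h4⟩ := sup_eq_and_finrank_inf (k := k - 1) (Y := (z 0).1)
      (by have := h1.2.1; omega)
      (by have := h2.2.1; omega) (by rw [(z 0).finrank_eq]; have := h1.2.1; omega)
      inf_le_left inf_le_left e
    have h5 := Submodule.finrank_mono (inf_le_inf inf_le_right inf_le_right :
      ((z 0).1 ⊓ s.1) ⊓ ((z 0).1 ⊓ t.1) ≤ s.1 ⊓ t.1)
    have h6 : finrank K ↥(s.1 ⊓ t.1) < k := by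
      refine lt_of_lt_of_eq (Submodule.finrank_lt_finrank_of_lt
        (lt_of_le_of_ne inf_le_left fun e => hne' ?_)) s.finrank_eq
      exact eq_of_le_of_finrank_eq' (inf_eq_left.1 e) (by rw [s.finrank_eq, t.finrank_eq])
    have h7 : finrank K ↥(s.1 ⊓ t.1) + 2 ≠ k := fun e => h.not_hasDiamond hk e hD
    have h8 : finrank K ↥(s.1 ⊓ t.1) + 1 = k := by omega
    refine ⟨h8, .inl ?_⟩
    have h9 : (z 0).1 ⊔ s.1 = s.1 ⊔ t.1 := by
      refine eq_of_le_of_finrank_eq' (sup_le ?_ le_sup_left) ?_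
      · rw [← h3]
        exact sup_le_sup inf_le_right inf_le_right
      · rw [finrank_sup_of_inf s.finrank_eq t.finrank_eq h8,
          finrank_sup_of_inf (z 0).finrank_eq s.finrank_eq h1.2.1]
    exact h9 ▸ h1.2.2.2

/-! ### Vectors in a regular subspace of dimension at least four -/

theorem IsRegular.exists_perp_not_perp (hA : ξ.IsAlt) {Y : Submodule K V} (hY : IsRegular ξ Y)
    {s t : V} (hs : s ∈ Y) (ht : t ∈ Y) (hs0 : s ≠ 0) (hst : t ∉ K ∙ s) :
    ∃ f ∈ Y, ξ s f = 0 ∧ ξ t f = 1 := by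
  have ht0 : t ≠ 0 := fun e => hst (by rw [e]; exact zero_mem _)
  obtain ⟨f, hf, hf'⟩ : ∃ f ∈ perpIn ξ Y s, f ∉ perpIn ξ Y t := by
    by_contra! hle
    refine hst (mem_span_of_perpIn_eq hA hY hs hs0 ht (eq_of_le_of_finrank_eq' hle ?_))
    have h1 := finrank_perpIn hA hY hs hs0
    have h2 := finrank_perpIn hA hY ht ht0
    omega
  have h1 : ξ t f ≠ 0 := fun e => hf' ⟨hf.1, e⟩
  have h2 : ξ s f = 0 := hf.2
  exact ⟨(ξ t f)⁻¹ • f, Y.smul_mem _ hf.1, by simp [h2], by simp [h1]⟩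

theorem not_mem_span_symm {s t : V} (hs0 : s ≠ 0) (hst : t ∉ K ∙ s) : s ∉ K ∙ t := by
  intro h
  obtain ⟨c, hc⟩ := Submodule.mem_span_singleton.1 h
  have hc0 : c ≠ 0 := by rintro rfl; exact hs0 (by simpa using hc.symm)
  exact hst (Submodule.mem_span_singleton.2 ⟨c⁻¹, by rw [← hc, smul_smul, inv_mul_cancel₀ hc0,
    one_smul]⟩)

/-- Completing two orthogonal vectors to a symplectic frame. -/
theorem IsRegular.exists_frame (hA : ξ.IsAlt) {Y : Submodule K V} (hY : IsRegular ξ Y)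
    {s t : V} (hs : s ∈ Y) (ht : t ∈ Y) (hs0 : s ≠ 0) (hst : t ∉ K ∙ s) (h0 : ξ s t = 0) :
    ∃ f ∈ Y, ∃ g ∈ Y, ξ s f = 1 ∧ ξ t f = 0 ∧ ξ s g = 0 ∧ ξ t g = 1 ∧ ξ f g = 0 := by
  have ht0 : t ≠ 0 := fun e => hst (by rw [e]; exact zero_mem _)
  obtain ⟨g, hg, hsg, htg⟩ := hY.exists_perp_not_perp hA hs ht hs0 hst
  obtain ⟨f, hf, htf, hsf⟩ := hY.exists_perp_not_perp hA ht hs ht0 (not_mem_span_symm hs0 hst)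
  have h1 : ξ s s = 0 := hA s
  have h2 : ξ t s = 0 := eq_zero_comm hA h0
  have h3 : ξ f s = -1 := by rw [← hA.neg_eq s f, hsf]
  refine ⟨f, hf, g + ξ f g • s, Y.add_mem hg (Y.smul_mem _ hs), hsf, htf, ?_, ?_, ?_⟩
  · simp [hsg, h1]
  · simp [htg, h2]
  · simp [h3]

/-- Two independent orthogonal vectors, not orthogonal to any of three given ones. -/
theorem IsSymplectic.exists_perp_pair (h : IsSymplectic ξ) {Y : Submodule K V}
    (hY : IsRegular ξ Y) (hd : 4 ≤ finrank K Y) {s t x : V} (hs : s ∈ Y) (ht : t ∈ Y) (hx : x ∈ Y)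
    (hs0 : s ≠ 0) (hx0 : x ≠ 0) (hst : t ∉ K ∙ s) (h0 : ξ s t = 0) :
    ∃ d ∈ Y, ∃ e ∈ Y, ξ d e = 0 ∧ e ∉ K ∙ d ∧ ξ s d ≠ 0 ∧ ξ t d ≠ 0 ∧ ξ x d ≠ 0 ∧
      ξ s e ≠ 0 ∧ ξ t e ≠ 0 ∧ ξ x e ≠ 0 := by
  have h2 := h.two_ne_zero
  obtain ⟨f, hf, g, hg, hsf, htf, hsg, htg, -⟩ := hY.exists_frame h.alt hs ht hs0 hst h0
  obtain ⟨d, hd', hsd, htd, hxd⟩ : ∃ d ∈ Y, ξ s d ≠ 0 ∧ ξ t d ≠ 0 ∧ ξ x d ≠ 0 := by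
    by_cases hx1 : ξ x (f + g) = 0
    · obtain ⟨p, hp, hxp⟩ : ∃ p ∈ Y, ξ x p ≠ 0 := by
        by_contra! hall
        exact hx0 (isRegular_iff.1 hY x hx fun u hu => eq_zero_comm h.alt (hall u hu))
      have key : ∀ c : K, ξ s (p + c • (f + g)) = ξ s p + c ∧ ξ t (p + c • (f + g)) = ξ t p + c ∧
          ξ x (p + c • (f + g)) = ξ x p := by
        intro c
        refine ⟨?_, ?_, ?_⟩
        · simp [hsf, hsg]
        · simp [htf, htg]
        · rw [map_add, map_smul, hx1, smul_zero, add_zero]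
      -- Two values are to be avoided, and 0, 1, -1 are three distinct scalars. Adding multiples of
      -- f + g leaves the value of ξ x unchanged in this case.
      obtain ⟨c, hc1, hc2⟩ : ∃ c : K, ξ s p + c ≠ 0 ∧ ξ t p + c ≠ 0 := by
        by_contra! hall
        by_cases a : ξ s p = 0
        · have e1 := hall 1 (by rw [a]; simp)
          have e2 := hall (-1) (by rw [a]; simp)
          exact h2 (by linear_combination e1 - e2)
        · have e1 := hall 0 (by simpa using a)
          by_cases b : ξ s p + 1 = 0
          · have e2 := hall (-1) (fun e => h2 (by linear_combination b - e))
            exact one_ne_zero (α := K) (by linear_combination e1 - e2)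
          · have e2 := hall 1 b
            exact one_ne_zero (α := K) (by linear_combination e2 - e1)
      refine ⟨p + c • (f + g), Y.add_mem hp (Y.smul_mem _ (Y.add_mem hf hg)), ?_, ?_, ?_⟩
      · rwa [(key c).1]
      · rwa [(key c).2.1]
      · rwa [(key c).2.2]
    · exact ⟨f + g, Y.add_mem hf hg, by simp [hsf, hsg], by simp [htf, htg], hx1⟩
  have hd0 : d ≠ 0 := fun e => hsd (by simp [e])
  -- Three linear conditions leave a nonzero vector in dimension at least four. The second vector
  -- will be p + c • d, with c one of 1, -1 chosen for the sake of x.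
  obtain ⟨p, hp, hp0⟩ : ∃ p ∈ Y ⊓ ξ.orthogonal (K ∙ s ⊔ K ∙ t ⊔ K ∙ d), p ≠ 0 := by
    apply exists_ne_zero_of_finrank_pos
    have h3 := finrank_inf_lower Y (ξ.orthogonal (K ∙ s ⊔ K ∙ t ⊔ K ∙ d))
    have h4 := finrank_add_finrank_orthogonal h.nondeg (K ∙ s ⊔ K ∙ t ⊔ K ∙ d)
    have h5 := Submodule.finrank_add_le_finrank_add_finrank (K ∙ s ⊔ K ∙ t) (K ∙ d)
    have h6 := Submodule.finrank_add_le_finrank_add_finrank (K ∙ s) (K ∙ t)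
    have h7 := finrank_span_singleton (K := K) hd0
    have h8 := finrank_span_singleton (K := K) hs0
    have h9 := finrank_span_singleton (K := K) (v := t)
      fun e => hst (by rw [e]; exact zero_mem _)
    omega
  have hps : ξ s p = 0 := hp.2 s (Submodule.mem_sup_left (Submodule.mem_sup_left
    (Submodule.mem_span_singleton_self s)))
  have hpt : ξ t p = 0 := hp.2 t (Submodule.mem_sup_left (Submodule.mem_sup_right
    (Submodule.mem_span_singleton_self t)))
  have hpd : ξ d p = 0 := hp.2 d (Submodule.mem_sup_right (Submodule.mem_span_singleton_self d))
  have hdd : ξ d d = 0 := h.alt d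
  obtain ⟨c, hc0, hc⟩ : ∃ c : K, c ≠ 0 ∧ ξ x p + c * ξ x d ≠ 0 := by
    by_contra! hall
    have e1 := hall 1 one_ne_zero
    have e2 := hall (-1) (neg_ne_zero.2 one_ne_zero)
    have : 2 * ξ x d = 0 := by linear_combination e1 - e2
    exact (mul_ne_zero h2 hxd) this
  refine ⟨d, hd', p + c • d, Y.add_mem hp.1 (Y.smul_mem _ hd'), ?_, ?_, hsd, htd, hxd, ?_, ?_, ?_⟩
  · simp [hpd, hdd]
  · intro hmem
    obtain ⟨b, hb⟩ := Submodule.mem_span_singleton.1 hmem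
    have e : p = (b - c) • d := by rw [sub_smul, hb]; abel
    rw [e, map_smul, smul_eq_mul, mul_eq_zero] at hps
    rw [hps.resolve_right hsd, zero_smul] at e
    exact hp0 e
  · simp [hps, hc0, hsd]
  · simp [hpt, hc0, htd]
  · simpa using hc

end Odd

/-! ### Odd dimension: hulls of pairs, and pairs with a prescribed join. -/

section Odd

variable {K V : Type*} [Field K] [AddCommGroup V] [Module K V] {ξ : LinearMap.BilinForm K V}
  {k : ℕ} [FiniteDimensional K V]

theorem perpIn_eq_of_mem_span {Y : Submodule K V} {x y : V} (hy0 : y ≠ 0) (h : y ∈ K ∙ x) :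
    perpIn ξ Y x = perpIn ξ Y y := by
  obtain ⟨c, rfl⟩ := Submodule.mem_span_singleton.1 h
  have hc : c ≠ 0 := by rintro rfl; simp at hy0
  ext z
  simp [mem_perpIn, hc]

/-- The connecting elements lie below s ⊔ t by `le_sup_of_adj`, are themselves non-adjacent with
this join, and so force x below it as well. Conversely, in terms of poles, `exists_perp_pair`
supplies them; this needs dimension at least four. -/
theorem IsSymplectic.inHull_iff (h : IsSymplectic ξ) (hk : ¬ Even k) (hk3 : 3 ≤ k) {s t : TR ξ k}
    (hne : s ≠ t) (hst : ¬ (adjacency ξ k).Adj s t) (hd : finrank K ↥(s.1 ⊓ t.1) + 1 = k)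
    (hreg : IsRegular ξ (s.1 ⊔ t.1)) (x : TR ξ k) :
    InHull (adjacency ξ k).Adj s t x ↔ x.1 ≤ s.1 ⊔ t.1 := by
  have hY := finrank_sup_of_inf s.finrank_eq t.finrank_eq hd
  constructor
  · rintro ⟨z, hz, hz01, hz01'⟩
    have h0 := h.le_sup_of_adj hk hne hst hd hreg (hz 0).1 (hz 0).2.1
    have h1 := h.le_sup_of_adj hk hne hst hd hreg (hz 1).1 (hz 1).2.1
    obtain ⟨h2, h3⟩ := sup_eq_and_finrank_inf (z 0).finrank_eq (z 1).finrank_eq hY h0 h1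
      (fun e => hz01 (Subtype.ext e))
    rw [← h2]
    exact h.le_sup_of_adj hk hz01 hz01' h3 (h2 ▸ hreg) (hz 0).2.2 (hz 1).2.2
  · intro hx
    generalize hYdef : s.1 ⊔ t.1 = Y at *
    obtain ⟨s', hs', hs0, rfl⟩ := h.exists_eq_hyperplane hreg hY (U := s) (hYdef ▸ le_sup_left)
    obtain ⟨t', ht', ht0, rfl⟩ := h.exists_eq_hyperplane hreg hY (U := t) (hYdef ▸ le_sup_right)
    obtain ⟨x', hx', hx0, rfl⟩ := h.exists_eq_hyperplane hreg hY hx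
    rw [h.adj_hyperplane_iff hk, not_not] at hst
    have hind : t' ∉ K ∙ s' := fun hm => hne (Subtype.ext (perpIn_eq_of_mem_span ht0 hm))
    obtain ⟨d, hd', e, he', hde, hind', hsd, htd, hxd, hse, hte, hxe⟩ :=
      h.exists_perp_pair hreg (by omega) hs' ht' hx' hs0 hx0 hind hst
    have hd0 : d ≠ 0 := fun e => hsd (by simp [e])
    have he0 : e ≠ 0 := fun e => hse (by simp [e])
    have adj : ∀ {p q : V} (hp : p ∈ Y) (hp0 : p ≠ 0) (hq : q ∈ Y) (hq0 : q ≠ 0), ξ p q ≠ 0 →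
        (adjacency ξ k).Adj (hyperplane h.alt hreg hY p hp hp0)
          (hyperplane h.alt hreg hY q hq hq0) :=
      fun hp hp0 hq hq0 => (h.adj_hyperplane_iff hk hreg hY hp hp0 hq hq0).2
    refine ⟨![hyperplane h.alt hreg hY d hd' hd0, hyperplane h.alt hreg hY e he' he0],
      Fin.forall_fin_two.2 ⟨⟨(adj hs' hs0 hd' hd0 hsd).symm, (adj ht' ht0 hd' hd0 htd).symm,
        adj hx' hx0 hd' hd0 hxd⟩, ⟨(adj hs' hs0 he' he0 hse).symm,
        (adj ht' ht0 he' he0 hte).symm, adj hx' hx0 he' he0 hxe⟩⟩, ?_, ?_⟩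
    · exact fun e => hind' (hyperplane_eq_iff h.alt hreg hY hd' hd0 he' he0 e)
    · exact fun hadj => (h.adj_hyperplane_iff hk hreg hY hd' hd0 he' he0).1 hadj hde

theorem IsSymplectic.hasTriangular_inHull_iff (h : IsSymplectic ξ) (hk : ¬ Even k) (hk3 : 3 ≤ k)
    {s t : TR ξ k} (hne : s ≠ t) (hst : ¬ (adjacency ξ k).Adj s t)
    (hd : finrank K ↥(s.1 ⊓ t.1) + 1 = k) (hreg : IsRegular ξ (s.1 ⊔ t.1)) (r : ℕ) :
    HasTriangular (adjacency ξ k).Adj (InHull (adjacency ξ k).Adj s t) r ↔ r ≤ k + 1 := by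
  rw [← h.hasTriangular_iff hk hreg (finrank_sup_of_inf s.finrank_eq t.finrank_eq hd),
    show InHull (adjacency ξ k).Adj s t = fun U => U.1 ≤ s.1 ⊔ t.1 from
      funext fun x => propext (h.inHull_iff hk hk3 hne hst hd hreg x)]

theorem orthogonal_sup' (U W : Submodule K V) :
    ξ.orthogonal (U ⊔ W) = ξ.orthogonal U ⊓ ξ.orthogonal W := by
  refine le_antisymm (le_inf (LinearMap.BilinForm.orthogonal_le le_sup_left)
    (LinearMap.BilinForm.orthogonal_le le_sup_right)) fun x hx u hu => ?_
  obtain ⟨p, hp, q, hq, rfl⟩ := Submodule.mem_sup.1 hu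
  have h1 : ξ p x = 0 := hx.1 p hp
  have h2 : ξ q x = 0 := hx.2 q hq
  show ξ (p + q) x = 0
  simp [h1, h2]

theorem IsSymplectic.orthogonal_inf (h : IsSymplectic ξ) (U W : Submodule K V) :
    ξ.orthogonal (U ⊓ W) = ξ.orthogonal U ⊔ ξ.orthogonal W := by
  rw [← orthogonal_orthogonal h.alt h.nondeg (ξ.orthogonal U ⊔ ξ.orthogonal W), orthogonal_sup',
    orthogonal_orthogonal h.alt h.nondeg, orthogonal_orthogonal h.alt h.nondeg]

theorem isRegular_orthogonal_iff (h : IsSymplectic ξ) (U : Submodule K V) :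
    IsRegular ξ (ξ.orthogonal U) ↔ IsRegular ξ U := by
  rw [IsRegular, IsRegular, rad_orthogonal h.alt h.nondeg]

/-- Duality turns a regular meet into a regular join in dimension j = n - k, and the property, being
definable, is preserved. -/
theorem IsSymplectic.hasTriangular_inHull_iff' (h : IsSymplectic ξ) {j : ℕ}
    (hkj : k + j = finrank K V) (hk : ¬ Even k) (hj3 : 3 ≤ j)
    {s t : TR ξ k} (hne : s ≠ t) (hst : ¬ (adjacency ξ k).Adj s t)
    (hd : finrank K ↥(s.1 ⊓ t.1) + 1 = k) (hreg : IsRegular ξ (s.1 ⊓ t.1)) (r : ℕ) :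
    HasTriangular (adjacency ξ k).Adj (InHull (adjacency ξ k).Adj s t) r ↔ r ≤ j + 1 := by
  have hj : ¬ Even j := by
    have := h.even_finrank
    rw [← hkj, Nat.even_add] at this
    exact fun hj => hk (this.2 hj)
  have e := (uniformlyDefinable_hasTriangular_inHull (0 : Fin 2) 1 r).iff_of_equiv (h.dual hkj)
    (fun a b => h.adj_dual_iff hkj) ![s, t]
  refine Iff.trans e (h.hasTriangular_inHull_iff hj hj3 ((h.dual hkj).injective.ne hne) ?_ ?_ ?_ r)
  · rwa [← h.adj_dual_iff]
  · have h1 := finrank_add_finrank_orthogonal h.nondeg (s.1 ⊔ t.1)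
    rw [finrank_sup_of_inf s.finrank_eq t.finrank_eq hd, orthogonal_sup'] at h1
    change finrank K ↥(ξ.orthogonal s.1 ⊓ ξ.orthogonal t.1) + 1 = j
    omega
  · change IsRegular ξ (ξ.orthogonal s.1 ⊔ ξ.orthogonal t.1)
    rwa [← h.orthogonal_inf, isRegular_orthogonal_iff h]

theorem IsSymplectic.exists_isPure (h : IsSymplectic ξ) (hk : ¬ Even k) (hk3 : 3 ≤ k)
    (Y : TR ξ (k + 1)) : ∃ s t : TR ξ k, IsPure (adjacency ξ k).Adj s t ∧ s.1 ⊔ t.1 = Y.1 := by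
  have h2 := h.two_ne_zero
  have hY := h.isRegular (by rw [Nat.even_add_one]; exact hk) Y
  obtain ⟨s, hs, hs0⟩ := exists_ne_zero_of_finrank_pos (S := Y.1) (by rw [Y.finrank_eq]; omega)
  obtain ⟨t, ht, hts⟩ : ∃ t ∈ perpIn ξ Y.1 s, t ∉ K ∙ s := by
    by_contra! hle
    have h1 := Submodule.finrank_mono (show perpIn ξ Y.1 s ≤ K ∙ s from hle)
    have h3 := finrank_perpIn h.alt hY hs hs0
    rw [finrank_span_singleton hs0] at h1
    rw [Y.finrank_eq] at h3
    omega
  obtain ⟨ht, hst⟩ := ht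
  have hst : ξ s t = 0 := hst
  have ht0 : t ≠ 0 := fun e => hts (by rw [e]; exact zero_mem _)
  obtain ⟨f, hf, g, hg, hsf, htf, hsg, htg, hfg⟩ := hY.exists_frame h.alt hs ht hs0 hts hst
  have hgf : ξ g f = 0 := eq_zero_comm h.alt hfg
  have hff : ξ f f = 0 := h.alt f
  have hgg : ξ g g = 0 := h.alt g
  have hss : ξ s s = 0 := h.alt s
  have hts' : ξ t s = 0 := eq_zero_comm h.alt hst
  have hfs : ξ f s = -1 := by rw [← h.alt.neg_eq s f, hsf]
  have hgs : ξ g s = 0 := eq_zero_comm h.alt hsg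
  have hY' := Y.finrank_eq
  -- Poles of the diamond: all four are nonorthogonal to s and t, and among themselves only f + g
  -- and f - g are orthogonal. The product of the first two is 2.
  let w : Fin 4 → V := ![f + g + s, f + g - s, f + g, f - g]
  have hw : ∀ i, w i ∈ Y.1 := by
    have h1 := Y.1.add_mem hf hg
    simp only [Fin.forall_fin_succ, w]
    exact ⟨Y.1.add_mem h1 hs, Y.1.sub_mem h1 hs, h1, Y.1.sub_mem hf hg, fun i => i.elim0⟩
  have hsw : ∀ i, ξ s (w i) = 1 := by
    simp [Fin.forall_fin_succ, w, hsf, hsg, hss]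
  have htw : ∀ i, ξ t (w i) ≠ 0 := by
    simp [Fin.forall_fin_succ, w, htf, htg, hts']
  have hw0 : ∀ i, w i ≠ 0 := fun i e => by
    have := hsw i
    rw [e, map_zero] at this
    exact zero_ne_one this
  have hne : hyperplane h.alt hY hY' s hs hs0 ≠ hyperplane h.alt hY hY' t ht ht0 :=
    fun e => hts (hyperplane_eq_iff h.alt hY hY' hs hs0 ht ht0 e)
  have adj : ∀ {p q : V} (hp : p ∈ Y.1) (hp0 : p ≠ 0) (hq : q ∈ Y.1) (hq0 : q ≠ 0), ξ p q ≠ 0 →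
      (adjacency ξ k).Adj (hyperplane h.alt hY hY' p hp hp0) (hyperplane h.alt hY hY' q hq hq0) :=
    fun hp hp0 hq hq0 => (h.adj_hyperplane_iff hk hY hY' hp hp0 hq hq0).2
  refine ⟨hyperplane h.alt hY hY' s hs hs0, hyperplane h.alt hY hY' t ht ht0, ⟨hne, ?_,
    fun i => hyperplane h.alt hY hY' (w i) (hw i) (hw0 i), fun i => ⟨?_, ?_⟩, ?_, ?_, ?_, ?_, ?_,
    ?_, ?_⟩, ?_⟩
  · rw [h.adj_hyperplane_iff hk, not_not]; exact hst
  · refine (adj hs hs0 (hw i) (hw0 i) ?_).symm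
    rw [hsw]; exact one_ne_zero
  · exact (adj ht ht0 (hw i) (hw0 i) (htw i)).symm
  · refine adj (hw 0) (hw0 0) (hw 1) (hw0 1) ?_
    have : ξ (w 0) (w 1) = 2 := by
      simp [w, hsf, hsg, hss, hff, hgg, hfg, hgf, hfs, hgs]; norm_num
    rw [this]; exact h2
  · refine adj (hw 0) (hw0 0) (hw 2) (hw0 2) ?_
    simp [w, hsf, hsg, hff, hgg, hfg, hgf]
  · refine adj (hw 0) (hw0 0) (hw 3) (hw0 3) ?_
    simp [w, hsf, hsg, hff, hgg, hfg, hgf]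
  · refine adj (hw 1) (hw0 1) (hw 2) (hw0 2) ?_
    simp [w, hsf, hsg, hff, hgg, hfg, hgf]
  · refine adj (hw 1) (hw0 1) (hw 3) (hw0 3) ?_
    simp [w, hsf, hsg, hff, hgg, hfg, hgf]
  · intro e
    obtain ⟨c, hc⟩ := Submodule.mem_span_singleton.1
      (hyperplane_eq_iff h.alt hY hY' (hw 2) (hw0 2) (hw 3) (hw0 3) e)
    -- Pairing with s - t annihilates f + g but takes the value 2 on f - g.
    have e1 := congrArg (fun x => ξ (s - t) x) hc
    simp [w, hsf, hsg, htf, htg] at e1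
    exact h2 (by linear_combination -e1)
  · rw [h.adj_hyperplane_iff hk, not_not]
    simp [w, hff, hgg, hfg, hgf]
  · exact (sup_eq_and_finrank_inf (TR.finrank_eq _) (TR.finrank_eq _) hY' perpIn_le perpIn_le
      fun e => hne (Subtype.ext e)).1

end Odd

/-- If a definable family of properties `P r` amounts to `r ≤ p` for some tuples and to `r ≤ q` for
others, with `p ≠ q`, then the two kinds of tuples are told apart by a formula. -/
theorem exists_separating {m p q : ℕ} (hpq : p ≠ q)
    {P : ℕ → ∀ M : Type v, (M → M → Prop) → (Fin m → M) → Prop}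
    (hP : ∀ r {α : Type} (t : Fin m → α), UniformlyDefinable fun M A x => P r M A (x ∘ t)) :
    ∃ Ty : ∀ M : Type v, (M → M → Prop) → (Fin m → M) → Prop,
      (∀ {α : Type} (t : Fin m → α), UniformlyDefinable fun M A x => Ty M A (x ∘ t)) ∧
      ∀ (M : Type v) (A : M → M → Prop) (t : Fin m → M),
        ((∀ r, P r M A t ↔ r ≤ p) → Ty M A t) ∧ ((∀ r, P r M A t ↔ r ≤ q) → ¬ Ty M A t) := by
  rcases lt_or_gt_of_ne hpq with hlt | hlt
  · refine ⟨fun M A t => ¬ P q M A t, fun t => (hP q t).not, fun M A t =>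
      ⟨fun h => ?_, fun h => ?_⟩⟩
    · exact fun h' => absurd ((h q).1 h') (by omega)
    · exact not_not.2 ((h q).2 le_rfl)
  · refine ⟨fun M A t => P p M A t, fun t => hP p t, fun M A t => ⟨fun h => ?_, fun h => ?_⟩⟩
    · exact (h p).2 le_rfl
    · exact fun h' => absurd ((h p).1 h') (by omega)

/-- Elements of dimension k + 1 are coded by pure pairs with that join. The formula `Ty` discards
the pairs whose hull is a star, by comparing triangular lengths k + 1 and n - k + 1. -/
theorem definableFromAdjacency_odd {n k : ℕ} (hk : ¬ Even k) (hk3 : 3 ≤ k) (hkn : k + 3 ≤ n)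
    (hne : k ≠ n - k) : DefinableFromAdjacency.{u, v} n k (k + 1) := by
  obtain ⟨Ty, hTy, hTop⟩ := exists_separating (m := 2) (show k + 1 ≠ n - k + 1 by omega)
    (P := fun r M A t => HasTriangular A (InHull A (t 0) (t 1)) r)
    fun r _ t => uniformlyDefinable_hasTriangular_inHull.{v} (t 0) (t 1) r
  refine definableFromAdjacency_succ (m := 2) hk hkn
    (Dom := fun M A t => IsPure A (t 0) (t 1) ∧ Ty M A t)
    (Mem := fun M A t c => InHull A (t 0) (t 1) c)
    (fun t => (uniformlyDefinable_isPure (t 0) (t 1)).and (hTy t))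
    (fun t c => uniformlyDefinable_inHull (t 0) (t 1) c) ?_
  intro K V _ _ _ ξ hξ
  have := hξ.2.1
  have hs := hξ.isSymplectic
  have hn := hξ.2.2.1
  constructor
  · rintro t ⟨hp, hty⟩
    obtain ⟨hd, hreg | hreg⟩ := hs.regular_of_isPure hk hp
    · exact ⟨TR.of _ (finrank_sup_of_inf (t 0).finrank_eq (t 1).finrank_eq hd)
        (by rw [isRegular_iff_finrank.1 hreg]; exact zero_le_one),
        hs.inHull_iff hk hk3 hp.1 hp.2.1 hd hreg⟩
    · refine absurd hty ((hTop _ _ t).2 fun r => ?_)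
      exact hs.hasTriangular_inHull_iff' (by omega) hk (by omega) hp.1 hp.2.1 hd hreg r
  · intro Y
    obtain ⟨s, t, hp, hY⟩ := hs.exists_isPure hk hk3 Y
    have hreg : IsRegular ξ (s.1 ⊔ t.1) := by
      rw [hY]
      exact hs.isRegular (by rw [Nat.even_add_one]; exact hk) Y
    have hd := (hs.regular_of_isPure hk hp).1
    refine ⟨![s, t], ⟨hp, (hTop _ _ _).1 fun r => ?_⟩, fun U => ?_⟩
    · exact hs.hasTriangular_inHull_iff hk hk3 hp.1 hp.2.1 hd hreg r
    · rw [← hY]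
      exact hs.inHull_iff hk hk3 hp.1 hp.2.1 hd hreg U

/-! ### Maximal cliques given by triples -/

section Graph

variable {M : Type*} (A : M → M → Prop)

/-- `z` is equal or related to each entry of `t`. -/
def InClique (t : Fin 3 → M) (z : M) : Prop := ∀ i, A z (t i) ∨ z = t i

/-- The triple `t` is contained in exactly one maximal clique. -/
def IsClass (t : Fin 3 → M) : Prop :=
  A (t 0) (t 1) ∧ A (t 0) (t 2) ∧ A (t 1) (t 2) ∧
    ∀ z w, InClique A t z → InClique A t w → A z w ∨ z = w

/-- `s` and `t` determine the same clique. -/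
def SameClique (s t : Fin 3 → M) : Prop := ∀ z, InClique A s z ↔ InClique A t z

/-- The cliques of `t` and `t'` share exactly one element. -/
def MeetOnce (t t' : Fin 3 → M) : Prop :=
  ∃ z, (InClique A t z ∧ InClique A t' z) ∧ ∀ w, InClique A t w → InClique A t' w → w = z

/-- The relation between cliques that expresses the adjacency of the subspaces they stand for. -/
def CliqueAdj (t s : Fin 3 → M) : Prop :=
  MeetOnce A t s ∧ ∃ d e g : Fin 3 → M, (IsClass A d ∧ IsClass A e ∧ IsClass A g) ∧
    (∀ z, InClique A t z → InClique A s z → ¬ InClique A d z ∧ ¬ InClique A e z) ∧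
    (MeetOnce A d t ∧ MeetOnce A d s ∧ MeetOnce A e t ∧ MeetOnce A e s) ∧
    (¬ MeetOnce A d e ∧ ¬ SameClique A d e) ∧ (MeetOnce A g d ∧ MeetOnce A g e) ∧
    (¬ MeetOnce A g t ∧ ¬ MeetOnce A g s) ∧ ¬ SameClique A g t ∧ ¬ SameClique A g s

/-- Triangular systems of length `r` of cliques through an element of the clique of `t`. -/
def HasCliqueTriangular (t : Fin 3 → M) (r : ℕ) : Prop :=
  ∃ z, InClique A t z ∧ HasTriangular (CliqueAdj A)
    (fun c => IsClass A c ∧ InClique A c z ∧ (SameClique A c t ∨ MeetOnce A c t)) r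

end Graph

/-! ### Definability of the clique relations. -/

section Definability

variable {α : Type}

theorem UniformlyDefinable.exists_tuples {ι β : Type} [Finite ι] [Finite β]
    {Q : ∀ M : Type v, (M → M → Prop) → (α → M) → (ι → β → M) → Prop}
    (h : UniformlyDefinable fun M A (x : α ⊕ ι × β → M) =>
      Q M A (x ∘ Sum.inl) (fun i j => x (Sum.inr (i, j)))) :
    UniformlyDefinable fun M A x => ∃ z : ι → β → M, Q M A x z := by
  have := UniformlyDefinable.exists_tuple (β := ι × β)
    (Q := fun M A x z => Q M A x fun i j => z (i, j)) h
  convert this using 5 with M A x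
  exact ⟨fun ⟨z, hz⟩ => ⟨fun p => z p.1 p.2, hz⟩, fun ⟨z, hz⟩ => ⟨_, hz⟩⟩

theorem uniformlyDefinable_inClique (t : Fin 3 → α) (a : α) :
    UniformlyDefinable.{v} fun _ A x => InClique A (x ∘ t) (x a) :=
  .forall_index fun i => .or (.rel a (t i)) (.eq a (t i))

theorem uniformlyDefinable_isClass (t : Fin 3 → α) :
    UniformlyDefinable.{v} fun _ A x => IsClass A (x ∘ t) :=
  .and (.rel (t 0) (t 1)) (.and (.rel (t 0) (t 2)) (.and (.rel (t 1) (t 2))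
    (.forall_elem (.forall_elem (.imp
      (uniformlyDefinable_inClique (Sum.inl ∘ Sum.inl ∘ t) (.inl (.inr ())))
      (.imp (uniformlyDefinable_inClique (Sum.inl ∘ Sum.inl ∘ t) (.inr ()))
        (.or (.rel (Sum.inl (Sum.inr ())) (Sum.inr ()))
          (.eq (Sum.inl (Sum.inr ())) (Sum.inr ())))))))))

theorem uniformlyDefinable_sameClique (t t' : Fin 3 → α) :
    UniformlyDefinable.{v} fun _ A x => SameClique A (x ∘ t) (x ∘ t') :=
  .forall_elem (.iff (uniformlyDefinable_inClique (Sum.inl ∘ t) (.inr ()))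
    (uniformlyDefinable_inClique (Sum.inl ∘ t') (.inr ())))

theorem uniformlyDefinable_meetOnce (t t' : Fin 3 → α) :
    UniformlyDefinable.{v} fun _ A x => MeetOnce A (x ∘ t) (x ∘ t') :=
  .exists_elem (.and (.and (uniformlyDefinable_inClique (Sum.inl ∘ t) (.inr ()))
    (uniformlyDefinable_inClique (Sum.inl ∘ t') (.inr ())))
    (.forall_elem (.imp (uniformlyDefinable_inClique (Sum.inl ∘ Sum.inl ∘ t) (.inr ()))
      (.imp (uniformlyDefinable_inClique (Sum.inl ∘ Sum.inl ∘ t') (.inr ()))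
        (.eq (Sum.inr ()) (Sum.inl (Sum.inr ())))))))

theorem uniformlyDefinable_cliqueAdj (t t' : Fin 3 → α) :
    UniformlyDefinable.{v} fun _ A x => CliqueAdj A (x ∘ t) (x ∘ t') := by
  refine .and (uniformlyDefinable_meetOnce t t') (.exists_tuple (.exists_tuple (.exists_tuple ?_)))
  let s : Fin 3 → ((α ⊕ Fin 3) ⊕ Fin 3) ⊕ Fin 3 := Sum.inl ∘ Sum.inl ∘ Sum.inl ∘ t
  let s' : Fin 3 → ((α ⊕ Fin 3) ⊕ Fin 3) ⊕ Fin 3 := Sum.inl ∘ Sum.inl ∘ Sum.inl ∘ t'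
  let d : Fin 3 → ((α ⊕ Fin 3) ⊕ Fin 3) ⊕ Fin 3 := Sum.inl ∘ Sum.inl ∘ Sum.inr
  let e : Fin 3 → ((α ⊕ Fin 3) ⊕ Fin 3) ⊕ Fin 3 := Sum.inl ∘ Sum.inr
  let g : Fin 3 → ((α ⊕ Fin 3) ⊕ Fin 3) ⊕ Fin 3 := Sum.inr
  have hC := fun {β : Type} (c : Fin 3 → β) => uniformlyDefinable_isClass.{v} c
  have hM := fun {β : Type} (c c' : Fin 3 → β) => uniformlyDefinable_meetOnce.{v} c c'
  have hS := fun {β : Type} (c c' : Fin 3 → β) => uniformlyDefinable_sameClique.{v} c c'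
  have hI := fun {β : Type} (c : Fin 3 → β) => uniformlyDefinable_inClique.{v} (Sum.inl ∘ c)
    (Sum.inr ())
  exact .and (.and (hC d) (.and (hC e) (hC g))) (.and
    (.forall_elem (.imp (hI s) (.imp (hI s') (.and (.not (hI d)) (.not (hI e))))))
    (.and (.and (hM d s) (.and (hM d s') (.and (hM e s) (hM e s'))))
    (.and (.and (.not (hM d e)) (.not (hS d e))) (.and (.and (hM g d) (hM g e))
    (.and (.and (.not (hM g s)) (.not (hM g s'))) (.and (.not (hS g s)) (.not (hS g s'))))))))

theorem uniformlyDefinable_hasCliqueTriangular (t : Fin 3 → α) (r : ℕ) :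
    UniformlyDefinable.{v} fun _ A x => HasCliqueTriangular A (x ∘ t) r := by
  refine .exists_elem (.and (uniformlyDefinable_inClique (Sum.inl ∘ t) (.inr ()))
    (.exists_tuples (.exists_tuples ?_)))
  let β := ((α ⊕ Unit) ⊕ Fin r × Fin 3) ⊕ Fin r × Fin 3
  let s : Fin 3 → β := Sum.inl ∘ Sum.inl ∘ Sum.inl ∘ t
  let a : Fin r → Fin 3 → β := fun i j => Sum.inl (Sum.inr (i, j))
  let b : Fin r → Fin 3 → β := fun i j => Sum.inr (i, j)
  have hT : ∀ c : Fin 3 → β, UniformlyDefinable.{v} fun _ A x => IsClass A (x ∘ c) ∧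
      InClique A (x ∘ c) (x (Sum.inl (Sum.inl (Sum.inr ())))) ∧
        (SameClique A (x ∘ c) (x ∘ s) ∨ MeetOnce A (x ∘ c) (x ∘ s)) := fun c =>
    .and (uniformlyDefinable_isClass c) (.and (uniformlyDefinable_inClique c _)
      (.or (uniformlyDefinable_sameClique c s) (uniformlyDefinable_meetOnce c s)))
  exact .and (.forall_index fun i => .and (hT (a i)) (.and (hT (b i))
    (uniformlyDefinable_cliqueAdj (a i) (b i)))) (.forall_index fun i => .forall_index fun j =>
      .imp_of_const (.not (uniformlyDefinable_cliqueAdj (a j) (b i))))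

end Definability

/-! ### Even dimension: stars, tops and their intersections. -/

section Even

variable {K V : Type*} [Field K] [AddCommGroup V] [Module K V] {ξ : LinearMap.BilinForm K V}
  {k j : ℕ} [FiniteDimensional K V]

/-- The clique of `t` consists of the elements above `X`. -/
def StarAt (t : Fin 3 → TR ξ k) (X : TR ξ j) : Prop :=
  ∀ z, InClique (adjacency ξ k).Adj t z ↔ X.1 ≤ z.1

/-- The clique of `t` consists of the elements below `Y`. -/
def TopAt (t : Fin 3 → TR ξ k) (Y : TR ξ j) : Prop :=
  ∀ z, InClique (adjacency ξ k).Adj t z ↔ z.1 ≤ Y.1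

/-- An element near all three that is not in the star lies in both t 0 ⊔ t 1 and t 0 ⊔ t 2; these
intersect in t 0, so it is t 0, which is in the star after all. -/
theorem IsSymplectic.inClique_iff_ge (h : IsSymplectic ξ) (hk : Even k) {t : Fin 3 → TR ξ k}
    (h01 : (adjacency ξ k).Adj (t 0) (t 1)) (h02 : (adjacency ξ k).Adj (t 0) (t 2))
    (hle : (t 0).1 ⊓ (t 1).1 ≤ (t 2).1) (hnle : ¬ (t 2).1 ≤ (t 0).1 ⊔ (t 1).1) (z : TR ξ k) :
    InClique (adjacency ξ k).Adj t z ↔ (t 0).1 ⊓ (t 1).1 ≤ z.1 := by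
  have a01 := adj_iff.1 h01
  have a02 := adj_iff.1 h02
  constructor
  · intro hz
    rcases h.inf_le_or_le_sup hk h01 (hz 0) (hz 1) with h1 | h1
    · exact h1
    have e : (t 0).1 ⊓ (t 2).1 = (t 0).1 ⊓ (t 1).1 :=
      (inf_eq_and_finrank_sup (t 0).finrank_eq (t 2).finrank_eq a01.2.1 inf_le_left hle
        fun e => a02.1 (Subtype.ext e)).1
    rcases h.inf_le_or_le_sup hk h02 (hz 0) (hz 2) with h2 | h2
    · exact e ▸ h2
    have h3 : ((t 0).1 ⊔ (t 1).1) ⊓ ((t 0).1 ⊔ (t 2).1) = (t 0).1 :=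
      (inf_eq_and_finrank_sup
        (finrank_sup_of_inf (t 0).finrank_eq (t 1).finrank_eq a01.2.1)
        (finrank_sup_of_inf (t 0).finrank_eq (t 2).finrank_eq a02.2.1)
        (by rw [(t 0).finrank_eq]) le_sup_left le_sup_left
        fun e => hnle (e ▸ le_sup_right)).1
    have h4 : z.1 = (t 0).1 := eq_of_le_of_finrank_eq' (h3 ▸ le_inf h1 h2)
      (by rw [z.finrank_eq, (t 0).finrank_eq])
    rw [h4]
    exact inf_le_left
  · intro hz
    simp only [InClique, Fin.forall_fin_succ, Fin.succ_zero_eq_one]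
    exact ⟨h.adj_or_eq_of_ge hk a01.2.1 hz inf_le_left,
      h.adj_or_eq_of_ge hk a01.2.1 hz inf_le_right, h.adj_or_eq_of_ge hk a01.2.1 hz hle,
      fun i => i.elim0⟩

theorem IsSymplectic.inClique_iff_le (h : IsSymplectic ξ) (hk : Even k) {t : Fin 3 → TR ξ k}
    (h01 : (adjacency ξ k).Adj (t 0) (t 1)) (h02 : (adjacency ξ k).Adj (t 0) (t 2))
    (hle : (t 2).1 ≤ (t 0).1 ⊔ (t 1).1) (hnle : ¬ (t 0).1 ⊓ (t 1).1 ≤ (t 2).1) (z : TR ξ k) :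
    InClique (adjacency ξ k).Adj t z ↔ z.1 ≤ (t 0).1 ⊔ (t 1).1 := by
  have a01 := adj_iff.1 h01
  have a02 := adj_iff.1 h02
  have hY := finrank_sup_of_inf (t 0).finrank_eq (t 1).finrank_eq a01.2.1
  constructor
  · intro hz
    rcases h.inf_le_or_le_sup hk h01 (hz 0) (hz 1) with h1 | h1
    swap
    · exact h1
    have e : (t 0).1 ⊔ (t 2).1 = (t 0).1 ⊔ (t 1).1 :=
      (sup_eq_and_finrank_inf (t 0).finrank_eq (t 2).finrank_eq hY le_sup_left hle
        fun e => a02.1 (Subtype.ext e)).1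
    rcases h.inf_le_or_le_sup hk h02 (hz 0) (hz 2) with h2 | h2
    swap
    · exact e ▸ h2
    have h3 : ((t 0).1 ⊓ (t 1).1) ⊔ ((t 0).1 ⊓ (t 2).1) = (t 0).1 :=
      (sup_eq_and_finrank_inf (k := k - 1) (by have := a01.2.1; omega) (by have := a02.2.1; omega)
        (by rw [(t 0).finrank_eq]; have := a01.2.1; omega) inf_le_left inf_le_left
        fun e => hnle (e.le.trans inf_le_right)).1
    have h4 : (t 0).1 = z.1 := eq_of_le_of_finrank_eq' (h3 ▸ sup_le h1 h2)
      (by rw [z.finrank_eq, (t 0).finrank_eq])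
    rw [← h4]
    exact le_sup_left
  · intro hz
    simp only [InClique, Fin.forall_fin_succ, Fin.succ_zero_eq_one]
    exact ⟨h.adj_or_eq_of_le hk hY hz le_sup_left,
      h.adj_or_eq_of_le hk hY hz le_sup_right, h.adj_or_eq_of_le hk hY hz hle,
      fun i => i.elim0⟩

theorem IsSymplectic.starAt_or_topAt (h : IsSymplectic ξ) (hjk : j + 1 = k) (hk : Even k)
    (hk2 : 2 ≤ k) (hkn : k + 2 ≤ finrank K V) {t : Fin 3 → TR ξ k}
    (ht : IsClass (adjacency ξ k).Adj t) :
    (∃ X : TR ξ j, StarAt t X) ∨ ∃ Y : TR ξ (k + 1), TopAt t Y := by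
  obtain ⟨h01, h02, h12, hcl⟩ := ht
  have a01 := adj_iff.1 h01
  have hY := finrank_sup_of_inf (t 0).finrank_eq (t 1).finrank_eq a01.2.1
  by_cases h1 : (t 0).1 ⊓ (t 1).1 ≤ (t 2).1
  · by_cases h2 : (t 2).1 ≤ (t 0).1 ⊔ (t 1).1
    · exfalso
      -- A collinear triple is near the whole star and the whole top of its line. By the clique
      -- condition an element z of the star outside the join would be near all of these, hence on
      -- the line, which is absurd.
      have hline := (h.mem_line_iff hk hk2 hkn h01).1 ⟨h1, h2⟩
      have hin : ∀ z, ((adjacency ξ k).Adj z (t 0) ∨ z = t 0) →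
          ((adjacency ξ k).Adj z (t 1) ∨ z = t 1) → InClique (adjacency ξ k).Adj t z := by
        intro z hz0 hz1
        simp only [InClique, Fin.forall_fin_succ, Fin.succ_zero_eq_one]
        exact ⟨hz0, hz1, hline z hz0 hz1, fun i => i.elim0⟩
      obtain ⟨z, hz1, hz2⟩ := h.exists_ge_not_le a01.2.1 hk
        (TR.of ((t 0).1 ⊓ (t 1).1) rfl a01.2.2.1) (B := (t 0).1 ⊔ (t 1).1)
        (fun e => by rw [e, finrank_top] at hY; omega)
      have hz := hin z (h.adj_or_eq_of_ge hk a01.2.1 hz1 inf_le_left)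
        (h.adj_or_eq_of_ge hk a01.2.1 hz1 inf_le_right)
      exact hz2 ((h.mem_line_iff hk hk2 hkn h01).2
        fun T hT0 hT1 => hcl T z (hin T hT0 hT1) hz).2
    · exact .inl ⟨TR.of _ (by have := a01.2.1; omega) a01.2.2.1,
        h.inClique_iff_ge hk h01 h02 h1 h2⟩
  · have h2 := (h.inf_le_or_le_sup hk h01 (.inl h02.symm) (.inl h12.symm)).resolve_left h1
    exact .inr ⟨TR.of _ hY a01.2.2.2, h.inClique_iff_le hk h01 h02 h2 h1⟩

theorem IsSymplectic.exists_starAt (h : IsSymplectic ξ) (hjk : j + 1 = k) (hk : Even k)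
    (hkn : k + 2 ≤ finrank K V) (X : TR ξ j) :
    ∃ t : Fin 3 → TR ξ k, IsClass (adjacency ξ k).Adj t ∧ StarAt t X := by
  have hX : finrank K X.1 + 1 = k := by rw [X.finrank_eq, hjk]
  have hntop : ∀ {S : Submodule K V}, finrank K S ≤ k + 1 → S ≠ ⊤ := by
    rintro S hS rfl
    rw [finrank_top] at hS
    omega
  obtain ⟨t0, h0, -⟩ := h.exists_ge_not_le hjk hk X (hntop (S := ⊥) (by simp))
  obtain ⟨t1, h1, h01⟩ := h.exists_ge_not_le hjk hk X
    (hntop (S := t0.1) (by rw [t0.finrank_eq]; omega))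
  have ne01 : t0 ≠ t1 := fun e => h01 (e ▸ le_rfl)
  obtain ⟨e01, d01⟩ := inf_eq_and_finrank_sup t0.finrank_eq t1.finrank_eq hX h0 h1
    fun e => ne01 (Subtype.ext e)
  obtain ⟨t2, h2, h012⟩ := h.exists_ge_not_le hjk hk X (hntop d01.le)
  have a01 := (h.adj_or_eq_of_ge hk hX h0 h1).resolve_right ne01
  have a02 := (h.adj_or_eq_of_ge hk hX h0 h2).resolve_right fun e => h012 (e ▸ le_sup_left)
  have a12 := (h.adj_or_eq_of_ge hk hX h1 h2).resolve_right fun e => h012 (e ▸ le_sup_right)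
  have hstar : StarAt ![t0, t1, t2] X := fun z => by
    rw [← e01]
    exact h.inClique_iff_ge (t := ![t0, t1, t2]) hk a01 a02 (e01.le.trans h2) h012 z
  exact ⟨![t0, t1, t2], ⟨a01, a02, a12, fun z z' hz hz' =>
    h.adj_or_eq_of_ge hk hX ((hstar z).1 hz) ((hstar z').1 hz')⟩, hstar⟩

theorem IsSymplectic.exists_inf_eq (h : IsSymplectic ξ) (hjk : j + 1 = k) (hk : Even k)
    (hkn : k + 2 ≤ finrank K V) (X : TR ξ j) :
    ∃ z w : TR ξ k, z ≠ w ∧ z.1 ⊓ w.1 = X.1 := by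
  have hX : finrank K X.1 + 1 = k := by rw [X.finrank_eq, hjk]
  obtain ⟨t, ht, hs⟩ := h.exists_starAt hjk hk hkn X
  have hin : ∀ i, InClique (adjacency ξ k).Adj t (t i) := by
    obtain ⟨h01, h02, h12, -⟩ := ht
    simp only [InClique, Fin.forall_fin_succ, Fin.succ_zero_eq_one]
    exact ⟨⟨.inr trivial, .inl h01, .inl h02, fun i => i.elim0⟩,
      ⟨.inl h01.symm, .inr trivial, .inl h12, fun i => i.elim0⟩,
      ⟨.inl h02.symm, .inl h12.symm, .inr trivial, fun i => i.elim0⟩, fun i => i.elim0⟩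
  exact ⟨t 0, t 1, ht.1.1, (inf_eq_and_finrank_sup (t 0).finrank_eq (t 1).finrank_eq hX
    ((hs _).1 (hin 0)) ((hs _).1 (hin 1)) fun e => ht.1.1 (Subtype.ext e)).1⟩

/-- X is recovered from its star as the meet of two of its members. -/
theorem IsSymplectic.sameClique_iff (h : IsSymplectic ξ) (hjk : j + 1 = k) (hk : Even k)
    (hkn : k + 2 ≤ finrank K V) {t t' : Fin 3 → TR ξ k} {X X' : TR ξ j} (ht : StarAt t X)
    (ht' : StarAt t' X') : SameClique (adjacency ξ k).Adj t t' ↔ X = X' := by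
  constructor
  · intro hs
    have key : ∀ {t t' : Fin 3 → TR ξ k} {X X' : TR ξ j}, StarAt t X → StarAt t' X' →
        SameClique (adjacency ξ k).Adj t t' → X.1 ≤ X'.1 := by
      intro t t' X X' ht ht' hs
      obtain ⟨z, w, -, e⟩ := h.exists_inf_eq hjk hk hkn X'
      rw [← e]
      refine le_inf ?_ ?_
      · rw [← ht, hs, ht', ← e]; exact inf_le_left
      · rw [← ht, hs, ht', ← e]; exact inf_le_right
    exact Subtype.ext (le_antisymm (key ht ht' hs) (key ht' ht fun z => (hs z).symm))
  · rintro rfl z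
    exact (ht z).trans (ht' z).symm

/-- Distinct elements lying in a common element of the next dimension. -/
def Joinable (k : ℕ) (X X' : TR ξ j) : Prop := X ≠ X' ∧ ∃ U : TR ξ k, X.1 ≤ U.1 ∧ X'.1 ≤ U.1

theorem IsSymplectic.meetOnce_iff (h : IsSymplectic ξ) (hjk : j + 1 = k) (hk : Even k)
    (hkn : k + 2 ≤ finrank K V) {t t' : Fin 3 → TR ξ k} {X X' : TR ξ j} (ht : StarAt t X)
    (ht' : StarAt t' X') : MeetOnce (adjacency ξ k).Adj t t' ↔ Joinable k X X' := by
  constructor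
  · rintro ⟨U, ⟨hU, hU'⟩, huniq⟩
    refine ⟨?_, U, (ht U).1 hU, (ht' U).1 hU'⟩
    rintro rfl
    obtain ⟨z, w, hne, e⟩ := h.exists_inf_eq hjk hk hkn X
    have hz : X.1 ≤ z.1 := e ▸ inf_le_left
    have hw : X.1 ≤ w.1 := e ▸ inf_le_right
    exact hne ((huniq z ((ht z).2 hz) ((ht' z).2 hz)).trans
      (huniq w ((ht w).2 hw) ((ht' w).2 hw)).symm)
  · rintro ⟨hne, U, hU, hU'⟩
    refine ⟨U, ⟨(ht U).2 hU, (ht' U).2 hU'⟩, fun W hW hW' => Subtype.ext ?_⟩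
    obtain ⟨e, -⟩ := sup_eq_and_finrank_inf X.finrank_eq X'.finrank_eq
      (by rw [U.finrank_eq, hjk]) hU hU' fun e => hne (Subtype.ext e)
    refine (eq_of_le_of_finrank_eq' ?_ (by rw [U.finrank_eq, W.finrank_eq])).symm
    rw [← e]
    exact sup_le ((ht W).1 hW) ((ht' W).1 hW')

/-- A star and a top with a common element share a whole line. Therefore any clique of a class
triple that meets a star exactly once is itself a star. -/
theorem IsSymplectic.not_meetOnce (h : IsSymplectic ξ) (hjk : j + 1 = k)
    {t t' : Fin 3 → TR ξ k} {X : TR ξ j} {Y : TR ξ (k + 1)} (ht : StarAt t X)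
    (ht' : TopAt t' Y) : ¬ MeetOnce (adjacency ξ k).Adj t t' ∧
      ¬ MeetOnce (adjacency ξ k).Adj t' t := by
  have key : ∀ U : TR ξ k, X.1 ≤ U.1 → U.1 ≤ Y.1 →
      ∃ W : TR ξ k, W ≠ U ∧ X.1 ≤ W.1 ∧ W.1 ≤ Y.1 := by
    intro U hU hU'
    obtain ⟨W, hW, hne⟩ := h.exists_ne_mem_pencil (l := {U : TR ξ k | X.1 ≤ U.1 ∧ U.1 ≤ Y.1})
      ⟨⟨U, hU, hU'⟩, j, X, Y, hjk, hU.trans hU', rfl⟩ (U := U) ⟨hU, hU'⟩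
    exact ⟨W, hne, hW⟩
  constructor
  · rintro ⟨U, ⟨hU, hU'⟩, huniq⟩
    obtain ⟨W, hne, hW, hW'⟩ := key U ((ht U).1 hU) ((ht' U).1 hU')
    exact hne (huniq W ((ht W).2 hW) ((ht' W).2 hW'))
  · rintro ⟨U, ⟨hU', hU⟩, huniq⟩
    obtain ⟨W, hne, hW, hW'⟩ := key U ((ht U).1 hU) ((ht' U).1 hU')
    exact hne (huniq W ((ht' W).2 hW') ((ht W).2 hW))

end Even

/-! ### Recognising adjacency in odd dimension j from joinability. -/

section Even

variable {K V : Type*} [Field K] [AddCommGroup V] [Module K V] {ξ : LinearMap.BilinForm K V}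
  {k j : ℕ} [FiniteDimensional K V]

theorem IsSymplectic.joinable_iff (h : IsSymplectic ξ) (hjk : j + 1 = k) (hk : Even k)
    {A B : TR ξ j} : Joinable k A B ↔
      A ≠ B ∧ finrank K ↥(A.1 ⊓ B.1) + 1 = j ∧ IsRegular ξ (A.1 ⊔ B.1) := by
  constructor
  · rintro ⟨hne, U, hA, hB⟩
    obtain ⟨e, hd⟩ := sup_eq_and_finrank_inf A.finrank_eq B.finrank_eq
      (by rw [U.finrank_eq, hjk]) hA hB fun e => hne (Subtype.ext e)
    exact ⟨hne, hd, e ▸ h.isRegular hk U⟩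
  · rintro ⟨hne, hd, hreg⟩
    refine ⟨hne, TR.of (A.1 ⊔ B.1) ?_ ?_, le_sup_left, le_sup_right⟩
    · rw [finrank_sup_of_inf A.finrank_eq B.finrank_eq hd, hjk]
    · rw [isRegular_iff_finrank.1 hreg]; exact zero_le_one

theorem IsSymplectic.two_le_finrank_rad (h : IsSymplectic ξ) {H : Submodule K V}
    (hH : Even (finrank K H)) (hreg : ¬ IsRegular ξ H) : 2 ≤ finrank K (rad ξ H) := by
  by_contra hlt
  exact hreg (isRegular_of_even h.alt h.two_ne_zero hH (by omega))

/-- By parity the radical of H has dimension at least two, so it meets A^⊥, a hyperplane of H^⊥. A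
nonzero common vector spans the radical of A. -/
theorem IsSymplectic.rad_le_of_not_isRegular (h : IsSymplectic ξ) (hj : ¬ Even j)
    {H : Submodule K V} (hH : finrank K H + 1 = j) (hreg : ¬ IsRegular ξ H) {A : TR ξ j}
    (hA : H ≤ A.1) : rad ξ A.1 ≤ H := by
  have hr := h.two_le_finrank_rad (H := H) (by rwa [← hH, Nat.even_add_one, not_not] at hj) hreg
  have h1 := finrank_add_finrank_orthogonal h.nondeg H
  have h2 := finrank_add_finrank_orthogonal h.nondeg A.1
  rw [A.finrank_eq] at h2
  have h3 := Submodule.finrank_sup_add_finrank_inf_eq (rad ξ H) (ξ.orthogonal A.1)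
  have h4 := Submodule.finrank_mono (show rad ξ H ⊔ ξ.orthogonal A.1 ≤ ξ.orthogonal H from
    sup_le inf_le_right (LinearMap.BilinForm.orthogonal_le hA))
  obtain ⟨r, hr, hr0⟩ := exists_ne_zero_of_finrank_pos
    (S := rad ξ H ⊓ ξ.orthogonal A.1) (by omega)
  have hrH := rad_le H hr.1
  intro y hy
  have := mem_span_singleton_of_finrank_le_one A.finrank_rad_le
    (show r ∈ rad ξ A.1 from ⟨hA hrH, hr.2⟩) hy hr0
  exact (Submodule.span_singleton_le_iff_mem r H).2 hrH this

/-- Over a nonregular hyperplane, regularity of the join is inequality of the radicals. -/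
theorem IsSymplectic.isRegular_sup_iff_rad_ne (h : IsSymplectic ξ) (hj : ¬ Even j)
    {H : Submodule K V} (hH : finrank K H + 1 = j) (hreg : ¬ IsRegular ξ H) {A B : TR ξ j}
    (hA : H ≤ A.1) (hB : H ≤ B.1) (hne : A ≠ B) :
    IsRegular ξ (A.1 ⊔ B.1) ↔ rad ξ A.1 ≠ rad ξ B.1 := by
  have hd := (inf_eq_and_finrank_sup A.finrank_eq B.finrank_eq hH hA hB
    fun e => hne (Subtype.ext e)).2
  constructor
  · intro hr e
    obtain ⟨r, hr1, hr0⟩ := exists_ne_zero_of_finrank_pos (S := rad ξ A.1)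
      (by rw [h.finrank_rad hj]; exact zero_lt_one)
    refine hr0 ((Submodule.mem_bot K).1 (hr.le ⟨le_sup_left (a := A.1) hr1.1, ?_⟩))
    rw [orthogonal_sup']
    exact ⟨hr1.2, (e ▸ hr1).2⟩
  · intro hrad
    by_contra hr
    have h1 := h.two_le_finrank_rad (by rwa [hd, Nat.even_add_one]) hr
    have h2 := Submodule.finrank_sup_add_finrank_inf_eq (rad ξ (A.1 ⊔ B.1)) A.1
    have h3 := Submodule.finrank_mono (sup_le (rad_le _) le_sup_left :
      rad ξ (A.1 ⊔ B.1) ⊔ A.1 ≤ A.1 ⊔ B.1)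
    rw [hd] at h3
    rw [A.finrank_eq] at h2
    -- A nonregular join has a radical of dimension at least two, which meets its hyperplane A. The
    -- vector found lies in the radical of A, hence in H and in B, hence in the radical of B.
    obtain ⟨r, hr1, hr0⟩ := exists_ne_zero_of_finrank_pos
      (S := rad ξ (A.1 ⊔ B.1) ⊓ A.1) (by omega)
    have hrA : r ∈ rad ξ A.1 :=
      ⟨hr1.2, LinearMap.BilinForm.orthogonal_le le_sup_left hr1.1.2⟩
    have hrB : r ∈ rad ξ B.1 := ⟨hB (h.rad_le_of_not_isRegular hj hH hreg hA hrA),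
      LinearMap.BilinForm.orthogonal_le le_sup_right hr1.1.2⟩
    have key : ∀ C : TR ξ j, r ∈ rad ξ C.1 → rad ξ C.1 = K ∙ r := fun C hC =>
      le_antisymm (fun y hy => mem_span_singleton_of_finrank_le_one C.finrank_rad_le hC hy hr0)
        ((Submodule.span_singleton_le_iff_mem _ _).2 hC)
    exact hrad ((key A hrA).trans (key B hrB).symm)

/-- The adjacency of `X` and `X'`, expressed by joinability. -/
def AdjByJoin (k : ℕ) (X X' : TR ξ j) : Prop :=
  Joinable k X X' ∧ ∃ D E G : TR ξ j,
    (∀ U : TR ξ k, X.1 ≤ U.1 → X'.1 ≤ U.1 → ¬ D.1 ≤ U.1 ∧ ¬ E.1 ≤ U.1) ∧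
    (Joinable k D X ∧ Joinable k D X' ∧ Joinable k E X ∧ Joinable k E X') ∧
    (¬ Joinable k D E ∧ D ≠ E) ∧ (Joinable k G D ∧ Joinable k G E) ∧
    (¬ Joinable k G X ∧ ¬ Joinable k G X') ∧ G ≠ X ∧ G ≠ X'

/-- Over a nonregular H = X ⊓ X', being unjoinable or equal means having the same radical, which is
transitive. But G would be unjoinable to both X and X', while these are joinable. The elements D and
E serve to force G above H. -/
theorem IsSymplectic.adj_of_adjByJoin (h : IsSymplectic ξ) (hjk : j + 1 = k) (hk : Even k)
    {X X' : TR ξ j} (hX : AdjByJoin k X X') : (adjacency ξ j).Adj X X' := by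
  obtain ⟨hXX, D, E, G, hU, ⟨hDX, hDX', hEX, hEX'⟩, ⟨hDE, hneDE⟩, ⟨hGD, hGE⟩, ⟨hGX, hGX'⟩,
    hneX, hneX'⟩ := hX
  have hj : ¬ Even j := by rwa [← hjk, Nat.even_add_one] at hk
  rw [h.joinable_iff hjk hk] at *
  obtain ⟨hne, hd, hreg⟩ := hXX
  refine (h.adj_iff_of_odd hj).2 ⟨hne, hd, ?_, hreg⟩
  by_contra hH
  have hU' := hU (TR.of (X.1 ⊔ X'.1) (by rw [finrank_sup_of_inf X.finrank_eq X'.finrank_eq hd, hjk])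
    (by rw [isRegular_iff_finrank.1 hreg]; exact zero_le_one)) le_sup_left le_sup_right
  have hD := (SympGrassmann.inf_le_or_le_sup D.finrank_eq hd hDX.2.1 hDX'.2.1).resolve_right hU'.1
  have hE := (SympGrassmann.inf_le_or_le_sup E.finrank_eq hd hEX.2.1 hEX'.2.1).resolve_right hU'.2
  obtain ⟨eDE, dDE⟩ := inf_eq_and_finrank_sup D.finrank_eq E.finrank_eq hd hD hE
    fun e => hneDE (Subtype.ext e)
  -- Otherwise G lies in D ⊔ E, so D ⊔ E = G ⊔ D is regular and D, E would be joinable.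
  have hG : X.1 ⊓ X'.1 ≤ G.1 := by
    rcases SympGrassmann.inf_le_or_le_sup G.finrank_eq (by rw [eDE, hd]) hGD.2.1 hGE.2.1 with h1 | h1
    · exact eDE ▸ h1
    · have := (sup_eq_and_finrank_inf G.finrank_eq D.finrank_eq dDE h1 le_sup_left
        fun e => hGD.1 (Subtype.ext e)).1
      exact absurd ⟨hneDE, by rw [eDE, hd], this ▸ hGD.2.2⟩ hDE
  have key : ∀ Z : TR ξ j, X.1 ⊓ X'.1 ≤ Z.1 → G ≠ Z →
      ¬ (G ≠ Z ∧ finrank K ↥(G.1 ⊓ Z.1) + 1 = j ∧ IsRegular ξ (G.1 ⊔ Z.1)) →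
      rad ξ G.1 = rad ξ Z.1 := by
    intro Z hZ hn hJ
    by_contra hr
    exact hJ ⟨hn, by rw [(inf_eq_and_finrank_sup G.finrank_eq Z.finrank_eq hd hG hZ
      fun e => hn (Subtype.ext e)).1, hd],
      (h.isRegular_sup_iff_rad_ne hj hd hH hG hZ hn).2 hr⟩
  exact (h.isRegular_sup_iff_rad_ne hj hd hH inf_le_left inf_le_right hne).1 hreg
    ((key X inf_le_left hneX hGX).symm.trans (key X' inf_le_right hneX' hGX'))

theorem eq_zero_of_mem_sup_span {H : Submodule K V} {p v w : V} (hp : p ∈ ξ.orthogonal H)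
    (hA : ξ.IsAlt) (hw : w ∈ H ⊔ K ∙ v) (hv : ξ p v = 0) : ξ p w = 0 := by
  obtain ⟨y, hy, z, hz, rfl⟩ := Submodule.mem_sup.1 hw
  obtain ⟨c, rfl⟩ := Submodule.mem_span_singleton.1 hz
  have : ξ p y = 0 := eq_zero_comm hA (hp y hy)
  simp [this, hv]

theorem not_mem_of_mem_orthogonal {H : Submodule K V} (hH : IsRegular ξ H) {v : V}
    (hv : v ∈ ξ.orthogonal H) (hv0 : v ≠ 0) : v ∉ H :=
  fun hvH => hv0 ((Submodule.mem_bot K).1 (hH.le ⟨hvH, hv⟩))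

/-- The extension of a regular subspace by a vector orthogonal to it. -/
def IsRegular.extend {H : Submodule K V} (hH : IsRegular ξ H) (hd : finrank K H + 1 = j) (v : V)
    (hv : v ∈ ξ.orthogonal H) (hv0 : v ≠ 0) : TR ξ j :=
  TR.of (H ⊔ K ∙ v)
    (by rw [finrank_sup_span_singleton' (not_mem_of_mem_orthogonal hH hv hv0), hd])
    (finrank_rad_le_one_of_ge
      (finrank_sup_span_singleton' (not_mem_of_mem_orthogonal hH hv hv0)) le_sup_left hH)

theorem IsRegular.extend_ne {H : Submodule K V} (hH : IsRegular ξ H) (hd : finrank K H + 1 = j)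
    (hA : ξ.IsAlt) {p v w : V} (hv : v ∈ ξ.orthogonal H) (hv0 : v ≠ 0) (hw : w ∈ ξ.orthogonal H)
    (hw0 : w ≠ 0) (hp : p ∈ ξ.orthogonal H) (hpv : ξ p v = 0) (hpw : ξ p w ≠ 0) :
    hH.extend hd v hv hv0 ≠ hH.extend hd w hw hw0 := by
  intro e
  refine hpw (eq_zero_of_mem_sup_span hp hA ?_ hpv)
  rw [show H ⊔ K ∙ v = H ⊔ K ∙ w from congrArg Subtype.val e]
  exact le_sup_right (a := H) (Submodule.mem_span_singleton_self w)

theorem IsSymplectic.joinable_extend_iff (h : IsSymplectic ξ) (hjk : j + 1 = k) (hk : Even k)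
    {H : Submodule K V} (hH : IsRegular ξ H) (hd : finrank K H + 1 = j) {v w : V}
    (hv : v ∈ ξ.orthogonal H) (hv0 : v ≠ 0) (hw : w ∈ ξ.orthogonal H) (hw0 : w ≠ 0) :
    Joinable k (hH.extend hd v hv hv0) (hH.extend hd w hw hw0) ↔ ξ v w ≠ 0 := by
  rw [h.joinable_iff hjk hk, ← isRegular_sup_iff h.alt hH hv hw hv0]
  refine ⟨fun h1 => h1.2.2, fun h1 => ?_⟩
  have hne : hH.extend hd v hv hv0 ≠ hH.extend hd w hw hw0 :=
    hH.extend_ne hd h.alt hv hv0 hw hw0 hv (h.alt v)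
      ((isRegular_sup_iff h.alt hH hv hw hv0).1 h1)
  refine ⟨hne, ?_, h1⟩
  rw [(inf_eq_and_finrank_sup (TR.finrank_eq _) (TR.finrank_eq _) hd
    (le_sup_left : H ≤ (hH.extend hd v hv hv0).1) (le_sup_left : H ≤ (hH.extend hd w hw hw0).1)
    fun e => hne (Subtype.ext e)).1, hd]

/-- A radical vector of X is orthogonal to H, and not in H since H is regular. So the elements above
H correspond to points of H^⊥, with joinability as nonorthogonality. -/
theorem IsSymplectic.exists_eq_extend (h : IsSymplectic ξ) (hj : ¬ Even j)
    {H : Submodule K V} (hH : IsRegular ξ H) (hd : finrank K H + 1 = j) {X : TR ξ j}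
    (hX : H ≤ X.1) : ∃ x hx hx0, X = hH.extend hd x hx hx0 := by
  obtain ⟨x, hx, hx0⟩ := exists_ne_zero_of_finrank_pos (S := rad ξ X.1)
    (by rw [h.finrank_rad hj]; exact zero_lt_one)
  have hxo : x ∈ ξ.orthogonal H := LinearMap.BilinForm.orthogonal_le hX hx.2
  refine ⟨x, hxo, hx0, Subtype.ext (eq_of_le_of_finrank_eq' ?_ ?_).symm⟩
  · exact sup_le hX ((Submodule.span_singleton_le_iff_mem _ _).2 hx.1)
  · rw [X.finrank_eq, TR.finrank_eq]

theorem IsSymplectic.adjByJoin_of_adj (h : IsSymplectic ξ) (hjk : j + 1 = k) (hk : Even k)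
    (hkn : k + 2 ≤ finrank K V) {X X' : TR ξ j} (hX : (adjacency ξ j).Adj X X') :
    AdjByJoin k X X' := by
  have hj : ¬ Even j := by rwa [← hjk, Nat.even_add_one] at hk
  obtain ⟨hne, hd, hH, hreg⟩ := (h.adj_iff_of_odd hj).1 hX
  have hsup := finrank_sup_of_inf X.finrank_eq X'.finrank_eq hd
  have hperp : 1 ≤ finrank K (ξ.orthogonal (X.1 ⊔ X'.1)) := by
    have := finrank_add_finrank_orthogonal h.nondeg (X.1 ⊔ X'.1)
    omega
  -- The complement of the regular join is regular and nonzero. With X = H + ⟨x⟩ and X' = H + ⟨y⟩,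
  -- the vectors for D, E, G will be x + y + f, x + y - f and e: the first two are orthogonal, and e
  -- is orthogonal to x and y but not to them.
  obtain ⟨e, f, he, hf, hef⟩ : ∃ e f : V, e ∈ ξ.orthogonal (X.1 ⊔ X'.1) ∧
      f ∈ ξ.orthogonal (X.1 ⊔ X'.1) ∧ ξ e f ≠ 0 := by
    obtain ⟨e, f, he, hf, hef, -⟩ :=
      ((isRegular_orthogonal_iff h _).2 hreg).exists_triangular h.alt hperp
    exact ⟨_, _, he 0, hf 0, hef 0⟩
  set H := X.1 ⊓ X'.1 with hHdef
  obtain ⟨x, hx, hx0, eX⟩ := h.exists_eq_extend hj hH hd (inf_le_left : H ≤ X.1)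
  obtain ⟨y, hy, hy0, eX'⟩ := h.exists_eq_extend hj hH hd (inf_le_right : H ≤ X'.1)
  have hxX : x ∈ X.1 ⊔ X'.1 := le_sup_left (a := X.1) (by
    rw [eX]; exact le_sup_right (a := H) (Submodule.mem_span_singleton_self x))
  have hyX : y ∈ X.1 ⊔ X'.1 := le_sup_right (a := X.1) (by
    rw [eX']; exact le_sup_right (a := H) (Submodule.mem_span_singleton_self y))
  have hXX : Joinable k X X' := (h.joinable_iff hjk hk).2 ⟨hne, hd, hreg⟩
  have hxy : ξ x y ≠ 0 := by
    rw [eX, eX', h.joinable_extend_iff hjk hk] at hXX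
    exact hXX
  have hHU : H ≤ X.1 ⊔ X'.1 := inf_le_left.trans le_sup_left
  have he' : e ∈ ξ.orthogonal H := LinearMap.BilinForm.orthogonal_le hHU he
  have hf' : f ∈ ξ.orthogonal H := LinearMap.BilinForm.orthogonal_le hHU hf
  have hxe : ξ x e = 0 := he x hxX
  have hye : ξ y e = 0 := he y hyX
  have hxf : ξ x f = 0 := hf x hxX
  have hyf : ξ y f = 0 := hf y hyX
  have hex := eq_zero_comm h.alt hxe
  have hey := eq_zero_comm h.alt hye
  have hfx := eq_zero_comm h.alt hxf
  have hfy := eq_zero_comm h.alt hyf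
  have hxx : ξ x x = 0 := h.alt x
  have hyy : ξ y y = 0 := h.alt y
  have hff : ξ f f = 0 := h.alt f
  have hyx : ξ y x = -ξ x y := (h.alt.neg_eq x y).symm
  have hee : ξ e e = 0 := h.alt e
  have he0 : e ≠ 0 := fun e0 => hef (by rw [e0]; simp)
  have hd1 : x + y + f ∈ ξ.orthogonal H := add_mem (add_mem hx hy) hf'
  have hd2 : x + y - f ∈ ξ.orthogonal H := sub_mem (add_mem hx hy) hf'
  have ne0 : ∀ {z : V}, ξ x z = ξ x y → z ≠ 0 := by
    rintro z hz rfl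
    exact hxy (by rw [← hz, map_zero])
  have hd10 : x + y + f ≠ 0 := ne0 (by simp [hxx, hxf])
  have hd20 : x + y - f ≠ 0 := ne0 (by simp [hxx, hxf])
  have hfU : f ∉ X.1 ⊔ X'.1 := fun hfm => hef (by
    rw [(Submodule.mem_bot K).1 (hreg.le ⟨hfm, hf⟩), map_zero])
  have notle : ∀ {d : V} (hd1 : d ∈ ξ.orthogonal H) (hd10 : d ≠ 0), d ∉ X.1 ⊔ X'.1 →
      ∀ U : TR ξ k, X.1 ≤ U.1 → X'.1 ≤ U.1 → ¬ (hH.extend hd d hd1 hd10).1 ≤ U.1 := by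
    intro d hd1 hd10 hdU U hU hU' hle
    rw [(sup_eq_and_finrank_inf X.finrank_eq X'.finrank_eq (by rw [U.finrank_eq, hjk]) hU hU'
      fun e => hne (Subtype.ext e)).1] at hdU
    exact hdU (hle (le_sup_right (a := H) (Submodule.mem_span_singleton_self d)))
  have hxyU : x + y ∈ X.1 ⊔ X'.1 := add_mem hxX hyX
  have J := fun {v w : V} (hv : v ∈ ξ.orthogonal H) (hv0 : v ≠ 0) (hw : w ∈ ξ.orthogonal H)
    (hw0 : w ≠ 0) => h.joinable_extend_iff hjk hk hH hd hv hv0 hw hw0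
  refine ⟨hXX, hH.extend hd _ hd1 hd10, hH.extend hd _ hd2 hd20, hH.extend hd e he' he0,
    fun U hU hU' => ⟨notle _ _ (fun hm => hfU ?_) U hU hU', notle _ _ (fun hm => hfU ?_) U hU hU'⟩,
    ?_⟩
  · simpa using sub_mem hm hxyU
  · simpa using sub_mem hxyU hm
  rw [eX, eX']
  simp only [J]
  refine ⟨⟨?_, ?_, ?_, ?_⟩, ⟨?_, ?_⟩, ⟨?_, ?_⟩, ⟨?_, ?_⟩, ?_, ?_⟩
  · simpa [hxx, hfx, hyx] using hxy
  · simpa [hyy, hfy] using hxy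
  · simpa [hxx, hfx, hyx] using hxy
  · simpa [hyy, hfy] using hxy
  · simp [hxx, hyy, hxf, hfx, hyf, hfy, hff, hyx]
  -- This combination is chosen orthogonal to x + y + f; on x + y - f it takes the value 2 ξ(e, f)
  -- ξ(x, y).
  · refine hH.extend_ne hd h.alt hd1 hd10 hd2 hd20 (p := ξ e f • x - ξ x y • e)
      (sub_mem (Submodule.smul_mem _ _ hx) (Submodule.smul_mem _ _ he')) ?_ ?_
    · simp [hxx, hxf, hex, hey]; ring
    · have : ξ (ξ e f • x - ξ x y • e) (x + y - f) = 2 * (ξ e f * ξ x y) := by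
        simp [hxx, hxf, hex, hey]; ring
      rw [this]
      exact mul_ne_zero h.two_ne_zero (mul_ne_zero hef hxy)
  · simpa [hex, hey] using hef
  · simpa [hex, hey] using hef
  · simp [hex]
  · simp [hey]
  · exact hH.extend_ne hd h.alt he' he0 hx hx0 hy hye (by rw [hyx]; exact neg_ne_zero.2 hxy)
  · exact hH.extend_ne hd h.alt he' he0 hy hy0 hx hxe hxy

end Even

/-! ### Adjacency, dimension and lines expressed by cliques. -/

section Even

variable {K V : Type*} [Field K] [AddCommGroup V] [Module K V] {ξ : LinearMap.BilinForm K V}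
  {k j : ℕ} [FiniteDimensional K V]

/-- The auxiliary cliques d, e, g are stars, because each meets a star exactly once; the statement
then reads as `AdjByJoin`. -/
theorem IsSymplectic.cliqueAdj_iff (h : IsSymplectic ξ) (hjk : j + 1 = k) (hk : Even k)
    (hk2 : 2 ≤ k) (hkn : k + 2 ≤ finrank K V) {t t' : Fin 3 → TR ξ k} {X X' : TR ξ j}
    (ht : StarAt t X) (ht' : StarAt t' X') :
    CliqueAdj (adjacency ξ k).Adj t t' ↔ (adjacency ξ j).Adj X X' := by
  have M := fun {c c' : Fin 3 → TR ξ k} {Z Z' : TR ξ j} (hc : StarAt c Z) (hc' : StarAt c' Z') =>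
    h.meetOnce_iff hjk hk hkn hc hc'
  have S := fun {c c' : Fin 3 → TR ξ k} {Z Z' : TR ξ j} (hc : StarAt c Z) (hc' : StarAt c' Z') =>
    h.sameClique_iff hjk hk hkn hc hc'
  constructor
  · rintro ⟨htt, d, e, g, ⟨cd, ce, cg⟩, hU, ⟨hdt, hdt', het, het'⟩, hde, ⟨hgd, hge⟩, hgt, hn⟩
    have star : ∀ {c c' : Fin 3 → TR ξ k} {Z : TR ξ j}, StarAt c' Z →
        IsClass (adjacency ξ k).Adj c → MeetOnce (adjacency ξ k).Adj c c' →
        ∃ W : TR ξ j, StarAt c W := fun hc' hc hm =>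
      (h.starAt_or_topAt hjk hk hk2 hkn hc).resolve_right
        fun ⟨Y, hY⟩ => (h.not_meetOnce hjk hc' hY).2 hm
    obtain ⟨D, hD⟩ := star ht cd hdt
    obtain ⟨E, hE⟩ := star ht ce het
    obtain ⟨G, hG⟩ := star hD cg hgd
    rw [M ht ht'] at htt
    rw [M hD ht] at hdt
    rw [M hD ht'] at hdt'
    rw [M hE ht] at het
    rw [M hE ht'] at het'
    rw [M hD hE, S hD hE] at hde
    rw [M hG hD] at hgd
    rw [M hG hE] at hge
    rw [M hG ht, M hG ht'] at hgt
    rw [S hG ht, S hG ht'] at hn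
    refine h.adj_of_adjByJoin hjk hk ⟨htt, D, E, G, fun U hX hX' => ?_, ⟨hdt, hdt', het, het'⟩, hde,
      ⟨hgd, hge⟩, hgt, hn⟩
    rw [← hD U, ← hE U]
    exact hU U ((ht U).2 hX) ((ht' U).2 hX')
  · intro hX
    obtain ⟨htt, D, E, G, hU, hJ, hde, hgd, hgt, hn⟩ := h.adjByJoin_of_adj hjk hk hkn hX
    obtain ⟨d, cd, hD⟩ := h.exists_starAt hjk hk hkn D
    obtain ⟨e, ce, hE⟩ := h.exists_starAt hjk hk hkn E
    obtain ⟨g, cg, hG⟩ := h.exists_starAt hjk hk hkn G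
    refine ⟨(M ht ht').2 htt, d, e, g, ⟨cd, ce, cg⟩, fun z hz hz' => ?_, ?_⟩
    · rw [hD z, hE z]
      exact hU z ((ht z).1 hz) ((ht' z).1 hz')
    · rw [M hD ht, M hD ht', M hE ht, M hE ht', M hD hE, S hD hE, M hG hD, M hG hE, M hG ht,
        M hG ht', S hG ht, S hG ht']
      exact ⟨hJ, hde, hgd, hgt, hn⟩

/-- The cliques admitted are exactly the stars of hyperplanes of the regular space z, whose
dimension k bounds the triangular length. -/
theorem IsSymplectic.hasCliqueTriangular_iff (h : IsSymplectic ξ) (hjk : j + 1 = k) (hk : Even k)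
    (hk2 : 2 ≤ k) (hkn : k + 2 ≤ finrank K V) {t : Fin 3 → TR ξ k} {X : TR ξ j}
    (ht : StarAt t X) (r : ℕ) : HasCliqueTriangular (adjacency ξ k).Adj t r ↔ r ≤ k := by
  have hj : ¬ Even j := by rwa [← hjk, Nat.even_add_one] at hk
  have hd : ∀ z : TR ξ k, finrank K z.1 = j + 1 := fun z => by rw [z.finrank_eq, hjk]
  constructor
  · rintro ⟨z, hz, a, b, hab, h0⟩
    have star : ∀ c, (IsClass (adjacency ξ k).Adj c ∧ InClique (adjacency ξ k).Adj c z ∧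
        (SameClique (adjacency ξ k).Adj c t ∨ MeetOnce (adjacency ξ k).Adj c t)) →
        ∃ Z : TR ξ j, StarAt c Z ∧ Z.1 ≤ z.1 := by
      rintro c ⟨hc, hcz, hs | hm⟩
      · exact ⟨X, fun w => (hs w).trans (ht w), (ht z).1 hz⟩
      · obtain ⟨Z, hZ⟩ := (h.starAt_or_topAt hjk hk hk2 hkn hc).resolve_right
          fun ⟨Y, hY⟩ => (h.not_meetOnce hjk ht hY).2 hm
        exact ⟨Z, hZ, (hZ z).1 hcz⟩
    choose P hP hPz using fun i => star _ (hab i).1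
    choose Q hQ hQz using fun i => star _ (hab i).2.1
    rw [← hjk, ← h.hasTriangular_iff hj (h.isRegular hk z) (hd z)]
    refine ⟨P, Q, fun i => ⟨hPz i, hQz i, ?_⟩, fun i l hl => ?_⟩
    · exact (h.cliqueAdj_iff hjk hk hk2 hkn (hP i) (hQ i)).1 (hab i).2.2
    · rw [← h.cliqueAdj_iff hjk hk hk2 hkn (hP l) (hQ i)]
      exact h0 i l hl
  · intro hr
    obtain ⟨z, hz, -⟩ := h.exists_ge_not_le hjk hk X (B := ⊥) (fun e => by
      have := finrank_top K V
      rw [← e, finrank_bot] at this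
      omega)
    rw [← hjk, ← h.hasTriangular_iff hj (h.isRegular hk z) (hd z)] at hr
    obtain ⟨P, Q, hPQ, h0⟩ := hr
    choose a ca ha using fun i => h.exists_starAt hjk hk hkn (P i)
    choose b cb hb using fun i => h.exists_starAt hjk hk hkn (Q i)
    have key : ∀ {c : Fin 3 → TR ξ k} {Z : TR ξ j}, StarAt c Z → Z.1 ≤ z.1 →
        SameClique (adjacency ξ k).Adj c t ∨ MeetOnce (adjacency ξ k).Adj c t := by
      intro c Z hc hZ
      rw [h.sameClique_iff hjk hk hkn hc ht, h.meetOnce_iff hjk hk hkn hc ht]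
      exact or_iff_not_imp_left.2 fun hne => ⟨hne, z, hZ, hz⟩
    refine ⟨z, (ht z).2 hz, a, b, fun i => ⟨⟨ca i, (ha i z).2 (hPQ i).1, key (ha i) (hPQ i).1⟩,
      ⟨cb i, (hb i z).2 (hPQ i).2.1, key (hb i) (hPQ i).2.1⟩, ?_⟩, fun i l hl => ?_⟩
    · exact (h.cliqueAdj_iff hjk hk hk2 hkn (ha i) (hb i)).2 (hPQ i).2.2
    · rw [h.cliqueAdj_iff hjk hk hk2 hkn (ha l) (hb i)]
      exact h0 i l hl

theorem IsSymplectic.starAt_dual (h : IsSymplectic ξ) {l m : ℕ} (hkl : k + l = finrank K V)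
    (hjm : j + m = finrank K V) {t : Fin 3 → TR ξ k} {Y : TR ξ j} (ht : TopAt t Y) :
    StarAt (h.dual hkl ∘ t) (h.dual hjm Y) := by
  intro z
  obtain ⟨w, rfl⟩ := (h.dual hkl).surjective z
  rw [h.dual_le_iff, ← ht w]
  simp only [InClique, Function.comp_apply, ← h.adj_dual_iff, (h.dual hkl).injective.eq_iff]

theorem IsSymplectic.hasCliqueTriangular_iff_of_topAt (h : IsSymplectic ξ) {l : ℕ}
    (hkl : k + l = finrank K V) (hk : Even k) (hk2 : 2 ≤ k) (hl2 : 2 ≤ l) {t : Fin 3 → TR ξ k}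
    {Y : TR ξ (k + 1)} (ht : TopAt t Y) (r : ℕ) :
    HasCliqueTriangular (adjacency ξ k).Adj t r ↔ r ≤ l := by
  have hl : Even l := by
    have := h.even_finrank
    rw [← hkl, Nat.even_add] at this
    exact this.1 hk
  have e := (uniformlyDefinable_hasCliqueTriangular (id : Fin 3 → Fin 3) r).iff_of_equiv
    (h.dual hkl) (fun a b => h.adj_dual_iff hkl) t
  exact e.trans (h.hasCliqueTriangular_iff (j := l - 1) (by omega) hl hl2 (by omega)
    (h.starAt_dual hkl (by omega) ht) r)

theorem IsSymplectic.adj_hyperplane_iff_not_mem (h : IsSymplectic ξ) (hj : ¬ Even j)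
    {Y : Submodule K V} (hY : IsRegular ξ Y) (hd : finrank K Y = j + 1) {z : V} (hz : z ∈ Y)
    (hz0 : z ≠ 0) {X : TR ξ j} (hX : X.1 ≤ Y) :
    (adjacency ξ j).Adj (hyperplane h.alt hY hd z hz hz0) X ↔ z ∉ X.1 := by
  obtain ⟨x, hx, hx0, rfl⟩ := h.exists_eq_hyperplane hY hd hX
  rw [h.adj_hyperplane_iff hj]
  refine not_congr ⟨fun hzx => ?_, fun hm => ?_⟩
  · exact mem_perpIn.2 ⟨hz, eq_zero_comm h.alt hzx⟩
  · exact eq_zero_comm h.alt (mem_perpIn.1 hm).2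

/-- Inside the regular U, a hyperplane with pole z is non-adjacent to X exactly if z ∈ X. So the
condition on Z says X ⊓ X' ≤ X'', and U is forced to be X ⊔ X'. -/
theorem IsSymplectic.mem_line_iff_of_odd (h : IsSymplectic ξ) (hjk : j + 1 = k) (hk : Even k)
    {X X' X'' : TR ξ j} (hX : (adjacency ξ j).Adj X X') :
    (∃ U : TR ξ k, X.1 ≤ U.1 ∧ X'.1 ≤ U.1 ∧ X''.1 ≤ U.1 ∧ ∀ Z : TR ξ j, Z.1 ≤ U.1 →
      ¬ (adjacency ξ j).Adj Z X → ¬ (adjacency ξ j).Adj Z X' → ¬ (adjacency ξ j).Adj Z X'') ↔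
    (X.1 ⊓ X'.1 ≤ X''.1 ∧ X''.1 ≤ X.1 ⊔ X'.1) := by
  have hj : ¬ Even j := by rwa [← hjk, Nat.even_add_one] at hk
  obtain ⟨hne, hdX, -, hreg⟩ := (h.adj_iff_of_odd hj).1 hX
  constructor
  · rintro ⟨U, h1, h2, h3, hU⟩
    have hd : finrank K U.1 = j + 1 := by rw [U.finrank_eq, hjk]
    have hY := h.isRegular hk U
    refine ⟨fun z hz => ?_, ?_⟩
    · by_cases hz0 : z = 0
      · rw [hz0]; exact zero_mem _
      have := hU (hyperplane h.alt hY hd z (h1 hz.1) hz0) (hyperplane_le h.alt hY hd _ hz0)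
      rw [h.adj_hyperplane_iff_not_mem hj hY hd _ hz0 h1,
        h.adj_hyperplane_iff_not_mem hj hY hd _ hz0 h2,
        h.adj_hyperplane_iff_not_mem hj hY hd _ hz0 h3] at this
      exact not_not.1 (this (not_not.2 hz.1) (not_not.2 hz.2))
    · rwa [(sup_eq_and_finrank_inf X.finrank_eq X'.finrank_eq hd h1 h2
        fun e => hne (Subtype.ext e)).1]
  · rintro ⟨hle, hle'⟩
    have hd := finrank_sup_of_inf X.finrank_eq X'.finrank_eq hdX
    refine ⟨TR.of (X.1 ⊔ X'.1) (hd.trans hjk)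
      (by rw [isRegular_iff_finrank.1 hreg]; exact zero_le_one), le_sup_left, le_sup_right, hle',
      fun Z hZ => ?_⟩
    obtain ⟨z, hz, hz0, rfl⟩ := h.exists_eq_hyperplane hreg hd hZ
    rw [h.adj_hyperplane_iff_not_mem hj hreg hd hz hz0 le_sup_left,
      h.adj_hyperplane_iff_not_mem hj hreg hd hz hz0 le_sup_right,
      h.adj_hyperplane_iff_not_mem hj hreg hd hz hz0 hle', not_not, not_not, not_not]
    exact fun h1 h2 => hle ⟨h1, h2⟩

end Even

/-- Elements of dimension k - 1 are coded by class triples whose clique is a star. Tops are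
discarded by `Ty`, which compares the triangular lengths k and n - k. -/
theorem definableFromAdjacency_even {n k : ℕ} (hk : Even k) (hk2 : 2 ≤ k) (hkn : k + 2 ≤ n)
    (hne : k ≠ n - k) : DefinableFromAdjacency.{u, v} n k (k - 1) := by
  obtain ⟨Ty, hTy, hsep⟩ := exists_separating (m := 3) hne
    (P := fun r M A t => HasCliqueTriangular A t r)
    fun r _ t => uniformlyDefinable_hasCliqueTriangular.{v} t r
  have hDom : ∀ {α : Type} (t : Fin 3 → α), UniformlyDefinable.{v} fun M A x =>
      IsClass A (x ∘ t) ∧ Ty M A (x ∘ t) := fun t => (uniformlyDefinable_isClass t).and (hTy t)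
  refine definableFromAdjacency_of_points (m := 3)
    (Dom := fun M A t => IsClass A t ∧ Ty M A t)
    (Mem := fun M A t c => InClique A t c)
    (Ad := fun M A t t' => CliqueAdj A t t')
    (Inc := fun M A t t' t'' => ∃ U, InClique A t U ∧ InClique A t' U ∧ InClique A t'' U ∧
      ∀ z : Fin 3 → M, (IsClass A z ∧ Ty M A z) → InClique A z U → ¬ CliqueAdj A z t →
        ¬ CliqueAdj A z t' → ¬ CliqueAdj A z t'')
    hDom uniformlyDefinable_inClique uniformlyDefinable_cliqueAdj ?_ ?_
  · intro α t t' t''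
    have hI := fun (c : Fin 3 → α) =>
      uniformlyDefinable_inClique.{v} (Sum.inl ∘ c) (Sum.inr () : α ⊕ Unit)
    have hC := fun (c : Fin 3 → α) => (uniformlyDefinable_cliqueAdj.{v}
      (Sum.inr : Fin 3 → (α ⊕ Unit) ⊕ Fin 3) (Sum.inl ∘ Sum.inl ∘ c)).not
    exact .exists_elem (.and (hI t) (.and (hI t') (.and (hI t'') (.forall_tuple
      (.imp (hDom Sum.inr) (.imp (uniformlyDefinable_inClique Sum.inr (Sum.inl (Sum.inr ())))
        (.imp (hC t) (.imp (hC t') (hC t'')))))))))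
  intro K V _ _ _ ξ hξ
  have := hξ.2.1
  have hs := hξ.isSymplectic
  have hn := hξ.2.2.1
  have hjk : k - 1 + 1 = k := by omega
  have hkn' : k + 2 ≤ finrank K V := by omega
  have hstar : ∀ t : {t : Fin 3 → TR ξ k // IsClass (adjacency ξ k).Adj t ∧
      Ty _ (adjacency ξ k).Adj t}, ∃ X : TR ξ (k - 1), StarAt t.1 X := fun t =>
    (hs.starAt_or_topAt hjk hk hk2 hkn' t.2.1).resolve_right fun ⟨Y, hY⟩ =>
      (hsep _ _ t.1).2 (hs.hasCliqueTriangular_iff_of_topAt (by omega) hk hk2 (by omega) hY) t.2.2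
  choose f hf using hstar
  have hsurj : ∀ X, ∃ t, f t = X := by
    intro X
    obtain ⟨t, ct, ht⟩ := hs.exists_starAt hjk hk hkn' X
    refine ⟨⟨t, ct, (hsep _ _ t).1 (hs.hasCliqueTriangular_iff hjk hk hk2 hkn' ht)⟩, ?_⟩
    exact (hs.sameClique_iff hjk hk hkn' (hf _) ht).1 fun _ => Iff.rfl
  have hadj := fun t t' => hs.cliqueAdj_iff hjk hk hk2 hkn' (hf t) (hf t')
  refine ⟨f, hsurj, fun t U => ?_, fun t t' hU => ?_, hadj, fun t t' t'' hX => ?_⟩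
  · rw [hf t U, or_iff_left]
    intro hle
    have := Submodule.finrank_mono hle
    rw [U.finrank_eq, TR.finrank_eq] at this
    omega
  · exact (hs.sameClique_iff hjk hk hkn' (hf t) (hf t')).1 hU
  · rw [← hs.mem_line_iff_of_odd hjk hk hX]
    refine exists_congr fun U => and_congr (hf t U) (and_congr (hf t' U) (and_congr (hf t'' U) ?_))
    constructor
    · intro hz Z hZ
      obtain ⟨z, rfl⟩ := hsurj Z
      have := hz z.1 z.2 ((hf z U).2 hZ)
      rwa [hadj, hadj, hadj] at this
    · intro hZ z hz hzU
      have := hZ (f ⟨z, hz⟩) ((hf ⟨z, hz⟩ U).1 hzU)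
      rwa [← hadj, ← hadj, ← hadj] at this

/-! ### Reduction of all cases by parity and duality. -/

theorem definableFromAdjacency_of_odd {n k j : ℕ} (hn : ¬ Even n) :
    DefinableFromAdjacency.{u, v} n k j := by
  -- No symplectic space has odd dimension, so any scheme will do.
  refine ⟨⟨0, 0, ⊥, ⊥, ⊥, ⊥, ⊥, ⊥⟩, fun K V _ _ _ ξ hξ => absurd ?_ hn⟩
  have := hξ.2.1
  rw [← hξ.2.2.1]
  exact hξ.isSymplectic.even_finrank

theorem definableFromAdjacency_add_one_of_odd {n k : ℕ} (hk : ¬ Even k) (hkn : k + 3 ≤ n)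
    (hne : k ≠ n - k) : DefinableFromAdjacency.{u, v} n k (k + 1) := by
  obtain rfl | hk3 : k = 1 ∨ 3 ≤ k := by
    rcases Nat.not_even_iff_odd.1 hk with ⟨m, rfl⟩
    omega
  · exact definableFromAdjacency_one_two (by omega)
  · exact definableFromAdjacency_odd hk hk3 hkn hne

theorem definableFromAdjacency_pred {n k : ℕ} (hk : 1 < k) (hkn : k < n) (hne : k ≠ n - k) :
    DefinableFromAdjacency.{u, v} n k (k - 1) := by
  by_cases hn : Even n
  swap
  · exact definableFromAdjacency_of_odd hn
  by_cases he : Even k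
  · refine definableFromAdjacency_even he hk ?_ hne
    rcases hn with ⟨a, rfl⟩
    rcases he with ⟨b, rfl⟩
    omega
  · have hnk : ¬ Even (n - k) := by rwa [Nat.even_sub hkn.le, iff_true_left hn]
    -- For odd k, descending from k is dual to ascending from the odd number n - k; the bound n - k
    -- + 3 ≤ n holds since an odd k > 1 is at least 3.
    have h := (definableFromAdjacency_add_one_of_odd.{u, v} (n := n) hnk (by
      rcases hn with ⟨a, rfl⟩
      rcases Nat.not_even_iff_odd.1 he with ⟨b, rfl⟩
      omega) (by omega)).dual (by omega) (by omega)
    rwa [show n - (n - k) = k by omega, show n - (n - k + 1) = k - 1 by omega] at h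

theorem definableFromAdjacency_add_one {n k : ℕ} (hk : 1 ≤ k) (hkn : k + 1 < n)
    (hne : k ≠ n - k) : DefinableFromAdjacency.{u, v} n k (k + 1) := by
  have h := (definableFromAdjacency_pred.{u, v} (n := n) (k := n - k) (by omega) (by omega)
    (by omega)).dual (by omega) (by omega)
  rwa [show n - (n - k) = k by omega, show n - (n - k - 1) = k + 1 by omega] at h

end SympGrassmann

theorem proposition2 (n k : ℕ) (hk1 : 1 ≤ k) (hkn : k ≤ n - 1) (hk : k ≠ n - k) :
    (1 < k →
      SympGrassmann.DefinableFromAdjacency.{u, v} n k (k - 1) ∧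
      SympGrassmann.DefinableFromGrassmann.{u, v} n k (k - 1)) ∧
    (k < n - 1 →
      SympGrassmann.DefinableFromAdjacency.{u, v} n k (k + 1) ∧
      SympGrassmann.DefinableFromGrassmann.{u, v} n k (k + 1)) := by
  refine ⟨fun h => ?_, fun h => ?_⟩
  · have := SympGrassmann.definableFromAdjacency_pred.{u, v} h (by omega) hk
    exact ⟨this, this.definableFromGrassmann⟩
  · have := SympGrassmann.definableFromAdjacency_add_one.{u, v} hk1 (by omega) hk
    exact ⟨this, this.definableFromGrassmann⟩
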